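/- Let $\mathscr V$ be a complete symmetric monoidal closed category and let $\mathscr A$ be a small monoidal $\mathscr V$-category, with tensor product $\otimes$ and unit $I$. Let $\mathscr M=[\mathscr A^{\mathrm{op}}\otimes\mathscr A,\mathscr V]$ be the $\mathscr V$-category of $\mathscr V$-functors $\mathscr A^{\mathrm{op}}\otimes\mathscr A\to\mathscr V$. (As usual, associativity and unit isomorphisms of $\mathscr A$ are suppressed from the notation.) Consider the following $\mathscr V$-comonads on $\mathscr M$. * $\Theta_l(T)(X,Y)=\int_A T(A\otimes X,A\otimes Y)$, with counit $\Theta_l(T)(X,Y)\to T(X,Y)$ the projection at $A=I$, and with comultiplication $\Theta_l\to\Theta_l\Theta_l$ whose composite with the projection to $T(B\otimes C\otimes X,B\otimes C\otimes Y)$ is the projection at $A=B\otimes C$. * $\Theta_r(T)(X,Y)=\int_B T(X\otimes B,Y\otimes B)$, with the analogous structure. * $\Theta=\Theta_r\Theta_l$, so that $\Theta(T)(X,Y)=\int_{A,B}T(A\otimes X\otimes B,A\otimes Y\otimes B)$, the composite comonad for the distributive law $\Theta_r\Theta_l\cong\Theta_l\Theta_r$ given by interchange of ends and the associativity isomorphism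 $(A\otimes X)\otimes B\cong A\otimes (X\otimes B)$. A left Tambara module on $\mathscr A$ is a $\mathscr V$-functor $T:\mathscr A^{\mathrm{op}}\otimes\mathscr A\to\mathscr V$ with morphisms $\alpha_l(A,X,Y):T(X,Y)\to T(A\otimes X,A\otimes Y)$, $\mathscr V$-natural in each of $A,X,Y$, such that $\alpha_l(I,X,Y)=1$ and $\alpha_l(A\otimes A',X,Y)=\alpha_l(A,A'\otimes X,A'\otimes Y)\circ\alpha_l(A',X,Y)$. A right Tambara module is defined likewise, with morphisms $\alpha_r(B,X,Y):T(X,Y)\to T(X\otimes B,Y\otimes B)$. A Tambara module is a $T$ with a left and a right structure such that $\alpha_r(B,A\otimes X,A\otimes Y)\circ\alpha_l(A,X,Y)=\alpha_l(A,X\otimes B,Y\otimes B)\circ\alpha_r(B,X,Y)$. Let $\mathrm{LTamb}(\mathscr A)$, $\mathrm{RTamb}(\mathscr A)$ and $\mathrm{Tamb}(\mathscr A)$ be the $\mathscr V$-categories of left, right and all Tambara modules; the hom-object $\mathrm{LTamb}(\mathscr A)(T,T')$ is the intersection over all $A,X,Y$ of the equalizers of the pairs $$\mathscr V(\alpha_l,1)\circ\mathrm{pr}_{A\otimes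 X,A\otimes Y},\ \ \mathscr V(1,\alpha_l)\circ\mathrm{pr}_{X,Y}:\ \mathscr M(T,T')\longrightarrow\mathscr V(T(X,Y),T'(A\otimes X,A\otimes Y)),$$ and the other two are defined likewise. Then there are isomorphisms of $\mathscr V$-categories, commuting with the forgetful $\mathscr V$-functors to $\mathscr M$, from the $\mathscr V$-categories of Eilenberg–Moore coalgebras: $$\mathscr M^{\Theta_l}\cong\mathrm{LTamb}(\mathscr A),\qquad \mathscr M^{\Theta_r}\cong\mathrm{RTamb}(\mathscr A),\qquad \mathscr M^{\Theta}\cong\mathrm{Tamb}(\mathscr A).$$ -/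

import Mathlib

open CategoryTheory MonoidalCategory Limits

universe w v u u₁ u₂ u₃ u₄

set_option linter.unusedSectionVars false

noncomputable section

namespace VTamb
/-- The hom-object of a `V`-category. -/
notation:50 X:51 " ⟶ᵥ " Y:51 => EnrichedCategory.Hom X Y

attribute [local instance] MonoidalClosed.enrichedCategorySelf

section Action

variable {V : Type u} [Category.{v} V] [MonoidalCategory V] [SymmetricCategory V]

/-- The symmetry exchanging the last two factors of `(X ⊗ W) ⊗ U`. -/
def sw (X W U : V) : (X ⊗ W) ⊗ U ⟶ (X ⊗ U) ⊗ W :=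
  (α_ X W U).hom ≫ X ◁ (β_ W U).hom ≫ (α_ X U W).inv

@[simp]
lemma sw_sw (X W U : V) : sw X W U ≫ sw X U W = 𝟙 _ := by
  simp [sw, ← MonoidalCategory.whiskerLeft_comp_assoc]

lemma sw_nat_left {X X' : V} (f : X ⟶ X') (W U : V) :
    f ▷ W ▷ U ≫ sw X' W U = sw X W U ≫ f ▷ U ▷ W := by
  simp only [sw, associator_naturality_left_assoc, Category.assoc,
    ← associator_inv_naturality_left, whisker_exchange_assoc]

lemma sw_nat_mid (X : V) {W W' : V} (f : W ⟶ W') (U : V) :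
    (X ◁ f) ▷ U ≫ sw X W' U = sw X W U ≫ (X ⊗ U) ◁ f := by
  simp only [sw, associator_naturality_middle_assoc, Category.assoc,
    ← associator_inv_naturality_right]
  simp only [← MonoidalCategory.whiskerLeft_comp_assoc, BraidedCategory.braiding_naturality_left]

lemma sw_nat_right (X W : V) {U U' : V} (f : U ⟶ U') :
    (X ⊗ W) ◁ f ≫ sw X W U' = sw X W U ≫ (X ◁ f) ▷ W := by
  simp only [sw, associator_naturality_right_assoc, Category.assoc,
    ← associator_inv_naturality_middle]
  simp only [← MonoidalCategory.whiskerLeft_comp_assoc, BraidedCategory.braiding_naturality_right]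

lemma sw_unit (X U : V) : sw X (𝟙_ V) U = (ρ_ X).hom ▷ U ≫ (ρ_ (X ⊗ U)).inv := by
  simp [sw]

lemma sw_unit' (X U : V) : sw X U (𝟙_ V) = (ρ_ (X ⊗ U)).hom ≫ (ρ_ X).inv ▷ U := by
  simp [sw]

lemma sw_tensor (X W₁ W₂ U : V) :
    (α_ X W₁ W₂).inv ▷ U ≫ sw (X ⊗ W₁) W₂ U ≫ sw X W₁ U ▷ W₂ =
      sw X (W₁ ⊗ W₂) U ≫ (α_ (X ⊗ U) W₁ W₂).inv := by
  simp [sw]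

lemma sw_tensor' (X W U₁ U₂ : V) :
    sw X W (U₁ ⊗ U₂) ≫ (α_ X U₁ U₂).inv ▷ W =
     (α_ (X ⊗ W) U₁ U₂).inv ≫ sw X W U₁ ▷ U₂ ≫ sw (X ⊗ U₁) W U₂  := by
  simp [sw]

variable [MonoidalClosed V]

lemma uncurry_comp_aux {X Y Z W U : V} (f : W ⟶ (ihom X).obj Y) (g : U ⟶ (ihom Y).obj Z) :
    MonoidalClosed.uncurry ((f ⊗ₘ g) ≫ MonoidalClosed.comp X Y Z) =
      (α_ X W U).inv ≫ MonoidalClosed.uncurry f ▷ U ≫ MonoidalClosed.uncurry g := by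
  rw [MonoidalClosed.uncurry_natural_left, MonoidalClosed.comp_eq,
    MonoidalClosed.uncurry_curry, MonoidalClosed.compTranspose_eq,
    MonoidalClosed.uncurry_eq, MonoidalClosed.uncurry_eq, ← id_tensorHom,
    associator_inv_naturality_assoc, MonoidalCategory.tensorHom_def]
  simp only [id_tensorHom, comp_whiskerRight, Category.assoc, whisker_exchange_assoc]
  rfl

lemma uncurry_comp' {X Y Z W U : V} (f : W ⟶ (X ⟶ᵥ Y)) (g : U ⟶ (Y ⟶ᵥ Z)) :
    MonoidalClosed.uncurry ((f ⊗ₘ g) ≫ eComp V X Y Z) =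
      (α_ X W U).inv ≫ MonoidalClosed.uncurry f ▷ U ≫ MonoidalClosed.uncurry g :=
  uncurry_comp_aux f g

lemma uncurry_id' (X : V) : MonoidalClosed.uncurry (eId V X) = (ρ_ X).hom := by
  rw [MonoidalClosed.enrichedCategorySelf_id]
  exact MonoidalClosed.uncurry_curry _

variable {C : Type u₁} [EnrichedCategory V C]

/-- The action of a `V`-functor `F : C ⟶ V` on homs, in uncurried form. -/
def act (F : EnrichedFunctor V C V) (c d : C) : F.obj c ⊗ (c ⟶ᵥ d) ⟶ F.obj d :=
  MonoidalClosed.uncurry (F.map c d)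

@[simp]
lemma act_id (F : EnrichedFunctor V C V) (c : C) :
    F.obj c ◁ eId V c ≫ act F c c = (ρ_ _).hom := by
  rw [act, ← MonoidalClosed.uncurry_natural_left, F.map_id, uncurry_id']

lemma act_comp (F : EnrichedFunctor V C V) (c d e : C) :
    F.obj c ◁ eComp V c d e ≫ act F c e =
      (α_ _ _ _).inv ≫ act F c d ▷ _ ≫ act F d e := by
  rw [act, ← MonoidalClosed.uncurry_natural_left, F.map_comp, uncurry_comp']; rfl

/-- Build a `V`-functor into `V` from an action on homs. -/
@[simps obj]
def ofAct (obj : C → V) (a : ∀ c d, obj c ⊗ (c ⟶ᵥ d) ⟶ obj d)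
    (h_id : ∀ c, obj c ◁ eId V c ≫ a c c = (ρ_ _).hom)
    (h_comp : ∀ c d e, obj c ◁ eComp V c d e ≫ a c e =
      (α_ _ _ _).inv ≫ a c d ▷ _ ≫ a d e) : EnrichedFunctor V C V where
  obj := obj
  map c d := MonoidalClosed.curry (a c d)
  map_id c := by
    apply MonoidalClosed.uncurry_injective
    rw [MonoidalClosed.uncurry_natural_left, MonoidalClosed.uncurry_curry, uncurry_id', h_id]
  map_comp c d e := by
    apply MonoidalClosed.uncurry_injective
    rw [MonoidalClosed.uncurry_natural_left, MonoidalClosed.uncurry_curry, uncurry_comp',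
      h_comp, MonoidalClosed.uncurry_curry, MonoidalClosed.uncurry_curry]

@[simp]
lemma act_ofAct (obj : C → V) (a : ∀ c d, obj c ⊗ (c ⟶ᵥ d) ⟶ obj d) (h_id) (h_comp) (c d : C) :
    act (ofAct obj a h_id h_comp) c d = a c d :=
  MonoidalClosed.uncurry_curry _

/-- The action of a generalised element `f : W ⟶ C(c, d)`. -/
def actOn (F : EnrichedFunctor V C V) {c d : C} {W : V} (f : W ⟶ (c ⟶ᵥ d)) :
    F.obj c ⊗ W ⟶ F.obj d :=
  F.obj c ◁ f ≫ act F c d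

lemma actOn_pre (F : EnrichedFunctor V C V) {c d : C} {W W' : V} (g : W' ⟶ W)
    (f : W ⟶ (c ⟶ᵥ d)) : actOn F (g ≫ f) = F.obj c ◁ g ≫ actOn F f := by
  simp [actOn]

@[simp]
lemma actOn_id (F : EnrichedFunctor V C V) (c : C) :
    actOn F (eId V c) = (ρ_ _).hom := act_id F c

lemma actOn_comp (F : EnrichedFunctor V C V) {c d e : C} {W U : V} (f : W ⟶ (c ⟶ᵥ d))
    (g : U ⟶ (d ⟶ᵥ e)) : actOn F ((f ⊗ₘ g) ≫ eComp V c d e) =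
      (α_ _ _ _).inv ≫ actOn F f ▷ U ≫ actOn F g := by
  simp only [actOn, MonoidalCategory.whiskerLeft_comp, Category.assoc, act_comp,
    comp_whiskerRight]
  rw [← id_tensorHom, associator_inv_naturality_assoc, MonoidalCategory.tensorHom_def]
  simp only [id_tensorHom, Category.assoc, whisker_exchange_assoc]

lemma act_eq_actOn (F : EnrichedFunctor V C V) (c d : C) : act F c d = actOn F (𝟙 _) := by
  simp [actOn]

/-- The action of an element `f : 𝟙 ⟶ C(c, d)`. -/
def actEl (F : EnrichedFunctor V C V) {c d : C} (f : 𝟙_ V ⟶ (c ⟶ᵥ d)) : F.obj c ⟶ F.obj d :=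
  (ρ_ _).inv ≫ actOn F f

end Action

section Tensor

variable (V : Type u) [Category.{v} V] [MonoidalCategory V] [SymmetricCategory V]

/-- Objects of the tensor product `C ⊗ D` of two `V`-categories. -/
structure TensorCat (C : Type u₁) (D : Type u₂) : Type max u₁ u₂ where
  fst : C
  snd : D

variable {V} in
lemma tensorμ_braiding (X₁ X₂ Y₁ Y₂ : V) :
    tensorμ X₁ X₂ Y₁ Y₂ ≫ ((β_ X₁ Y₁).hom ⊗ₘ (β_ X₂ Y₂).hom) =
      (β_ (X₁ ⊗ X₂) (Y₁ ⊗ Y₂)).hom ≫ tensorμ Y₁ Y₂ X₁ X₂ := by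
  have h : (β_ X₁ Y₂).hom ▷ X₂ ≫ (β_ Y₂ X₁).hom ▷ X₂ = 𝟙 _ := by
    rw [← comp_whiskerRight, SymmetricCategory.symmetry, id_whiskerRight]
  simp only [tensorμ, Category.assoc,
    BraidedCategory.braiding_tensor_right_hom, BraidedCategory.braiding_tensor_left_hom,
    comp_whiskerRight, whisker_assoc, MonoidalCategory.whiskerLeft_comp, pentagon_assoc,
    pentagon_inv_hom_hom_hom_inv_assoc, Iso.inv_hom_id_assoc, whiskerLeft_hom_inv_assoc]
  rw [← MonoidalCategory.whiskerLeft_comp_assoc Y₁ ((β_ X₁ Y₂).hom ▷ X₂), h,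
    MonoidalCategory.tensorHom_def]
  monoidal

variable {C : Type u₁} [EnrichedCategory V C] {D : Type u₂} [EnrichedCategory V D]
  {C' : Type u₃} [EnrichedCategory V C'] {D' : Type u₄} [EnrichedCategory V D']

/-- The tensor product of `V`-categories:
`(C ⊗ D)((c, d), (c', d')) = C(c, c') ⊗ D(d, d')`. -/
instance : EnrichedCategory V (TensorCat C D) where
  Hom x y := (x.fst ⟶ᵥ y.fst) ⊗ (x.snd ⟶ᵥ y.snd)
  id x := (λ_ (𝟙_ V)).inv ≫ (eId V x.fst ⊗ₘ eId V x.snd)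
  comp x y z := tensorμ _ _ _ _ ≫ (eComp V x.fst y.fst z.fst ⊗ₘ eComp V x.snd y.snd z.snd)
  id_comp x y := by
    rw [Iso.inv_comp_eq, comp_whiskerRight_assoc, tensorμ_natural_left_assoc,
      tensorHom_comp_tensorHom, Category.comp_id, tensor_left_unitality]
    congr 3 <;> rw [← Iso.inv_comp_eq_id, e_id_comp]
  comp_id x y := by
    rw [Iso.inv_comp_eq, MonoidalCategory.whiskerLeft_comp_assoc, tensorμ_natural_right_assoc,
      tensorHom_comp_tensorHom, Category.comp_id, tensor_right_unitality]
    congr 3 <;> rw [← Iso.inv_comp_eq_id, e_comp_id]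
  assoc w x y z := by
    rw [Iso.inv_comp_eq, comp_whiskerRight_assoc, MonoidalCategory.whiskerLeft_comp_assoc,
      tensorμ_natural_left_assoc, tensorμ_natural_right_assoc, tensorHom_comp_tensorHom,
      tensorHom_comp_tensorHom, ← e_assoc', ← e_assoc', ← tensorHom_comp_tensorHom,
      ← tensorHom_comp_tensorHom, tensor_associativity_assoc]

lemma tensor_eId (x : TensorCat C D) :
    eId V x = (λ_ (𝟙_ V)).inv ≫ (eId V x.fst ⊗ₘ eId V x.snd) := rfl

lemma tensor_eComp (x y z : TensorCat C D) : eComp V x y z =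
    tensorμ _ _ _ _ ≫ (eComp V x.fst y.fst z.fst ⊗ₘ eComp V x.snd y.snd z.snd) := rfl

/-- `D(d, d') ⟶ (C ⊗ D)((c, d), (c, d'))`. -/
def insR (c : C) (d d' : D) :
    (d ⟶ᵥ d') ⟶ (EnrichedCategory.Hom (V := V) (TensorCat.mk c d) (TensorCat.mk c d')) :=
  (λ_ _).inv ≫ eId V c ▷ _

/-- `C(c, c') ⟶ (C ⊗ D)((c, d), (c', d))`. -/
def insL (c c' : C) (d : D) :
    (c ⟶ᵥ c') ⟶ (EnrichedCategory.Hom (V := V) (TensorCat.mk c d) (TensorCat.mk c' d)) :=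
  (ρ_ _).inv ≫ _ ◁ eId V d

lemma insL_insR (c c' : C) (d d' : D) :
    (insL V c c' d ⊗ₘ insR V c' d d') ≫ eComp V _ _ _ = 𝟙 _ := by
  have h : ((ρ_ (c ⟶ᵥ c' : V)).inv ⊗ₘ (λ_ (d ⟶ᵥ d' : V)).inv) ≫ tensorμ _ _ _ _ =
      ((ρ_ _).inv ⊗ₘ (λ_ _).inv) := by
    simp [tensorμ, ← unitors_equal]
  rw [tensor_eComp, insL, insR, ← tensorHom_comp_tensorHom, Category.assoc,
    ← tensorHom_id, ← id_tensorHom, tensorμ_natural_assoc, tensorHom_comp_tensorHom,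
    reassoc_of% h, tensorHom_comp_tensorHom, tensorHom_id, id_tensorHom, e_comp_id, e_id_comp,
    id_tensorHom_id]

lemma insR_insL (c c' : C) (d d' : D) :
    (insR V c d d' ⊗ₘ insL V c c' d') ≫ eComp V _ _ _ = (β_ _ _).hom := by
  have h : ((λ_ (d ⟶ᵥ d' : V)).inv ⊗ₘ (ρ_ (c ⟶ᵥ c' : V)).inv) ≫ tensorμ _ _ _ _ =
      (β_ _ _).hom ≫ ((λ_ _).inv ⊗ₘ (ρ_ _).inv) := by
    simp only [tensorμ]
    monoidal
  rw [tensor_eComp, insL, insR, ← tensorHom_comp_tensorHom, Category.assoc,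
    ← tensorHom_id, ← id_tensorHom, tensorμ_natural_assoc, tensorHom_comp_tensorHom,
    reassoc_of% h, tensorHom_comp_tensorHom, tensorHom_id, id_tensorHom, e_comp_id, e_id_comp,
    id_tensorHom_id]
  exact Category.comp_id _

/-- The `V`-functor `(c, -) : D ⟶ C ⊗ D`. -/
@[simps]
def insRFunctor (C : Type u₁) [EnrichedCategory V C] (D : Type u₂) [EnrichedCategory V D] (c : C) :
    EnrichedFunctor V D (TensorCat C D) where
  obj d := ⟨c, d⟩
  map d d' := insR V c d d'
  map_id d := by
    rw [insR, tensor_eId, leftUnitor_inv_naturality_assoc, MonoidalCategory.tensorHom_def']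
  map_comp d d' d'' := by
    have h : ((λ_ (d ⟶ᵥ d' : V)).inv ⊗ₘ (λ_ (d' ⟶ᵥ d'' : V)).inv) ≫ tensorμ _ _ _ _ =
        (λ_ _).inv ≫ (λ_ (𝟙_ V)).inv ▷ _ := by
      rw [← cancel_mono ((λ_ (𝟙_ V)).hom ▷ _), ← cancel_mono (λ_ _).hom]
      simp only [Category.assoc, ← leftUnitor_monoidal, tensorHom_comp_tensorHom]
      simp
    have h2 : (λ_ (𝟙_ V)).inv ≫ (eId V c ⊗ₘ eId V c) ≫ eComp V c c c = eId V c := by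
      rw [MonoidalCategory.tensorHom_def'_assoc, ← leftUnitor_inv_naturality_assoc, e_id_comp,
        Category.comp_id]
    rw [tensor_eComp, insR, insR, insR, ← tensorHom_comp_tensorHom, Category.assoc,
      ← tensorHom_id (eId V c) (d ⟶ᵥ d'), ← tensorHom_id (eId V c) (d' ⟶ᵥ d''), tensorμ_natural_assoc, tensorHom_comp_tensorHom, reassoc_of% h,
      ← tensorHom_id (λ_ (𝟙_ V)).inv, tensorHom_comp_tensorHom, h2, leftUnitor_inv_naturality_assoc,
      whisker_exchange, MonoidalCategory.tensorHom_def', id_tensorHom_id, Category.id_comp,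
      Category.id_comp]
    exact congrArg _ (whisker_exchange (eId V c) (eComp V d d' d'')).symm

/-- The `V`-functor `(-, d) : C ⟶ C ⊗ D`. -/
@[simps]
def insLFunctor (C : Type u₁) [EnrichedCategory V C] (D : Type u₂) [EnrichedCategory V D] (d : D) :
    EnrichedFunctor V C (TensorCat C D) where
  obj c := ⟨c, d⟩
  map c c' := insL V c c' d
  map_id c := by
    rw [insL, tensor_eId, rightUnitor_inv_naturality_assoc, MonoidalCategory.tensorHom_def,
      unitors_inv_equal]
  map_comp c c' c'' := by
    have h : ((ρ_ (c ⟶ᵥ c' : V)).inv ⊗ₘ (ρ_ (c' ⟶ᵥ c'' : V)).inv) ≫ tensorμ _ _ _ _ =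
        (ρ_ _).inv ≫ _ ◁ (λ_ (𝟙_ V)).inv := by
      rw [← cancel_mono (_ ◁ (λ_ (𝟙_ V)).hom), ← cancel_mono (ρ_ _).hom]
      simp only [Category.assoc, ← rightUnitor_monoidal, tensorHom_comp_tensorHom]
      simp
    have h2 : (λ_ (𝟙_ V)).inv ≫ (eId V d ⊗ₘ eId V d) ≫ eComp V d d d = eId V d := by
      rw [MonoidalCategory.tensorHom_def'_assoc, ← leftUnitor_inv_naturality_assoc, e_id_comp,
        Category.comp_id]
    rw [tensor_eComp, insL, insL, insL, ← tensorHom_comp_tensorHom, Category.assoc,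
      ← id_tensorHom (c ⟶ᵥ c') (eId V d), ← id_tensorHom (c' ⟶ᵥ c'') (eId V d),
      tensorμ_natural_assoc, tensorHom_comp_tensorHom, reassoc_of% h,
      ← id_tensorHom _ (λ_ (𝟙_ V)).inv, tensorHom_comp_tensorHom, h2, rightUnitor_inv_naturality_assoc,
      ← whisker_exchange, MonoidalCategory.tensorHom_def, id_tensorHom_id, Category.id_comp,
      Category.id_comp]
    exact congrArg _ (whisker_exchange (eComp V c c' c'') (eId V d))

/-- The tensor product of two `V`-functors. -/
@[simps]
def tensorFunctor (F : EnrichedFunctor V C C') (G : EnrichedFunctor V D D') :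
    EnrichedFunctor V (TensorCat C D) (TensorCat C' D') where
  obj x := ⟨F.obj x.fst, G.obj x.snd⟩
  map x y := F.map x.fst y.fst ⊗ₘ G.map x.snd y.snd
  map_id x := by
    rw [tensor_eId, tensor_eId, Category.assoc, tensorHom_comp_tensorHom, F.map_id, G.map_id]
  map_comp x y z := by
    rw [tensor_eComp, tensor_eComp, Category.assoc, tensorHom_comp_tensorHom, F.map_comp,
      G.map_comp, tensorμ_natural_assoc, tensorHom_comp_tensorHom]

/-- The opposite of a `V`-functor. -/
@[simps]
def opFunctor (F : EnrichedFunctor V C D) : EnrichedFunctor V Cᵒᵖ Dᵒᵖ where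
  obj x := Opposite.op (F.obj x.unop)
  map x y := F.map y.unop x.unop
  map_id x := F.map_id x.unop
  map_comp x y z := by
    rw [eComp_op_eq, Category.assoc, F.map_comp, tensorHom_eComp_op_eq]
    rfl

end Tensor

section GNat

variable {V : Type u} [Category.{v} V] [MonoidalCategory V] [SymmetricCategory V]
variable {B : Type u₄} [EnrichedCategory V B] {C : Type u₁} [EnrichedCategory V C]
  {D : Type u₂} [EnrichedCategory V D] {E : Type u₃} [EnrichedCategory V E]

lemma eComp_assoc' {a b c d : C} {W₁ W₂ W₃ : V} (f : W₁ ⟶ (a ⟶ᵥ b)) (g : W₂ ⟶ (b ⟶ᵥ c))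
    (h : W₃ ⟶ (c ⟶ᵥ d)) :
    (f ⊗ₘ (g ⊗ₘ h) ≫ eComp V b c d) ≫ eComp V a b d =
      (α_ _ _ _).inv ≫ ((f ⊗ₘ g) ≫ eComp V a b c ⊗ₘ h) ≫ eComp V a c d := by
  have h1 : (f ⊗ₘ (g ⊗ₘ h) ≫ eComp V b c d) = (f ⊗ₘ (g ⊗ₘ h)) ≫ (_ ◁ eComp V b c d) := by
    rw [← id_tensorHom, tensorHom_comp_tensorHom, Category.comp_id]
  have h2 : ((f ⊗ₘ g) ≫ eComp V a b c ⊗ₘ h) = ((f ⊗ₘ g) ⊗ₘ h) ≫ (eComp V a b c ▷ _) := by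
    rw [← tensorHom_id, tensorHom_comp_tensorHom, Category.comp_id]
  rw [h1, h2, Category.assoc, Category.assoc, ← e_assoc, associator_inv_naturality_assoc]

/-- An `S`-graded `V`-natural transformation `F ⟶ G`: a family of morphisms
`S ⟶ D(F c, G c)` which is `V`-natural in `c`. -/
structure GNat (S : V) (F G : EnrichedFunctor V C D) where
  app : ∀ c, S ⟶ (F.obj c ⟶ᵥ G.obj c)
  naturality : ∀ c d, (F.map c d ⊗ₘ app d) ≫ eComp V (F.obj c) (F.obj d) (G.obj d) =
    (β_ (c ⟶ᵥ d) S).hom ≫ (app c ⊗ₘ G.map c d) ≫ eComp V (F.obj c) (G.obj c) (G.obj d)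

/-- A `V`-natural transformation: a family of elements `I ⟶ D(F c, G c)`, `V`-natural in `c`. -/
abbrev VNat (F G : EnrichedFunctor V C D) := GNat (𝟙_ V) F G

namespace GNat

variable {F G H : EnrichedFunctor V C D} {S U : V}

/-- Restriction of a graded transformation along `f : S' ⟶ S`. -/
@[simps]
def reindex (σ : GNat S F G) {S' : V} (f : S' ⟶ S) : GNat S' F G where
  app c := f ≫ σ.app c
  naturality c d := by
    have h : (F.map c d ⊗ₘ f ≫ σ.app d) = _ ◁ f ≫ (F.map c d ⊗ₘ σ.app d) := by
      rw [← id_tensorHom, tensorHom_comp_tensorHom, Category.id_comp]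
    have h2 : (f ≫ σ.app c ⊗ₘ G.map c d) = f ▷ _ ≫ (σ.app c ⊗ₘ G.map c d) := by
      rw [← tensorHom_id, tensorHom_comp_tensorHom, Category.id_comp]
    rw [h, h2, Category.assoc, Category.assoc, σ.naturality,
      BraidedCategory.braiding_naturality_right_assoc]

/-- The identity transformation. -/
@[simps]
def id (F : EnrichedFunctor V C D) : VNat F F where
  app c := eId V (F.obj c)
  naturality c d := by
    have h1 := e_comp_id V (F.obj c) (F.obj d)
    have h2 := e_id_comp V (F.obj c) (F.obj d)
    rw [Iso.inv_comp_eq, Category.comp_id] at h1 h2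
    rw [MonoidalCategory.tensorHom_def_assoc, MonoidalCategory.tensorHom_def'_assoc, h1, h2]
    simp

/-- Vertical composition of graded transformations. -/
@[simps]
def vcomp (σ : GNat S F G) (τ : GNat U G H) : GNat (S ⊗ U) F H where
  app c := (σ.app c ⊗ₘ τ.app c) ≫ eComp V _ _ _
  naturality c d := by
    rw [eComp_assoc', σ.naturality]
    have h : ((β_ (c ⟶ᵥ d) S).hom ≫ (σ.app c ⊗ₘ G.map c d) ≫ eComp V (F.obj c) (G.obj c) (G.obj d) ⊗ₘ τ.app d) = (β_ (c ⟶ᵥ d) S).hom ▷ U ≫ ((σ.app c ⊗ₘ G.map c d) ≫ eComp V (F.obj c) (G.obj c) (G.obj d) ⊗ₘ τ.app d) := by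
      rw [← tensorHom_id, tensorHom_comp_tensorHom, Category.id_comp]
    have h2 : (σ.app c ⊗ₘ (β_ (c ⟶ᵥ d) U).hom ≫ (τ.app c ⊗ₘ H.map c d) ≫ eComp V _ _ _) =
      _ ◁ (β_ (c ⟶ᵥ d) U).hom ≫ (σ.app c ⊗ₘ (τ.app c ⊗ₘ H.map c d) ≫ eComp V _ _ _) := by
      rw [← id_tensorHom, tensorHom_comp_tensorHom, Category.id_comp]
    rw [h, Category.assoc, ← Iso.hom_inv_id_assoc (α_ S (c ⟶ᵥ d) U) ((_ ⊗ₘ _) ≫ _), ← eComp_assoc',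
      τ.naturality, h2, Category.assoc, eComp_assoc']
    simp

/-- Postcomposition of a graded transformation with a `V`-functor. -/
@[simps]
def post (σ : GNat S F G) (K : EnrichedFunctor V D E) : GNat S (F.comp V K) (G.comp V K) where
  app c := σ.app c ≫ K.map _ _
  naturality c d := by
    change (F.map c d ≫ K.map _ _ ⊗ₘ σ.app d ≫ K.map _ _) ≫
        eComp V (K.obj (F.obj c)) (K.obj (F.obj d)) (K.obj (G.obj d)) =
      (β_ _ _).hom ≫ (σ.app c ≫ K.map _ _ ⊗ₘ G.map c d ≫ K.map _ _) ≫
        eComp V (K.obj (F.obj c)) (K.obj (G.obj c)) (K.obj (G.obj d))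
    rw [← tensorHom_comp_tensorHom, ← tensorHom_comp_tensorHom, Category.assoc, Category.assoc,
      ← K.map_comp, ← K.map_comp, reassoc_of% σ.naturality]

/-- Precomposition of a graded transformation with a `V`-functor. -/
@[simps]
def preF (K : EnrichedFunctor V B C) (σ : GNat S F G) : GNat S (K.comp V F) (K.comp V G) where
  app b := σ.app (K.obj b)
  naturality b b' := by
    change (K.map b b' ≫ F.map _ _ ⊗ₘ σ.app (K.obj b')) ≫
        eComp V (F.obj (K.obj b)) (F.obj (K.obj b')) (G.obj (K.obj b')) =
      (β_ _ _).hom ≫ (σ.app (K.obj b) ⊗ₘ K.map b b' ≫ G.map _ _) ≫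
        eComp V (F.obj (K.obj b)) (G.obj (K.obj b)) (G.obj (K.obj b'))
    rw [← Category.id_comp (σ.app (K.obj b')), ← Category.id_comp (σ.app (K.obj b)),
      ← tensorHom_comp_tensorHom, ← tensorHom_comp_tensorHom, Category.assoc, Category.assoc,
      σ.naturality, tensorHom_id, id_tensorHom, BraidedCategory.braiding_naturality_left_assoc]

/-- The opposite of a graded transformation. -/
@[simps]
def op (σ : GNat S F G) : GNat S (opFunctor V G) (opFunctor V F) where
  app c := σ.app c.unop
  naturality c d := by
    change (G.map d.unop c.unop ⊗ₘ σ.app d.unop) ≫ (β_ _ _).hom ≫ eComp V _ _ _ =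
      (β_ _ _).hom ≫ (σ.app c.unop ⊗ₘ F.map d.unop c.unop) ≫ (β_ _ _).hom ≫ eComp V _ _ _
    rw [BraidedCategory.braiding_naturality_assoc, BraidedCategory.braiding_naturality_assoc,
      σ.naturality, SymmetricCategory.symmetry_assoc]

/-- The tensor product of two graded transformations. -/
@[simps]
def tensor {C' : Type u₃} [EnrichedCategory V C'] {D' : Type u₄} [EnrichedCategory V D']
    {F' G' : EnrichedFunctor V C' D'} (σ : GNat S F G) (τ : GNat U F' G') :
    GNat (S ⊗ U) (tensorFunctor V F F') (tensorFunctor V G G') where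
  app x := σ.app x.fst ⊗ₘ τ.app x.snd
  naturality x y := by
    change ((F.map x.fst y.fst ⊗ₘ F'.map x.snd y.snd) ⊗ₘ (σ.app y.fst ⊗ₘ τ.app y.snd)) ≫
      tensorμ _ _ _ _ ≫ (eComp V _ _ _ ⊗ₘ eComp V _ _ _) =
      (β_ _ _).hom ≫ ((σ.app x.fst ⊗ₘ τ.app x.snd) ⊗ₘ (G.map x.fst y.fst ⊗ₘ G'.map x.snd y.snd)) ≫
      tensorμ _ _ _ _ ≫ (eComp V _ _ _ ⊗ₘ eComp V _ _ _)
    rw [tensorμ_natural_assoc, tensorμ_natural_assoc, tensorHom_comp_tensorHom,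
      tensorHom_comp_tensorHom, σ.naturality, τ.naturality, ← tensorHom_comp_tensorHom,
      reassoc_of% tensorμ_braiding]

end GNat

/-- For fixed `c, c'`, the `C(c, c')`-graded transformation `(c, -) ⟶ (c', -)`. -/
@[simps]
def insLNat (c c' : C) : GNat (c ⟶ᵥ c') (insRFunctor V C D c) (insRFunctor V C D c') where
  app d := insL V c c' d
  naturality d d' := by
    have h1 := insR_insL V c c' d d'
    have h2 := insL_insR V c c' d d'
    exact h1.trans (((β_ _ _).hom ≫= h2).trans (Category.comp_id _)).symm

/-- For fixed `d, d'`, the `D(d, d')`-graded transformation `(-, d) ⟶ (-, d')`. -/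
@[simps]
def insRNat (d d' : D) : GNat (d ⟶ᵥ d') (insLFunctor V C D d) (insLFunctor V C D d') where
  app c := insR V c d d'
  naturality c c' := by
    have h1 := insR_insL V c c' d d'
    have h2 := insL_insR V c c' d d'
    refine h2.trans (((β_ _ _).hom ≫= h1).trans (SymmetricCategory.symmetry _ _)).symm

lemma actOn_gnat [MonoidalClosed V] (T : EnrichedFunctor V D V) {F G : EnrichedFunctor V C D}
    {S : V} (σ : GNat S F G) (c d : C) :
    actOn T (F.map c d) ▷ S ≫ actOn T (σ.app d) =
      sw _ _ _ ≫ actOn T (σ.app c) ▷ _ ≫ actOn T (G.map c d) := by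
  have := congrArg (actOn T) (σ.naturality c d)
  rw [actOn_comp, actOn_pre, actOn_comp] at this
  rw [← cancel_epi (α_ _ _ _).inv, this, sw]
  simp

end GNat

section jointEq

variable {V : Type u} [Category.{v} V] [HasLimits V]

/-- The joint equalizer (that is, the intersection of the equalizers) of a family of pairs. -/
def jointEq {ι : Type v} {X : V} {Z : ι → V} (f g : ∀ i, X ⟶ Z i) : V :=
  equalizer (Pi.lift f) (Pi.lift g)

variable {ι : Type v} {X : V} {Z : ι → V} (f g : ∀ i, X ⟶ Z i)

/-- The inclusion of the joint equalizer. -/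
def jointEqι : jointEq f g ⟶ X := equalizer.ι _ _

lemma jointEq_condition (i : ι) : jointEqι f g ≫ f i = jointEqι f g ≫ g i := by
  have := equalizer.condition (Pi.lift f) (Pi.lift g) =≫ Pi.π _ i
  rw [Category.assoc, Category.assoc, Pi.lift_π, Pi.lift_π] at this
  exact this

/-- The universal property of the joint equalizer. -/
def jointEqLift {W : V} (k : W ⟶ X) (h : ∀ i, k ≫ f i = k ≫ g i) : W ⟶ jointEq f g :=
  equalizer.lift k (by ext i; simpa using h i)

@[simp]
lemma jointEqLift_ι {W : V} (k : W ⟶ X) (h : ∀ i, k ≫ f i = k ≫ g i) :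
    jointEqLift f g k h ≫ jointEqι f g = k := equalizer.lift_ι _ _

instance : Mono (jointEqι f g) := inferInstanceAs (Mono (equalizer.ι _ _))

end jointEq

section End

variable {V : Type u} [Category.{v} V] [MonoidalCategory V] [SymmetricCategory V]
  [MonoidalClosed V] [HasLimits V]

/-- The object `∫ᵢ P i i` for a family of objects `P i j` with actions
`P i i ⊗ H i j ⟶ P i j` and `P j j ⊗ H i j ⟶ P i j`: the equalizer of the two induced morphisms
`∏ᵢ P i i ⟶ ∏ᵢⱼ [H i j, P i j]`. -/
def endObj {ι : Type v} {P H : ι → ι → V} (r : ∀ i j, P i i ⊗ H i j ⟶ P i j)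
    (l : ∀ i j, P j j ⊗ H i j ⟶ P i j) : V :=
  jointEq (ι := ι × ι) (X := ∏ᶜ fun i => P i i) (Z := fun p => (ihom (H p.1 p.2)).obj (P p.1 p.2))
    (fun p => Pi.π _ p.1 ≫ MonoidalClosed.curry ((β_ _ _).hom ≫ r p.1 p.2))
    (fun p => Pi.π _ p.2 ≫ MonoidalClosed.curry ((β_ _ _).hom ≫ l p.1 p.2))

section endObj

variable {ι : Type v} {P H : ι → ι → V} (r : ∀ i j, P i i ⊗ H i j ⟶ P i j)
  (l : ∀ i j, P j j ⊗ H i j ⟶ P i j)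

/-- The inclusion of the end into the product. -/
def endObjι : endObj r l ⟶ ∏ᶜ fun i => P i i := jointEqι _ _

instance : Mono (endObjι r l) := inferInstanceAs (Mono (jointEqι _ _))

/-- The projections of the end. -/
def endObjπ (i : ι) : endObj r l ⟶ P i i := endObjι r l ≫ Pi.π _ i

lemma endObj_aux {W A B Q R : V} (f : W ⟶ A) (g : W ⟶ B) (r : A ⊗ Q ⟶ R) (l : B ⊗ Q ⟶ R) :
    f ≫ MonoidalClosed.curry ((β_ _ _).hom ≫ r) = g ≫ MonoidalClosed.curry ((β_ _ _).hom ≫ l) ↔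
      f ▷ Q ≫ r = g ▷ Q ≫ l := by
  rw [← MonoidalClosed.curry_natural_left, ← MonoidalClosed.curry_natural_left,
    MonoidalClosed.curry_injective.eq_iff, BraidedCategory.braiding_naturality_right_assoc,
    BraidedCategory.braiding_naturality_right_assoc, cancel_epi]

lemma endObj_condition (i j : ι) :
    endObjπ r l i ▷ H i j ≫ r i j = endObjπ r l j ▷ H i j ≫ l i j := by
  rw [← endObj_aux, endObjπ, endObjπ, Category.assoc, Category.assoc]
  exact jointEq_condition _ _ (⟨i, j⟩ : ι × ι)

/-- The universal property of the end. -/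
def endObjLift {W : V} (k : ∀ i, W ⟶ P i i)
    (h : ∀ i j, k i ▷ H i j ≫ r i j = k j ▷ H i j ≫ l i j) : W ⟶ endObj r l :=
  jointEqLift _ _ (Pi.lift k) (fun p => by
    rw [Pi.lift_π_assoc, Pi.lift_π_assoc, endObj_aux]
    exact h _ _)

@[simp]
lemma endObjLift_π {W : V} (k : ∀ i, W ⟶ P i i)
    (h : ∀ i j, k i ▷ H i j ≫ r i j = k j ▷ H i j ≫ l i j) (i : ι) :
    endObjLift r l k h ≫ endObjπ r l i = k i := by
  have : endObjLift r l k h ≫ endObjι r l = Pi.lift k := jointEqLift_ι _ _ _ _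
  rw [endObjπ, reassoc_of% this, Pi.lift_π]

lemma endObj_ext {W : V} {f g : W ⟶ endObj r l}
    (h : ∀ i, f ≫ endObjπ r l i = g ≫ endObjπ r l i) : f = g := by
  rw [← cancel_mono (endObjι r l)]
  ext i
  simpa [endObjπ] using h i

end endObj

/-- The end `∫_b P(b, b)` of a `V`-functor `P : Bᵒᵖ ⊗ B ⟶ V`. -/
def vEnd {B : Type v} [EnrichedCategory V B] (P : EnrichedFunctor V (TensorCat Bᵒᵖ B) V) : V :=
  endObj (P := fun b b' => P.obj ⟨Opposite.op b, b'⟩) (H := fun b b' => b ⟶ᵥ b')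
    (fun b b' => actOn P (insR V (Opposite.op b) b b'))
    (fun b b' => actOn P (insL V (Opposite.op b') (Opposite.op b) b'))

/-- The object `[C, D](F, G) = ∫_c D(F c, G c)` of `V`-natural transformations. -/
def natObj {C : Type v} [EnrichedCategory V C] {D : Type u₂} [EnrichedCategory V D]
    (F G : EnrichedFunctor V C D) : V :=
  endObj (P := fun c d => F.obj c ⟶ᵥ G.obj d) (H := fun c d => c ⟶ᵥ d)
    (fun c d => _ ◁ G.map c d ≫ eComp V (F.obj c) (G.obj c) (G.obj d))
    (fun c d => (β_ _ _).hom ≫ F.map c d ▷ _ ≫ eComp V (F.obj c) (F.obj d) (G.obj d))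

section FunctorCategory

variable {C : Type v} [EnrichedCategory V C] {D : Type u₂} [EnrichedCategory V D]

/-- The projection `[C, D](F, G) ⟶ D(F c, G c)`. -/
def natπ (F G : EnrichedFunctor V C D) (c : C) : natObj F G ⟶ (F.obj c ⟶ᵥ G.obj c) :=
  endObjπ _ _ c

lemma natObj_ext {F G : EnrichedFunctor V C D} {W : V} {f g : W ⟶ natObj F G}
    (h : ∀ c, f ≫ natπ F G c = g ≫ natπ F G c) : f = g :=
  endObj_ext _ _ h

/-- The universal graded transformation. -/
@[simps]
def natUniv (F G : EnrichedFunctor V C D) : GNat (natObj F G) F G where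
  app c := natπ F G c
  naturality c d := by
    have := endObj_condition (P := fun c d => F.obj c ⟶ᵥ G.obj d) (H := fun c d => c ⟶ᵥ d)
      (fun c d => _ ◁ G.map c d ≫ eComp V (F.obj c) (G.obj c) (G.obj d))
      (fun c d => (β_ _ _).hom ≫ F.map c d ▷ _ ≫ eComp V (F.obj c) (F.obj d) (G.obj d)) c d
    rw [BraidedCategory.braiding_naturality_left_assoc] at this
    change natπ F G c ▷ _ ≫ _ = (β_ _ _).hom ≫ _ ◁ natπ F G d ≫ _ at this
    rw [MonoidalCategory.tensorHom_def (natπ F G c), Category.assoc, this,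
      SymmetricCategory.symmetry_assoc, MonoidalCategory.tensorHom_def'_assoc]

/-- The morphism into `[C, D](F, G)` given by a graded transformation. -/
def natLift {F G : EnrichedFunctor V C D} {W : V} (σ : GNat W F G) : W ⟶ natObj F G :=
  endObjLift _ _ σ.app (fun c d => by
    rw [BraidedCategory.braiding_naturality_left_assoc, ← cancel_epi (β_ _ _).hom,
      SymmetricCategory.symmetry_assoc, ← MonoidalCategory.tensorHom_def_assoc,
      ← MonoidalCategory.tensorHom_def'_assoc]
    exact (σ.naturality c d).symm)

@[simp]
lemma natLift_π {F G : EnrichedFunctor V C D} {W : V} (σ : GNat W F G) (c : C) :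
    natLift σ ≫ natπ F G c = σ.app c := endObjLift_π _ _ _ _ _

/-- The `V`-category `[C, D]` of `V`-functors. -/
instance functorCategory : EnrichedCategory V (EnrichedFunctor V C D) where
  Hom F G := natObj F G
  id F := natLift (GNat.id F)
  comp F G H := natLift ((natUniv F G).vcomp (natUniv G H))
  id_comp F G := by
    apply natObj_ext; intro c
    simp only [Category.assoc, natLift_π, GNat.vcomp_app, natUniv_app, Category.id_comp]
    rw [← tensorHom_id, tensorHom_comp_tensorHom_assoc, natLift_π, Category.id_comp, GNat.id_app,
      MonoidalCategory.tensorHom_def'_assoc, ← leftUnitor_inv_naturality_assoc, e_id_comp,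
      Category.comp_id]
  comp_id F G := by
    apply natObj_ext; intro c
    simp only [Category.assoc, natLift_π, GNat.vcomp_app, natUniv_app, Category.id_comp]
    rw [← id_tensorHom, tensorHom_comp_tensorHom_assoc, natLift_π, Category.id_comp, GNat.id_app,
      MonoidalCategory.tensorHom_def_assoc, ← rightUnitor_inv_naturality_assoc, e_comp_id,
      Category.comp_id]
  assoc F G H K := by
    apply natObj_ext; intro c
    simp only [Category.assoc, natLift_π, GNat.vcomp_app, natUniv_app]
    rw [← id_tensorHom, ← tensorHom_id, tensorHom_comp_tensorHom_assoc,
      tensorHom_comp_tensorHom_assoc, natLift_π, natLift_π, Category.id_comp, Category.id_comp]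
    exact (eComp_assoc' _ _ _).symm

lemma functorCategory_eComp_π (F G H : EnrichedFunctor V C D) (c : C) :
    eComp V F G H ≫ natπ F H c = (natπ F G c ⊗ₘ natπ G H c) ≫ eComp V _ _ _ :=
  natLift_π _ _

lemma functorCategory_eId_π (F : EnrichedFunctor V C D) (c : C) :
    eId V F ≫ natπ F F c = eId V (F.obj c) :=
  natLift_π _ _

end FunctorCategory

end End

section Comonad

variable {V : Type u} [Category.{v} V] [MonoidalCategory V] [SymmetricCategory V]

section Elements

variable {M : Type u₁} [EnrichedCategory V M]

/-- Composition of elements `I ⟶ M(x, y)` and `I ⟶ M(y, z)`, i.e. composition in the underlying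
category of `M`. -/
def elComp {x y z : M} (f : 𝟙_ V ⟶ (x ⟶ᵥ y)) (g : 𝟙_ V ⟶ (y ⟶ᵥ z)) : 𝟙_ V ⟶ (x ⟶ᵥ z) :=
  (λ_ _).inv ≫ (f ⊗ₘ g) ≫ eComp V x y z

/-- Postcomposition `M(x, y) ⟶ M(x, z)` with an element of `M(y, z)`. -/
def ePost (x : M) {y z : M} (g : 𝟙_ V ⟶ (y ⟶ᵥ z)) : (x ⟶ᵥ y : V) ⟶ (x ⟶ᵥ z) :=
  (ρ_ _).inv ≫ _ ◁ g ≫ eComp V x y z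

/-- Precomposition `M(y, z) ⟶ M(x, z)` with an element of `M(x, y)`. -/
def ePre {x y : M} (f : 𝟙_ V ⟶ (x ⟶ᵥ y)) (z : M) : (y ⟶ᵥ z : V) ⟶ (x ⟶ᵥ z) :=
  (λ_ _).inv ≫ f ▷ _ ≫ eComp V x y z

lemma comp_ePost {W : V} {x y z : M} (k : W ⟶ (x ⟶ᵥ y)) (g : 𝟙_ V ⟶ (y ⟶ᵥ z)) :
    k ≫ ePost x g = (ρ_ _).inv ≫ (k ⊗ₘ g) ≫ eComp V x y z := by
  rw [ePost, rightUnitor_inv_naturality_assoc, MonoidalCategory.tensorHom_def_assoc]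

lemma comp_ePre {W : V} {x y z : M} (f : 𝟙_ V ⟶ (x ⟶ᵥ y)) (k : W ⟶ (y ⟶ᵥ z)) :
    k ≫ ePre f z = (λ_ _).inv ≫ (f ⊗ₘ k) ≫ eComp V x y z := by
  rw [ePre, leftUnitor_inv_naturality_assoc, MonoidalCategory.tensorHom_def'_assoc]

lemma elComp_eq_ePost {x y z : M} (f : 𝟙_ V ⟶ (x ⟶ᵥ y)) (g : 𝟙_ V ⟶ (y ⟶ᵥ z)) :
    elComp f g = f ≫ ePost x g := by
  rw [comp_ePost, elComp, unitors_inv_equal]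

lemma elComp_eq_ePre {x y z : M} (f : 𝟙_ V ⟶ (x ⟶ᵥ y)) (g : 𝟙_ V ⟶ (y ⟶ᵥ z)) :
    elComp f g = g ≫ ePre f z := by
  rw [comp_ePre, elComp]

@[simp]
lemma elComp_eId {x y : M} (f : 𝟙_ V ⟶ (x ⟶ᵥ y)) : elComp f (eId V y) = f := by
  rw [elComp_eq_ePost, ePost, e_comp_id, Category.comp_id]

@[simp]
lemma eId_elComp {x y : M} (f : 𝟙_ V ⟶ (x ⟶ᵥ y)) : elComp (eId V x) f = f := by
  rw [elComp_eq_ePre, ePre, e_id_comp, Category.comp_id]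

lemma comp_comp_ePost {W U : V} {x y z w : M} (h : W ⟶ (x ⟶ᵥ y)) (k : U ⟶ (y ⟶ᵥ z))
    (g : 𝟙_ V ⟶ (z ⟶ᵥ w)) :
    ((h ⊗ₘ k) ≫ eComp V x y z) ≫ ePost x g = (h ⊗ₘ k ≫ ePost y g) ≫ eComp V x y w := by
  have e : (h ⊗ₘ (ρ_ U).inv ≫ (k ⊗ₘ g) ≫ eComp V y z w) =
      W ◁ (ρ_ U).inv ≫ (h ⊗ₘ (k ⊗ₘ g) ≫ eComp V y z w) := by
    rw [← id_tensorHom, tensorHom_comp_tensorHom, Category.id_comp]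
  rw [comp_ePost, comp_ePost, e, Category.assoc, eComp_assoc']
  simp

lemma comp_ePre_comp {W U : V} {x y z w : M} (f : 𝟙_ V ⟶ (x ⟶ᵥ y)) (h : W ⟶ (y ⟶ᵥ z))
    (k : U ⟶ (z ⟶ᵥ w)) :
    ((h ⊗ₘ k) ≫ eComp V y z w) ≫ ePre f w = (h ≫ ePre f z ⊗ₘ k) ≫ eComp V x z w := by
  have e : ((λ_ W).inv ≫ (f ⊗ₘ h) ≫ eComp V x y z ⊗ₘ k) =
      (λ_ W).inv ▷ U ≫ ((f ⊗ₘ h) ≫ eComp V x y z ⊗ₘ k) := by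
    rw [← tensorHom_id, tensorHom_comp_tensorHom, Category.id_comp]
  rw [comp_ePre, comp_ePre, e, Category.assoc, eComp_assoc']
  simp

lemma comp_ePre_ePost {W U : V} {x y z w : M} (h : W ⟶ (x ⟶ᵥ y)) (f : 𝟙_ V ⟶ (y ⟶ᵥ z))
    (k : U ⟶ (z ⟶ᵥ w)) :
    (h ⊗ₘ k ≫ ePre f w) ≫ eComp V x y w = (h ≫ ePost x f ⊗ₘ k) ≫ eComp V x z w := by
  have e : (h ⊗ₘ (λ_ U).inv ≫ (f ⊗ₘ k) ≫ eComp V y z w) =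
      W ◁ (λ_ U).inv ≫ (h ⊗ₘ (f ⊗ₘ k) ≫ eComp V y z w) := by
    rw [← id_tensorHom, tensorHom_comp_tensorHom, Category.id_comp]
  have e' : ((ρ_ W).inv ≫ (h ⊗ₘ f) ≫ eComp V x y z ⊗ₘ k) =
      (ρ_ W).inv ▷ U ≫ ((h ⊗ₘ f) ≫ eComp V x y z ⊗ₘ k) := by
    rw [← tensorHom_id, tensorHom_comp_tensorHom, Category.id_comp]
  rw [comp_ePre, comp_ePost, e, e', Category.assoc, eComp_assoc', Category.assoc]
  simp

end Elements

/-- Data for a `V`-category with objects `O`, whose homs are intersections of equalizers of pairs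
of morphisms out of the homs of a given `V`-category `M`. -/
structure HomCut (M : Type u₁) [EnrichedCategory V M] (O : Type u₂) where
  obj : O → M
  I : O → O → Type v
  Z : ∀ x y, I x y → V
  f : ∀ x y i, (obj x ⟶ᵥ obj y) ⟶ Z x y i
  g : ∀ x y i, (obj x ⟶ᵥ obj y) ⟶ Z x y i
  id_mem : ∀ x i, eId V (obj x) ≫ f x x i = eId V (obj x) ≫ g x x i
  comp_mem : ∀ {x y z : O} {W U : V} (h : W ⟶ (obj x ⟶ᵥ obj y)) (k : U ⟶ (obj y ⟶ᵥ obj z)),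
    (∀ i, h ≫ f x y i = h ≫ g x y i) → (∀ i, k ≫ f y z i = k ≫ g y z i) →
    ∀ i, ((h ⊗ₘ k) ≫ eComp V _ _ _) ≫ f x z i = ((h ⊗ₘ k) ≫ eComp V _ _ _) ≫ g x z i

namespace HomCut

variable [HasLimits V]
variable {M : Type u₁} [EnrichedCategory V M] {O : Type u₂} (K : HomCut (V := V) M O)

/-- The hom-object: the intersection of the equalizers. -/
def hom (x y : O) : V := jointEq (K.f x y) (K.g x y)

def ι (x y : O) : K.hom x y ⟶ (K.obj x ⟶ᵥ K.obj y) := jointEqι _ _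

instance (x y : O) : Mono (K.ι x y) := inferInstanceAs (Mono (jointEqι _ _))

lemma condition (x y : O) (i) : K.ι x y ≫ K.f x y i = K.ι x y ≫ K.g x y i :=
  jointEq_condition _ _ i

def lift {W : V} {x y : O} (k : W ⟶ (K.obj x ⟶ᵥ K.obj y))
    (h : ∀ i, k ≫ K.f x y i = k ≫ K.g x y i) : W ⟶ K.hom x y := jointEqLift _ _ k h

@[simp]
lemma lift_ι {W : V} {x y : O} (k : W ⟶ (K.obj x ⟶ᵥ K.obj y))
    (h : ∀ i, k ≫ K.f x y i = k ≫ K.g x y i) : K.lift k h ≫ K.ι x y = k :=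
  jointEqLift_ι _ _ k h

/-- The resulting `V`-category. -/
@[reducible]
def enrichedCategory : EnrichedCategory V O where
  Hom x y := K.hom x y
  id x := K.lift (eId V (K.obj x)) (K.id_mem x)
  comp x y z := K.lift ((K.ι x y ⊗ₘ K.ι y z) ≫ eComp V _ _ _)
    (K.comp_mem _ _ (K.condition x y) (K.condition y z))
  id_comp x y := by
    rw [← cancel_mono (K.ι x y)]
    simp only [Category.assoc, lift_ι, Category.id_comp]
    rw [← tensorHom_id, tensorHom_comp_tensorHom_assoc, lift_ι, Category.id_comp,
      MonoidalCategory.tensorHom_def'_assoc, ← leftUnitor_inv_naturality_assoc, e_id_comp,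
      Category.comp_id]
  comp_id x y := by
    rw [← cancel_mono (K.ι x y)]
    simp only [Category.assoc, lift_ι, Category.id_comp]
    rw [← id_tensorHom, tensorHom_comp_tensorHom_assoc, lift_ι, Category.id_comp,
      MonoidalCategory.tensorHom_def_assoc, ← rightUnitor_inv_naturality_assoc, e_comp_id,
      Category.comp_id]
  assoc x y z w := by
    rw [← cancel_mono (K.ι x w)]
    simp only [Category.assoc, lift_ι]
    rw [← id_tensorHom, ← tensorHom_id, tensorHom_comp_tensorHom_assoc,
      tensorHom_comp_tensorHom_assoc, lift_ι, lift_ι, Category.id_comp, Category.id_comp]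
    exact (eComp_assoc' _ _ _).symm

/-- The `V`-functor to `M`. -/
def forget : letI := K.enrichedCategory; EnrichedFunctor V O M :=
  letI := K.enrichedCategory
  { obj := K.obj
    map := fun x y => K.ι x y
    map_id := fun x => K.lift_ι _ (K.id_mem x)
    map_comp := fun x y z => K.lift_ι _
      (K.comp_mem _ _ (K.condition x y) (K.condition y z)) }

end HomCut

/-- A `V`-comonad on a `V`-category `M`. -/
structure VComonad (M : Type u₁) [EnrichedCategory V M] where
  toFunctor : EnrichedFunctor V M M
  ε : VNat toFunctor (EnrichedFunctor.id V M)
  δ : VNat toFunctor (toFunctor.comp V toFunctor)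
  counit_left : ∀ x, elComp (δ.app x) (ε.app (toFunctor.obj x)) = eId V (toFunctor.obj x)
  counit_right : ∀ x, elComp (δ.app x) (ε.app x ≫ toFunctor.map (toFunctor.obj x) x) =
    eId V (toFunctor.obj x)
  coassoc : ∀ x, elComp (δ.app x) (δ.app (toFunctor.obj x)) =
    elComp (δ.app x) (δ.app x ≫ toFunctor.map (toFunctor.obj x) (toFunctor.obj (toFunctor.obj x)))

/-- An Eilenberg–Moore coalgebra for a `V`-comonad. -/
structure VComonad.Coalgebra {M : Type u₁} [EnrichedCategory V M] (G : VComonad (V := V) M) where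
  obj : M
  coact : 𝟙_ V ⟶ (obj ⟶ᵥ G.toFunctor.obj obj)
  counit : elComp coact (G.ε.app obj) = eId V obj
  coassoc : elComp coact (G.δ.app obj) =
    elComp coact (coact ≫ G.toFunctor.map obj (G.toFunctor.obj obj))

namespace VComonad

variable [HasLimits V] {M : Type u₁} [EnrichedCategory V M] (G : VComonad (V := V) M)

/-- `M^G((x, γ), (y, γ'))` is the equalizer of `γ' ∘ -` and `G(-) ∘ γ : M(x, y) ⟶ M(x, G y)`. -/
def coalgebraCut : HomCut (V := V) M G.Coalgebra where
  obj x := x.obj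
  I _ _ := PUnit
  Z x y _ := x.obj ⟶ᵥ G.toFunctor.obj y.obj
  f x y _ := ePost x.obj y.coact
  g x y _ := G.toFunctor.map x.obj y.obj ≫ ePre x.coact (G.toFunctor.obj y.obj)
  id_mem x _ := by
    rw [G.toFunctor.map_id_assoc, ← elComp_eq_ePost, ← elComp_eq_ePre, elComp_eId, eId_elComp]
  comp_mem := by
    intro x y z W U h k hh hk i
    have hh := hh ⟨⟩
    have hk := hk ⟨⟩
    rw [comp_comp_ePost, hk, ← Category.assoc k, comp_ePre_ePost, hh, ← Category.assoc h,
      ← comp_ePre_comp, ← tensorHom_comp_tensorHom, Category.assoc _ _ (eComp V _ _ _),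
      ← G.toFunctor.map_comp, Category.assoc, Category.assoc, Category.assoc]

/-- The Eilenberg–Moore `V`-category of coalgebras. -/
instance : EnrichedCategory V G.Coalgebra := G.coalgebraCut.enrichedCategory

/-- The underlying-object `V`-functor. -/
def forget : EnrichedFunctor V G.Coalgebra M := G.coalgebraCut.forget

end VComonad

/-- An isomorphism of `V`-categories. -/
structure VCatIso (C : Type u₁) [EnrichedCategory V C] (D : Type u₂) [EnrichedCategory V D] where
  hom : EnrichedFunctor V C D
  inv : EnrichedFunctor V D C
  hom_inv_id : hom.comp V inv = EnrichedFunctor.id V C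
  inv_hom_id : inv.comp V hom = EnrichedFunctor.id V D

end Comonad

section Monoidal

variable {V : Type u} [Category.{v} V] [MonoidalCategory V] [SymmetricCategory V]
  {A : Type u₁} [EnrichedCategory V A] {B : Type u₂} [EnrichedCategory V B]

lemma elComp_assoc {x y z w : A} (f : 𝟙_ V ⟶ (x ⟶ᵥ y)) (g : 𝟙_ V ⟶ (y ⟶ᵥ z))
    (h : 𝟙_ V ⟶ (z ⟶ᵥ w)) : elComp (elComp f g) h = elComp f (elComp g h) := by
  rw [elComp_eq_ePost, elComp_eq_ePost g h, elComp, Category.assoc, comp_comp_ePost]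
  rfl

lemma ePost_ePost (x : A) {y z w : A} (g : 𝟙_ V ⟶ (y ⟶ᵥ z)) (h : 𝟙_ V ⟶ (z ⟶ᵥ w)) :
    ePost x g ≫ ePost x h = ePost x (elComp g h) := by
  rw [ePost, Category.assoc, ← id_tensorHom, comp_comp_ePost, ← elComp_eq_ePost, id_tensorHom]
  rfl

lemma ePre_ePre {x y z : A} (f : 𝟙_ V ⟶ (x ⟶ᵥ y)) (g : 𝟙_ V ⟶ (y ⟶ᵥ z)) (w : A) :
    ePre g w ≫ ePre f w = ePre (elComp f g) w := by
  rw [ePre, Category.assoc, ← tensorHom_id, comp_ePre_comp, ← elComp_eq_ePre, tensorHom_id]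
  rfl

lemma ePre_ePost {x y z w : A} (f : 𝟙_ V ⟶ (x ⟶ᵥ y)) (g : 𝟙_ V ⟶ (z ⟶ᵥ w)) :
    ePre f z ≫ ePost x g = ePost y g ≫ ePre f w := by
  rw [ePre, Category.assoc, ← tensorHom_id, comp_comp_ePost, Category.id_comp, comp_ePre]

@[simp]
lemma ePost_eId (x y : A) : ePost x (eId V y) = 𝟙 _ := by
  rw [ePost, e_comp_id]

@[simp]
lemma ePre_eId (x y : A) : ePre (eId V x) y = 𝟙 _ := by
  rw [ePre, e_id_comp]

lemma elComp_map (F : EnrichedFunctor V A B) {x y z : A} (f : 𝟙_ V ⟶ (x ⟶ᵥ y))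
    (g : 𝟙_ V ⟶ (y ⟶ᵥ z)) :
    elComp f g ≫ F.map x z = elComp (f ≫ F.map x y) (g ≫ F.map y z) := by
  rw [elComp, elComp, Category.assoc, Category.assoc, F.map_comp, tensorHom_comp_tensorHom_assoc]

lemma ePost_map (F : EnrichedFunctor V A B) (x : A) {y z : A} (g : 𝟙_ V ⟶ (y ⟶ᵥ z)) :
    ePost x g ≫ F.map x z = F.map x y ≫ ePost (F.obj x) (g ≫ F.map y z) := by
  rw [comp_ePost, ePost, Category.assoc, Category.assoc, F.map_comp, ← id_tensorHom,
    tensorHom_comp_tensorHom_assoc, Category.id_comp]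

lemma ePre_map (F : EnrichedFunctor V A B) {x y : A} (g : 𝟙_ V ⟶ (x ⟶ᵥ y)) (z : A) :
    ePre g z ≫ F.map x z = F.map y z ≫ ePre (g ≫ F.map x y) (F.obj z) := by
  rw [comp_ePre, ePre, Category.assoc, Category.assoc, F.map_comp, ← tensorHom_id,
    tensorHom_comp_tensorHom_assoc, Category.id_comp]

lemma ePost_ePre_inv {W : V} {x x' y y' : A} {p : W ⟶ (x ⟶ᵥ x')} {q : W ⟶ (y ⟶ᵥ y')}
    {a : 𝟙_ V ⟶ (x ⟶ᵥ y)} {b : 𝟙_ V ⟶ (y ⟶ᵥ x)} (hba : elComp b a = eId V y)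
    {a' : 𝟙_ V ⟶ (x' ⟶ᵥ y')} {b' : 𝟙_ V ⟶ (y' ⟶ᵥ x')} (hab : elComp a' b' = eId V x')
    (h : p ≫ ePost x a' = q ≫ ePre a y') : q ≫ ePost y b' = p ≫ ePre b x' := by
  have := h =≫ (ePost x b' ≫ ePre b x')
  rw [Category.assoc, Category.assoc, reassoc_of% ePost_ePost, hab, ePost_eId, Category.id_comp,
    ← ePre_ePost, reassoc_of% ePre_ePre, hba, ePre_eId, Category.id_comp] at this
  exact this.symm

lemma tensorμ_braiding' (X₁ X₂ Y₁ Y₂ : V) :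
    tensorμ X₁ X₂ Y₁ Y₂ ≫ (β_ (X₁ ⊗ Y₁) (X₂ ⊗ Y₂)).hom =
      ((β_ X₁ X₂).hom ⊗ₘ (β_ Y₁ Y₂).hom) ≫ tensorμ X₂ X₁ Y₂ Y₁ := by
  have h : (β_ X₂ Y₁).hom ▷ Y₂ ≫ (β_ Y₁ X₂).hom ▷ Y₂ = 𝟙 _ := by
    rw [← comp_whiskerRight, SymmetricCategory.symmetry, id_whiskerRight]
  simp only [tensorμ, Category.assoc,
    BraidedCategory.braiding_tensor_right_hom, BraidedCategory.braiding_tensor_left_hom,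
    comp_whiskerRight, whisker_assoc, MonoidalCategory.whiskerLeft_comp, pentagon_assoc,
    pentagon_inv_hom_hom_hom_inv_assoc, Iso.inv_hom_id_assoc, whiskerLeft_hom_inv_assoc]
  rw [← MonoidalCategory.whiskerLeft_comp_assoc X₁ ((β_ X₂ Y₁).hom ▷ Y₂), h,
    MonoidalCategory.tensorHom_def]
  monoidal

variable (V) in
/-- The symmetry `C ⊗ D ⟶ D ⊗ C`. -/
@[simps]
def swapFunctor (C : Type u₁) [EnrichedCategory V C] (D : Type u₂) [EnrichedCategory V D] :
    EnrichedFunctor V (TensorCat C D) (TensorCat D C) where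
  obj x := ⟨x.snd, x.fst⟩
  map x y := (β_ _ _).hom
  map_id x := by
    rw [tensor_eId, tensor_eId, Category.assoc, BraidedCategory.braiding_naturality,
      braiding_tensorUnit_left]
    simp [unitors_equal]
  map_comp x y z := by
    rw [tensor_eComp, tensor_eComp, Category.assoc, BraidedCategory.braiding_naturality,
      ← Category.assoc, ← Category.assoc]
    congr 1
    exact tensorμ_braiding' _ _ _ _

section Whisker

variable (T : EnrichedFunctor V (TensorCat A A) A)

/-- `X ⊗ -` on homs. -/
def wl (X Y Y' : A) : (Y ⟶ᵥ Y' : V) ⟶ (T.obj ⟨X, Y⟩ ⟶ᵥ T.obj ⟨X, Y'⟩) :=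
  insR V X Y Y' ≫ T.map ⟨X, Y⟩ ⟨X, Y'⟩

/-- `- ⊗ Y` on homs. -/
def wr (Y X X' : A) : (X ⟶ᵥ X' : V) ⟶ (T.obj ⟨X, Y⟩ ⟶ᵥ T.obj ⟨X', Y⟩) :=
  insL V X X' Y ≫ T.map ⟨X, Y⟩ ⟨X', Y⟩

/-- The `V`-functor `X ⊗ -`. -/
@[simps]
def tl (X : A) : EnrichedFunctor V A A where
  obj Y := T.obj ⟨X, Y⟩
  map Y Y' := wl T X Y Y'
  map_id Y := ((insRFunctor V A A X).comp V T).map_id Y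
  map_comp Y Y' Y'' := ((insRFunctor V A A X).comp V T).map_comp Y Y' Y''

/-- The `V`-functor `- ⊗ Y`. -/
@[simps]
def tr (Y : A) : EnrichedFunctor V A A where
  obj X := T.obj ⟨X, Y⟩
  map X X' := wr T Y X X'
  map_id X := ((insLFunctor V A A Y).comp V T).map_id X
  map_comp X X' X'' := ((insLFunctor V A A Y).comp V T).map_comp X X' X''

/-- `X ⊗ Y ⟶ X' ⊗ Y` as an `A(X, X')`-graded transformation in `Y`. -/
@[simps]
def wrNat (X X' : A) : GNat (X ⟶ᵥ X') (tl T X) (tl T X') where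
  app Y := wr T Y X X'
  naturality Y Y' := ((insLNat (V := V) (C := A) (D := A) X X').post T).naturality Y Y'

end Whisker

/-- A monoidal `V`-category structure on the `V`-category `A`. The isomorphisms `(X ⊗ Y) ⊗ Z ≅
X ⊗ (Y ⊗ Z)`, `I ⊗ X ≅ X` and `X ⊗ I ≅ X` are given by mutually inverse elements of the
hom-objects, `V`-natural in each variable. -/
structure MonoidalVCat (V : Type u) [Category.{v} V] [MonoidalCategory V] [SymmetricCategory V]
    (A : Type u₁) [EnrichedCategory V A] where
  tensor : EnrichedFunctor V (TensorCat A A) A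
  unit : A
  assocHom : ∀ X Y Z : A, 𝟙_ V ⟶
    (tensor.obj ⟨tensor.obj ⟨X, Y⟩, Z⟩ ⟶ᵥ tensor.obj ⟨X, tensor.obj ⟨Y, Z⟩⟩)
  assocInv : ∀ X Y Z : A, 𝟙_ V ⟶
    (tensor.obj ⟨X, tensor.obj ⟨Y, Z⟩⟩ ⟶ᵥ tensor.obj ⟨tensor.obj ⟨X, Y⟩, Z⟩)
  leftUnitHom : ∀ X : A, 𝟙_ V ⟶ (tensor.obj ⟨unit, X⟩ ⟶ᵥ X)
  leftUnitInv : ∀ X : A, 𝟙_ V ⟶ (X ⟶ᵥ tensor.obj ⟨unit, X⟩)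
  rightUnitHom : ∀ X : A, 𝟙_ V ⟶ (tensor.obj ⟨X, unit⟩ ⟶ᵥ X)
  rightUnitInv : ∀ X : A, 𝟙_ V ⟶ (X ⟶ᵥ tensor.obj ⟨X, unit⟩)
  assocHom_assocInv : ∀ X Y Z, elComp (assocHom X Y Z) (assocInv X Y Z) = eId V _
  assocInv_assocHom : ∀ X Y Z, elComp (assocInv X Y Z) (assocHom X Y Z) = eId V _
  leftUnitHom_leftUnitInv : ∀ X, elComp (leftUnitHom X) (leftUnitInv X) = eId V _
  leftUnitInv_leftUnitHom : ∀ X, elComp (leftUnitInv X) (leftUnitHom X) = eId V _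
  rightUnitHom_rightUnitInv : ∀ X, elComp (rightUnitHom X) (rightUnitInv X) = eId V _
  rightUnitInv_rightUnitHom : ∀ X, elComp (rightUnitInv X) (rightUnitHom X) = eId V _
  /-- `V`-naturality of the associativity isomorphism in the first variable. -/
  assoc_naturality_left : ∀ X X' Y Z : A,
    wr tensor Y X X' ≫ wr tensor Z _ _ ≫ ePost _ (assocHom X' Y Z) =
      wr tensor (tensor.obj ⟨Y, Z⟩) X X' ≫ ePre (assocHom X Y Z) _
  /-- `V`-naturality of the associativity isomorphism in the second variable. -/
  assoc_naturality_middle : ∀ X Y Y' Z : A,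
    wl tensor X Y Y' ≫ wr tensor Z _ _ ≫ ePost _ (assocHom X Y' Z) =
      wr tensor Z Y Y' ≫ wl tensor X _ _ ≫ ePre (assocHom X Y Z) _
  /-- `V`-naturality of the associativity isomorphism in the third variable. -/
  assoc_naturality_right : ∀ X Y Z Z' : A,
    wl tensor (tensor.obj ⟨X, Y⟩) Z Z' ≫ ePost _ (assocHom X Y Z') =
      wl tensor Y Z Z' ≫ wl tensor X _ _ ≫ ePre (assocHom X Y Z) _
  leftUnit_naturality : ∀ X X' : A,
    wl tensor unit X X' ≫ ePost _ (leftUnitHom X') = ePre (leftUnitHom X) X'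
  rightUnit_naturality : ∀ X X' : A,
    wr tensor unit X X' ≫ ePost _ (rightUnitHom X') = ePre (rightUnitHom X) X'
  pentagon : ∀ W X Y Z : A,
    elComp (assocHom W X Y ≫ wr tensor Z _ _)
      (elComp (assocHom W (tensor.obj ⟨X, Y⟩) Z) (assocHom X Y Z ≫ wl tensor W _ _)) =
    elComp (assocHom (tensor.obj ⟨W, X⟩) Y Z) (assocHom W X (tensor.obj ⟨Y, Z⟩))
  triangle : ∀ X Y : A,
    elComp (assocHom X unit Y) (leftUnitHom Y ≫ wl tensor X _ _) =
      rightUnitHom X ≫ wr tensor Y _ _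

namespace MonoidalVCat

variable (M : MonoidalVCat V A)

lemma wl_el {X Y Z W : A} (f : 𝟙_ V ⟶ (X ⟶ᵥ Y)) (g : 𝟙_ V ⟶ (Y ⟶ᵥ Z)) :
    elComp f g ≫ wl M.tensor W X Z = elComp (f ≫ wl M.tensor W X Y) (g ≫ wl M.tensor W Y Z) :=
  elComp_map (tl M.tensor W) f g

lemma wr_el {X Y Z W : A} (f : 𝟙_ V ⟶ (X ⟶ᵥ Y)) (g : 𝟙_ V ⟶ (Y ⟶ᵥ Z)) :
    elComp f g ≫ wr M.tensor W X Z = elComp (f ≫ wr M.tensor W X Y) (g ≫ wr M.tensor W Y Z) :=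
  elComp_map (tr M.tensor W) f g

lemma wl_id (W X : A) : eId V X ≫ wl M.tensor W X X = eId V (M.tensor.obj ⟨W, X⟩) :=
  (tl M.tensor W).map_id X

lemma wr_id (W X : A) : eId V X ≫ wr M.tensor W X X = eId V (M.tensor.obj ⟨X, W⟩) :=
  (tr M.tensor W).map_id X

/-- Bifunctoriality of the tensor product. -/
lemma exchange {X X' Y Y' : A} (f : 𝟙_ V ⟶ (X ⟶ᵥ X')) (g : 𝟙_ V ⟶ (Y ⟶ᵥ Y')) :
    elComp (f ≫ wr M.tensor Y X X') (g ≫ wl M.tensor X' Y Y') =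
      elComp (g ≫ wl M.tensor X Y Y') (f ≫ wr M.tensor Y' X X') := by
  have h : (wl M.tensor X Y Y' ⊗ₘ wr M.tensor Y' X X') ≫ eComp V _ _ _ =
    (β_ _ _).hom ≫ (wr M.tensor Y X X' ⊗ₘ wl M.tensor X' Y Y') ≫ eComp V _ _ _ :=
      (wrNat M.tensor X X').naturality Y Y'
  rw [elComp, elComp, ← tensorHom_comp_tensorHom, ← tensorHom_comp_tensorHom, Category.assoc,
    Category.assoc, h, BraidedCategory.braiding_naturality_assoc, braiding_tensorUnit_left,
    unitors_inv_equal, unitors_equal]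
  simp

lemma el_cancel_left {x y z : A} {f : 𝟙_ V ⟶ (x ⟶ᵥ y)} {f' : 𝟙_ V ⟶ (y ⟶ᵥ x)}
    (h : elComp f' f = eId V y) {g g' : 𝟙_ V ⟶ (y ⟶ᵥ z)} (e : elComp f g = elComp f g') :
    g = g' := by
  have := congrArg (elComp f') e
  rwa [← elComp_assoc, ← elComp_assoc, h, eId_elComp, eId_elComp] at this

lemma el_cancel_right {x y z : A} {f : 𝟙_ V ⟶ (y ⟶ᵥ z)} {f' : 𝟙_ V ⟶ (z ⟶ᵥ y)}
    (h : elComp f f' = eId V y) {g g' : 𝟙_ V ⟶ (x ⟶ᵥ y)} (e : elComp g f = elComp g' f) :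
    g = g' := by
  have := congrArg (elComp · f') e
  simpa only [elComp_assoc, h, elComp_eId] using this

/-- `(I ⊗ f) ; λ = λ ; f`. -/
lemma leftUnit_el {X Y : A} (f : 𝟙_ V ⟶ (X ⟶ᵥ Y)) :
    elComp (f ≫ wl M.tensor M.unit X Y) (M.leftUnitHom Y) = elComp (M.leftUnitHom X) f := by
  rw [elComp_eq_ePost, Category.assoc, M.leftUnit_naturality, ← elComp_eq_ePre]

lemma unit_wl_injective {X Y : A} {f g : 𝟙_ V ⟶ (X ⟶ᵥ Y)}
    (h : f ≫ wl M.tensor M.unit X Y = g ≫ wl M.tensor M.unit X Y) : f = g := by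
  apply el_cancel_left (M.leftUnitInv_leftUnitHom X)
  rw [← leftUnit_el, h, leftUnit_el]

lemma assoc_el_left {X X' : A} (f : 𝟙_ V ⟶ (X ⟶ᵥ X')) (Y Z : A) :
    elComp (f ≫ wr M.tensor Y X X' ≫ wr M.tensor Z _ _) (M.assocHom X' Y Z) =
      elComp (M.assocHom X Y Z) (f ≫ wr M.tensor (M.tensor.obj ⟨Y, Z⟩) X X') := by
  rw [elComp_eq_ePost, elComp_eq_ePre, Category.assoc, Category.assoc, M.assoc_naturality_left,
    Category.assoc]

lemma assoc_el_middle {Y Y' : A} (f : 𝟙_ V ⟶ (Y ⟶ᵥ Y')) (X Z : A) :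
    elComp (f ≫ wl M.tensor X Y Y' ≫ wr M.tensor Z _ _) (M.assocHom X Y' Z) =
      elComp (M.assocHom X Y Z) (f ≫ wr M.tensor Z Y Y' ≫ wl M.tensor X _ _) := by
  rw [elComp_eq_ePost, elComp_eq_ePre, Category.assoc, Category.assoc, M.assoc_naturality_middle,
    Category.assoc, Category.assoc]

lemma leftUnit_tensor (X Y : A) :
    elComp (M.assocHom M.unit X Y) (M.leftUnitHom (M.tensor.obj ⟨X, Y⟩)) =
      M.leftUnitHom X ≫ wr M.tensor Y _ _ := by
  apply M.unit_wl_injective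
  apply el_cancel_left (M.assocInv_assocHom M.unit (M.tensor.obj ⟨M.unit, X⟩) Y)
  have h : elComp (M.assocInv M.unit M.unit X ≫ wr M.tensor Y _ _)
      (M.assocHom M.unit M.unit X ≫ wr M.tensor Y _ _) = eId V _ := by
    rw [← wr_el, M.assocInv_assocHom, wr_id]
  apply el_cancel_left h
  rw [wl_el, ← elComp_assoc (M.assocHom _ _ _) _ _, ← elComp_assoc, M.pentagon, elComp_assoc,
    M.triangle, ← assoc_el_left, Category.assoc, ← assoc_el_middle, ← elComp_assoc,
    ← Category.assoc (M.leftUnitHom X), ← wr_el, M.triangle, Category.assoc]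

end MonoidalVCat

end Monoidal

section Reverse

variable {V : Type u} [Category.{v} V] [MonoidalCategory V] [SymmetricCategory V]
  {A : Type u₁} [EnrichedCategory V A]

lemma insR_braiding (X Y Y' : A) :
    insR V X Y Y' ≫ (β_ (X ⟶ᵥ X) (Y ⟶ᵥ Y')).hom = insL V Y Y' X := by
  rw [insR, insL, Category.assoc, BraidedCategory.braiding_naturality_left]
  simp

lemma insL_braiding (X X' Y : A) :
    insL V X X' Y ≫ (β_ (X ⟶ᵥ X') (Y ⟶ᵥ Y)).hom = insR V Y X X' := by
  rw [insR, insL, Category.assoc, BraidedCategory.braiding_naturality_right]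
  simp

/-- The tensor product of the reverse monoidal `V`-category, `(X, Y) ↦ Y ⊗ X`. -/
def revTensor (T : EnrichedFunctor V (TensorCat A A) A) : EnrichedFunctor V (TensorCat A A) A :=
  (swapFunctor V A A).comp V T

lemma wl_revTensor (T : EnrichedFunctor V (TensorCat A A) A) (X Y Y' : A) :
    wl (revTensor T) X Y Y' = wr T X Y Y' := by
  change insR V X Y Y' ≫ (β_ _ _).hom ≫ T.map ⟨Y, X⟩ ⟨Y', X⟩ = _
  rw [reassoc_of% insR_braiding]; rfl

lemma wr_revTensor (T : EnrichedFunctor V (TensorCat A A) A) (Y X X' : A) :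
    wr (revTensor T) Y X X' = wl T Y X X' := by
  change insL V X X' Y ≫ (β_ _ _).hom ≫ T.map ⟨Y, X⟩ ⟨Y, X'⟩ = _
  rw [reassoc_of% insL_braiding]; rfl

lemma MonoidalVCat.pentagon_inv (M : MonoidalVCat V A) (W X Y Z : A) :
    elComp (M.assocInv Y X W ≫ wl M.tensor Z _ _)
      (elComp (M.assocInv Z (M.tensor.obj ⟨Y, X⟩) W) (M.assocInv Z Y X ≫ wr M.tensor W _ _)) =
      elComp (M.assocInv Z Y (M.tensor.obj ⟨X, W⟩)) (M.assocInv (M.tensor.obj ⟨Z, Y⟩) X W) := by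
  have h1 : elComp (M.assocInv Y X W ≫ wl M.tensor Z _ _)
      (M.assocHom Y X W ≫ wl M.tensor Z _ _) = eId V _ := by
    rw [← M.wl_el, M.assocInv_assocHom, M.wl_id]
  have h2 : elComp (M.assocInv Z Y X ≫ wr M.tensor W _ _)
      (M.assocHom Z Y X ≫ wr M.tensor W _ _) = eId V _ := by
    rw [← M.wr_el, M.assocInv_assocHom, M.wr_id]
  have h3 := M.assocInv_assocHom Z (M.tensor.obj ⟨Y, X⟩) W
  have h4 := M.assocHom_assocInv (M.tensor.obj ⟨Z, Y⟩) X W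
  have h5 := M.assocHom_assocInv Z Y (M.tensor.obj ⟨X, W⟩)
  have h6 := M.assocInv_assocHom Z Y (M.tensor.obj ⟨X, W⟩)
  have h7 := M.assocInv_assocHom (M.tensor.obj ⟨Z, Y⟩) X W
  have hp := M.pentagon Z Y X W
  refine MonoidalVCat.el_cancel_right (f := elComp (M.assocHom (M.tensor.obj ⟨Z, Y⟩) X W)
    (M.assocHom Z Y (M.tensor.obj ⟨X, W⟩))) (f' := elComp (M.assocInv Z Y (M.tensor.obj ⟨X, W⟩))
    (M.assocInv (M.tensor.obj ⟨Z, Y⟩) X W)) ?_ ?_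
  · rw [elComp_assoc, ← elComp_assoc _ _ (M.assocInv _ _ _), h5, eId_elComp, h4]
  · have e : elComp (elComp (M.assocInv Z Y (M.tensor.obj ⟨X, W⟩))
        (M.assocInv (M.tensor.obj ⟨Z, Y⟩) X W))
        (elComp (M.assocHom (M.tensor.obj ⟨Z, Y⟩) X W)
          (M.assocHom Z Y (M.tensor.obj ⟨X, W⟩))) = eId V _ := by
      rw [elComp_assoc, ← elComp_assoc _ _ (M.assocHom Z Y _), h7, eId_elComp, h6]
    rw [e, ← hp, elComp_assoc, elComp_assoc, ← elComp_assoc (_ ≫ wr M.tensor W _ _), h2,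
      eId_elComp, ← elComp_assoc (M.assocInv Z _ W), h3, eId_elComp, h1]

lemma MonoidalVCat.triangle' (M : MonoidalVCat V A) (X Y : A) :
    elComp (M.assocInv Y M.unit X) (M.rightUnitHom Y ≫ wr M.tensor X _ _) =
      M.leftUnitHom X ≫ wl M.tensor Y _ _ := by
  rw [← M.triangle, ← elComp_assoc, M.assocInv_assocHom, eId_elComp]

/-- The reverse monoidal `V`-category: the same `V`-category and unit, with tensor product
`(X, Y) ↦ Y ⊗ X`. -/
def MonoidalVCat.rev (M : MonoidalVCat V A) : MonoidalVCat V A where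
  tensor := revTensor M.tensor
  unit := M.unit
  assocHom X Y Z := M.assocInv Z Y X
  assocInv X Y Z := M.assocHom Z Y X
  leftUnitHom X := M.rightUnitHom X
  leftUnitInv X := M.rightUnitInv X
  rightUnitHom X := M.leftUnitHom X
  rightUnitInv X := M.leftUnitInv X
  assocHom_assocInv X Y Z := M.assocInv_assocHom Z Y X
  assocInv_assocHom X Y Z := M.assocHom_assocInv Z Y X
  leftUnitHom_leftUnitInv X := M.rightUnitHom_rightUnitInv X
  leftUnitInv_leftUnitHom X := M.rightUnitInv_rightUnitHom X
  rightUnitHom_rightUnitInv X := M.leftUnitHom_leftUnitInv X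
  rightUnitInv_rightUnitHom X := M.leftUnitInv_leftUnitHom X
  assoc_naturality_left X X' Y Z := by
    rw [wr_revTensor, wr_revTensor, wr_revTensor]
    have h := ePost_ePre_inv (M.assocInv_assocHom Z Y X) (M.assocHom_assocInv Z Y X')
      (M.assoc_naturality_right Z Y X X' |>.trans (Category.assoc _ _ _).symm)
    rwa [Category.assoc] at h
  assoc_naturality_middle X Y Y' Z := by
    rw [wr_revTensor, wr_revTensor, wl_revTensor, wl_revTensor]
    have h := ePost_ePre_inv (M.assocInv_assocHom Z Y X) (M.assocHom_assocInv Z Y' X)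
      ((Category.assoc _ _ _).trans
        (M.assoc_naturality_middle Z Y Y' X |>.trans (Category.assoc _ _ _).symm))
    rwa [Category.assoc, Category.assoc] at h
  assoc_naturality_right X Y Z Z' := by
    rw [wl_revTensor, wl_revTensor, wl_revTensor]
    have h := ePost_ePre_inv (M.assocInv_assocHom Z Y X) (M.assocHom_assocInv Z' Y X)
      ((Category.assoc _ _ _).trans (M.assoc_naturality_left Z Z' Y X))
    rwa [Category.assoc] at h
  leftUnit_naturality X X' := by
    rw [wl_revTensor]; exact M.rightUnit_naturality X X'
  rightUnit_naturality X X' := by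
    rw [wr_revTensor]; exact M.leftUnit_naturality X X'
  pentagon W X Y Z := by
    rw [wr_revTensor, wl_revTensor]; exact M.pentagon_inv W X Y Z
  triangle X Y := by
    rw [wr_revTensor, wl_revTensor]; exact M.triangle' X Y

end Reverse

section Evaluation

variable {V : Type u} [Category.{v} V] [MonoidalCategory V] [SymmetricCategory V]
  [MonoidalClosed V]

/-- The morphism of `V` corresponding to an element `I ⟶ [X, Y]`. -/
def vEl {X Y : V} (f : 𝟙_ V ⟶ (X ⟶ᵥ Y)) : X ⟶ Y := (ρ_ X).inv ≫ MonoidalClosed.uncurry f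

/-- The element `I ⟶ [X, Y]` corresponding to a morphism of `V`. -/
def elV {X Y : V} (f : X ⟶ Y) : 𝟙_ V ⟶ (X ⟶ᵥ Y) := MonoidalClosed.curry ((ρ_ X).hom ≫ f)

@[simp]
lemma vEl_elV {X Y : V} (f : X ⟶ Y) : vEl (elV f) = f := by
  rw [vEl, elV, MonoidalClosed.uncurry_curry, Iso.inv_hom_id_assoc]

lemma vEl_injective {X Y : V} {f g : 𝟙_ V ⟶ (X ⟶ᵥ Y)} (h : vEl f = vEl g) : f = g := by
  rw [vEl, vEl, cancel_epi] at h
  exact MonoidalClosed.uncurry_injective h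

lemma uncurry_injective' {X Y W : V} {f g : W ⟶ (X ⟶ᵥ Y)}
    (h : MonoidalClosed.uncurry f = MonoidalClosed.uncurry g) : f = g :=
  MonoidalClosed.uncurry_injective h

lemma uncurry_ePost {X Y Z W : V} (f : W ⟶ (X ⟶ᵥ Y)) (g : 𝟙_ V ⟶ (Y ⟶ᵥ Z)) :
    MonoidalClosed.uncurry (f ≫ ePost X g) = MonoidalClosed.uncurry f ≫ vEl g := by
  rw [comp_ePost, MonoidalClosed.uncurry_natural_left, uncurry_comp', vEl]
  rw [rightUnitor_inv_naturality_assoc]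
  simp

lemma uncurry_ePre {X Y Z W : V} (f : 𝟙_ V ⟶ (X ⟶ᵥ Y)) (g : W ⟶ (Y ⟶ᵥ Z)) :
    MonoidalClosed.uncurry (g ≫ ePre f Z) = vEl f ▷ W ≫ MonoidalClosed.uncurry g := by
  rw [comp_ePre, MonoidalClosed.uncurry_natural_left, uncurry_comp', vEl]
  simp

@[simp]
lemma vEl_eId (X : V) : vEl (eId V X) = 𝟙 X := by
  rw [vEl, uncurry_id', Iso.inv_hom_id]

lemma vEl_elComp {X Y Z : V} (f : 𝟙_ V ⟶ (X ⟶ᵥ Y)) (g : 𝟙_ V ⟶ (Y ⟶ᵥ Z)) :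
    vEl (elComp f g) = vEl f ≫ vEl g := by
  rw [elComp_eq_ePost, vEl, uncurry_ePost, ← Category.assoc]; rfl

variable {C : Type u₁} [EnrichedCategory V C] {D : Type u₂} [EnrichedCategory V D]

lemma actOn_eq (F : EnrichedFunctor V C V) {c d : C} {W : V} (f : W ⟶ (c ⟶ᵥ d)) :
    actOn F f = MonoidalClosed.uncurry (f ≫ F.map c d) := by
  rw [MonoidalClosed.uncurry_natural_left]; rfl

lemma actEl_eq (F : EnrichedFunctor V C V) {c d : C} (f : 𝟙_ V ⟶ (c ⟶ᵥ d)) :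
    actEl F f = vEl (f ≫ F.map c d) := by
  rw [actEl, actOn_eq, vEl]

lemma actOn_comp_functor (K : EnrichedFunctor V D C) (F : EnrichedFunctor V C V) {c d : D} {W : V}
    (f : W ⟶ (c ⟶ᵥ d)) : actOn (K.comp V F) f = actOn F (f ≫ K.map c d) := by
  rw [actOn_eq, actOn_eq, Category.assoc]
  rfl

lemma actOn_actEl (F : EnrichedFunctor V C V) {c d e : C} {W : V} (f : W ⟶ (c ⟶ᵥ d))
    (g : 𝟙_ V ⟶ (d ⟶ᵥ e)) : actOn F f ≫ actEl F g = actOn F (f ≫ ePost c g) := by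
  rw [actOn_eq, actEl_eq, ← uncurry_ePost, actOn_eq, Category.assoc, ← ePost_map, Category.assoc]

lemma actEl_actOn (F : EnrichedFunctor V C V) {c d e : C} {W : V} (f : 𝟙_ V ⟶ (c ⟶ᵥ d))
    (g : W ⟶ (d ⟶ᵥ e)) : actEl F f ▷ W ≫ actOn F g = actOn F (g ≫ ePre f e) := by
  rw [actOn_eq, actEl_eq, ← uncurry_ePre, actOn_eq, Category.assoc, ← ePre_map, Category.assoc]

lemma actEl_actEl (F : EnrichedFunctor V C V) {c d e : C} (f : 𝟙_ V ⟶ (c ⟶ᵥ d))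
    (g : 𝟙_ V ⟶ (d ⟶ᵥ e)) : actEl F f ≫ actEl F g = actEl F (elComp f g) := by
  rw [actEl_eq, actEl_eq, actEl_eq, ← vEl_elComp, elComp_map]

@[simp]
lemma actEl_eId (F : EnrichedFunctor V C V) (c : C) : actEl F (eId V c) = 𝟙 _ := by
  rw [actEl_eq, F.map_id, vEl_eId]

/-- For ungraded transformations, naturality in terms of pre- and postcomposition. -/
lemma GNat.el_naturality {F G : EnrichedFunctor V C D} (σ : VNat F G) (c d : C) :
    F.map c d ≫ ePost _ (σ.app d) = G.map c d ≫ ePre (σ.app c) _ := by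
  rw [comp_ePost, comp_ePre, σ.naturality]
  simp

/-- A family of elements satisfying the condition of `GNat.el_naturality` is `V`-natural. -/
@[simps]
def GNat.ofEl {F G : EnrichedFunctor V C D} (app : ∀ c, 𝟙_ V ⟶ (F.obj c ⟶ᵥ G.obj c))
    (h : ∀ c d, F.map c d ≫ ePost _ (app d) = G.map c d ≫ ePre (app c) _) : VNat F G where
  app := app
  naturality c d := by
    have h := h c d
    rw [comp_ePost, comp_ePre, Iso.inv_comp_eq] at h
    rw [h]
    simp

/-- A graded transformation with a prescribed form of its components. -/
@[simps]
def GNat.copy {F G : EnrichedFunctor V C D} {S : V} (σ : GNat S F G)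
    (app : ∀ c, S ⟶ (F.obj c ⟶ᵥ G.obj c)) (h : ∀ c, app c = σ.app c) : GNat S F G where
  app := app
  naturality c d := by rw [h, h]; exact σ.naturality c d

/-- The components `F c ⊗ S ⟶ G c` of a graded transformation of functors into `V`. -/
def GNat.ev {F G : EnrichedFunctor V C V} {S : V} (σ : GNat S F G) (c : C) :
    F.obj c ⊗ S ⟶ G.obj c := MonoidalClosed.uncurry (σ.app c)

lemma GNat.ev_naturality {F G : EnrichedFunctor V C V} {S : V} (σ : GNat S F G) {c d : C} {W : V}
    (f : W ⟶ (c ⟶ᵥ d)) :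
    actOn F f ▷ S ≫ σ.ev d = sw _ _ _ ≫ σ.ev c ▷ W ≫ actOn G f := by
  have e : actOn F (𝟙 (c ⟶ᵥ d)) ▷ S ≫ σ.ev d = sw _ _ _ ≫ σ.ev c ▷ _ ≫ actOn G (𝟙 (c ⟶ᵥ d)) := by
    have := congrArg MonoidalClosed.uncurry (σ.naturality c d)
    rw [uncurry_comp', MonoidalClosed.uncurry_natural_left, uncurry_comp'] at this
    rw [actOn_eq, actOn_eq, Category.id_comp, Category.id_comp, GNat.ev, GNat.ev,
      ← cancel_epi (α_ _ _ _).inv, this, sw]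
    simp
  rw [← Category.comp_id f, actOn_pre, actOn_pre, comp_whiskerRight, Category.assoc, e,
    reassoc_of% sw_nat_mid, ← whisker_exchange_assoc]

/-- A graded transformation of functors into `V` from its components `F c ⊗ S ⟶ G c`. -/
@[simps]
def GNat.ofEv {F G : EnrichedFunctor V C V} {S : V} (k : ∀ c, F.obj c ⊗ S ⟶ G.obj c)
    (h : ∀ c d, act F c d ▷ S ≫ k d = sw _ _ _ ≫ k c ▷ _ ≫ act G c d) : GNat S F G where
  app c := MonoidalClosed.curry (k c)
  naturality c d := by
    apply uncurry_injective'
    rw [uncurry_comp', MonoidalClosed.uncurry_natural_left, uncurry_comp',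
      MonoidalClosed.uncurry_curry, MonoidalClosed.uncurry_curry]
    have := h c d
    rw [act, act] at this
    rw [this, sw]
    simp

@[simp]
lemma GNat.ofEv_ev {F G : EnrichedFunctor V C V} {S : V} (k : ∀ c, F.obj c ⊗ S ⟶ G.obj c) (h)
    (c : C) : (GNat.ofEv k h).ev c = k c := MonoidalClosed.uncurry_curry _

end Evaluation

section FunctorEvaluation

variable {V : Type u} [Category.{v} V] [MonoidalCategory V] [SymmetricCategory V]
  [MonoidalClosed V] [HasLimits V]
variable {C : Type v} [EnrichedCategory V C] {D : Type v} [EnrichedCategory V D]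
  {N : Type u₁} [EnrichedCategory V N]

/-- The components `F c ⊗ W ⟶ G c` of a generalised element of `[C, V](F, G)`. -/
def nev {F G : EnrichedFunctor V C V} {W : V} (x : W ⟶ natObj F G) (c : C) :
    F.obj c ⊗ W ⟶ G.obj c := MonoidalClosed.uncurry (x ≫ natπ F G c)

/-- The components `F c ⟶ G c` of an element of `[C, V](F, G)`. -/
def nEl {F G : EnrichedFunctor V C V} (x : 𝟙_ V ⟶ natObj F G) (c : C) :
    F.obj c ⟶ G.obj c := vEl (x ≫ natπ F G c)

lemma nev_ext {F G : EnrichedFunctor V C V} {W : V} {x y : W ⟶ natObj F G}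
    (h : ∀ c, nev x c = nev y c) : x = y :=
  natObj_ext fun c => uncurry_injective' (h c)

lemma nEl_ext {F G : EnrichedFunctor V C V} {x y : 𝟙_ V ⟶ natObj F G}
    (h : ∀ c, nEl x c = nEl y c) : x = y :=
  natObj_ext fun c => vEl_injective (h c)

lemma nev_pre {F G : EnrichedFunctor V C V} {W W' : V} (g : W' ⟶ W) (x : W ⟶ natObj F G) (c : C) :
    nev (g ≫ x) c = _ ◁ g ≫ nev x c := by
  rw [nev, Category.assoc, MonoidalClosed.uncurry_natural_left]; rfl

lemma nev_naturality {F G : EnrichedFunctor V C V} {W : V} (x : W ⟶ natObj F G) {c d : C} {U : V}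
    (f : U ⟶ (c ⟶ᵥ d)) :
    actOn F f ▷ W ≫ nev x d = sw _ _ _ ≫ nev x c ▷ U ≫ actOn G f :=
  ((natUniv F G).reindex x).ev_naturality f

lemma nEl_naturality {F G : EnrichedFunctor V C V} (x : 𝟙_ V ⟶ natObj F G) {c d : C} {U : V}
    (f : U ⟶ (c ⟶ᵥ d)) : actOn F f ≫ nEl x d = nEl x c ▷ U ≫ actOn G f := by
  have e : ∀ c, nEl x c = (ρ_ _).inv ≫ nev x c := fun c => rfl
  rw [e, e, rightUnitor_inv_naturality_assoc, nev_naturality, reassoc_of% sw_unit']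
  simp

lemma nEl_naturality_el {F G : EnrichedFunctor V C V} (x : 𝟙_ V ⟶ natObj F G) {c d : C}
    (f : 𝟙_ V ⟶ (c ⟶ᵥ d)) : actEl F f ≫ nEl x d = nEl x c ≫ actEl G f := by
  rw [actEl, actEl, Category.assoc, nEl_naturality, rightUnitor_inv_naturality_assoc]

@[simp]
lemma nev_natLift {F G : EnrichedFunctor V C V} {W : V} (σ : GNat W F G) (c : C) :
    nev (natLift σ) c = σ.ev c := by
  rw [nev, natLift_π]; rfl

/-- The element of `[C, V](F, G)` given by a family of morphisms `F c ⟶ G c`, `V`-natural in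
`c`. -/
def elNat {F G : EnrichedFunctor V C V} (k : ∀ c, F.obj c ⟶ G.obj c)
    (h : ∀ c d, act F c d ≫ k d = k c ▷ _ ≫ act G c d) : 𝟙_ V ⟶ natObj F G :=
  natLift (GNat.ofEv (fun c => (ρ_ _).hom ≫ k c) (fun c d => by
    rw [reassoc_of% sw_unit', rightUnitor_naturality_assoc, h]
    simp))

@[simp]
lemma nEl_elNat {F G : EnrichedFunctor V C V} (k : ∀ c, F.obj c ⟶ G.obj c) (h) (c : C) :
    nEl (elNat k h) c = k c := by
  rw [nEl, elNat, natLift_π]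
  exact vEl_elV _

lemma natπ_ePost {F G H : EnrichedFunctor V C V} (g : 𝟙_ V ⟶ natObj G H) (c : C) :
    ePost F (y := G) (z := H) g ≫ natπ F H c = natπ F G c ≫ ePost _ (g ≫ natπ G H c) := by
  rw [comp_ePost, ePost, Category.assoc, Category.assoc, functorCategory_eComp_π, ← id_tensorHom,
    tensorHom_comp_tensorHom_assoc, Category.id_comp]
  rfl

lemma natπ_ePre {F G H : EnrichedFunctor V C V} (f : 𝟙_ V ⟶ natObj F G) (c : C) :
    ePre (x := F) (y := G) f H ≫ natπ F H c = natπ G H c ≫ ePre (f ≫ natπ F G c) _ := by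
  rw [comp_ePre, ePre, Category.assoc, Category.assoc, functorCategory_eComp_π, ← tensorHom_id,
    tensorHom_comp_tensorHom_assoc, Category.id_comp]
  rfl

lemma nev_ePost {F G H : EnrichedFunctor V C V} {W : V} (f : W ⟶ natObj F G)
    (g : 𝟙_ V ⟶ natObj G H) (c : C) :
    nev (f ≫ ePost F (y := G) (z := H) g) c = nev f c ≫ nEl g c := by
  rw [nev, Category.assoc, natπ_ePost, ← Category.assoc, uncurry_ePost]; rfl

lemma nev_ePre {F G H : EnrichedFunctor V C V} {W : V} (f : 𝟙_ V ⟶ natObj F G)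
    (g : W ⟶ natObj G H) (c : C) :
    nev (g ≫ ePre (x := F) (y := G) f H) c = nEl f c ▷ W ≫ nev g c := by
  rw [nev, Category.assoc, natπ_ePre, ← Category.assoc, uncurry_ePre]; rfl

lemma nev_eComp {F G H : EnrichedFunctor V C V} {W U : V} (f : W ⟶ natObj F G)
    (g : U ⟶ natObj G H) (c : C) :
    nev ((f ⊗ₘ g) ≫ eComp V F G H) c = (α_ _ _ _).inv ≫ nev f c ▷ U ≫ nev g c := by
  rw [nev, Category.assoc, functorCategory_eComp_π, tensorHom_comp_tensorHom_assoc, uncurry_comp']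
  rfl

lemma nev_eId (F : EnrichedFunctor V C V) (c : C) : nev (eId V F) c = (ρ_ _).hom := by
  rw [nev, functorCategory_eId_π, uncurry_id']

@[simp]
lemma nEl_eId (F : EnrichedFunctor V C V) (c : C) : nEl (eId V F) c = 𝟙 _ := by
  rw [nEl, functorCategory_eId_π, vEl_eId]

lemma nEl_elComp {F G H : EnrichedFunctor V C V} (f : 𝟙_ V ⟶ natObj F G)
    (g : 𝟙_ V ⟶ natObj G H) (c : C) :
    nEl (elComp (x := F) (y := G) (z := H) f g) c = nEl f c ≫ nEl g c := by
  rw [elComp_eq_ePost, nEl, vEl]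
  change _ ≫ nev (f ≫ ePost F g) c = _
  rw [nev_ePost, ← Category.assoc]; rfl

/-- `V`-natural transformations between `V`-functors into a functor category `[C, V]`, in terms
of components. -/
def GNat.ofNev {H K : EnrichedFunctor V N (EnrichedFunctor V C V)}
    (e : ∀ x, 𝟙_ V ⟶ natObj (H.obj x) (K.obj x))
    (h : ∀ x y c, nev (H.map x y) c ≫ nEl (e y) c = nEl (e x) c ▷ _ ≫ nev (K.map x y) c) :
    VNat H K :=
  GNat.ofEl e fun x y => nev_ext fun c =>
    (nev_ePost _ _ _).trans ((h x y c).trans (nev_ePre _ _ _).symm)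

@[simp]
lemma GNat.ofNev_app {H K : EnrichedFunctor V N (EnrichedFunctor V C V)}
    (e : ∀ x, 𝟙_ V ⟶ natObj (H.obj x) (K.obj x)) (h) (x : N) :
    (GNat.ofNev e h).app x = e x := rfl

end FunctorEvaluation

section TwoVariable

variable {V : Type u} [Category.{v} V] [MonoidalCategory V] [SymmetricCategory V]
  [MonoidalClosed V] {A : Type u₁} [EnrichedCategory V A]

/-- The object `(X, Y)` of `Aᵒᵖ ⊗ A`. -/
abbrev pr (X Y : A) : TensorCat Aᵒᵖ A := ⟨Opposite.op X, Y⟩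

/-- `(X, g)` for `g : W ⟶ A(Y, Y')`. -/
def elR (X : A) {Y Y' : A} {W : V} (g : W ⟶ (Y ⟶ᵥ Y')) : W ⟶ (pr X Y ⟶ᵥ pr X Y') :=
  g ≫ insR V (Opposite.op X) Y Y'

/-- `(f, Y)` for `f : W ⟶ A(X', X)`. -/
def elL (Y : A) {X X' : A} {W : V} (f : W ⟶ (X' ⟶ᵥ X)) : W ⟶ (pr X Y ⟶ᵥ pr X' Y) :=
  f ≫ insL V (Opposite.op X) (Opposite.op X') Y

lemma ePost_op {X Y Z : A} (g : 𝟙_ V ⟶ (Z ⟶ᵥ Y)) :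
    ePost (Opposite.op X) (y := Opposite.op Y) (z := Opposite.op Z) g = ePre g X := by
  change (ρ_ _).inv ≫ _ ◁ g ≫ (β_ (Y ⟶ᵥ X) (Z ⟶ᵥ Y)).hom ≫ eComp V Z Y X =
    (λ_ _).inv ≫ g ▷ _ ≫ eComp V Z Y X
  rw [BraidedCategory.braiding_naturality_right_assoc]
  simp

lemma ePre_op {X Y Z : A} (g : 𝟙_ V ⟶ (Y ⟶ᵥ X)) :
    ePre (x := Opposite.op X) (y := Opposite.op Y) g (Opposite.op Z) = ePost Z g := by
  change (λ_ _).inv ≫ g ▷ _ ≫ (β_ (Y ⟶ᵥ X) (Z ⟶ᵥ Y)).hom ≫ eComp V Z Y X =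
    (ρ_ _).inv ≫ _ ◁ g ≫ eComp V Z Y X
  rw [BraidedCategory.braiding_naturality_left_assoc]
  simp

lemma elR_ePost (X : A) {Y Y' Y'' : A} {W : V} (g : W ⟶ (Y ⟶ᵥ Y')) (h : 𝟙_ V ⟶ (Y' ⟶ᵥ Y'')) :
    elR X g ≫ ePost _ (elR X h) = elR X (g ≫ ePost Y h) := by
  rw [elR, elR, elR, Category.assoc, Category.assoc]
  exact g ≫= (ePost_map (insRFunctor V Aᵒᵖ A (Opposite.op X)) Y h).symm

lemma elR_ePre (X : A) {Y Y' Y'' : A} {W : V} (h : 𝟙_ V ⟶ (Y ⟶ᵥ Y')) (g : W ⟶ (Y' ⟶ᵥ Y'')) :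
    elR X g ≫ ePre (elR X h) _ = elR X (g ≫ ePre h Y'') := by
  rw [elR, elR, elR, Category.assoc, Category.assoc]
  exact g ≫= (ePre_map (insRFunctor V Aᵒᵖ A (Opposite.op X)) h Y'').symm

lemma elL_ePost (Y : A) {X X' X'' : A} {W : V} (g : W ⟶ (X' ⟶ᵥ X)) (h : 𝟙_ V ⟶ (X'' ⟶ᵥ X')) :
    elL Y g ≫ ePost _ (elL Y h) = elL Y (g ≫ ePre h X) := by
  rw [elL, elL, elL, Category.assoc, Category.assoc]
  refine g ≫= (ePost_map (insLFunctor V Aᵒᵖ A Y) (Opposite.op X) (y := Opposite.op X')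
    (z := Opposite.op X'') h).symm.trans ?_
  rw [ePost_op]; rfl

lemma elL_ePre (Y : A) {X X' X'' : A} {W : V} (h : 𝟙_ V ⟶ (X' ⟶ᵥ X)) (g : W ⟶ (X'' ⟶ᵥ X')) :
    elL Y g ≫ ePre (elL Y h) _ = elL Y (g ≫ ePost X'' h) := by
  rw [elL, elL, elL, Category.assoc, Category.assoc]
  refine g ≫= (ePre_map (insLFunctor V Aᵒᵖ A Y) (x := Opposite.op X) (y := Opposite.op X')
    h (Opposite.op X'')).symm.trans ?_
  rw [ePre_op]; rfl

/-- Interchange of the two variables. -/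
lemma elR_elL {X X' Y Y' : A} {W : V} (g : W ⟶ (Y ⟶ᵥ Y')) (h : 𝟙_ V ⟶ (X' ⟶ᵥ X)) :
    elR X g ≫ ePost _ (elL Y' h) = elR X' g ≫ ePre (elL Y h) _ := by
  rw [elR, elR, Category.assoc, Category.assoc]
  exact g ≫= GNat.el_naturality
    ((insLNat (V := V) (D := A) (Opposite.op X) (Opposite.op X')).reindex h) Y Y'

lemma elL_elR {X X' Y Y' : A} {W : V} (g : W ⟶ (X' ⟶ᵥ X)) (h : 𝟙_ V ⟶ (Y ⟶ᵥ Y')) :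
    elL Y g ≫ ePost _ (elR X' h) = elL Y' g ≫ ePre (elR X h) _ := by
  rw [elL, elL, Category.assoc, Category.assoc]
  exact g ≫= GNat.el_naturality
    ((insRNat (V := V) (C := Aᵒᵖ) Y Y').reindex h) (Opposite.op X) (Opposite.op X')

variable (T : EnrichedFunctor V (TensorCat Aᵒᵖ A) V)

/-- `T(X, Y) ⊗ W ⟶ T(X, Y')` for `g : W ⟶ A(Y, Y')`. -/
def actR (X : A) {Y Y' : A} {W : V} (g : W ⟶ (Y ⟶ᵥ Y')) :
    T.obj (pr X Y) ⊗ W ⟶ T.obj (pr X Y') := actOn T (elR X g)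

/-- `T(X, Y) ⊗ W ⟶ T(X', Y)` for `f : W ⟶ A(X', X)`. -/
def actL (Y : A) {X X' : A} {W : V} (f : W ⟶ (X' ⟶ᵥ X)) :
    T.obj (pr X Y) ⊗ W ⟶ T.obj (pr X' Y) := actOn T (elL Y f)

/-- `T(X, g) : T(X, Y) ⟶ T(X, Y')`. -/
def mapR (X : A) {Y Y' : A} (g : 𝟙_ V ⟶ (Y ⟶ᵥ Y')) : T.obj (pr X Y) ⟶ T.obj (pr X Y') :=
  actEl T (elR X g)

/-- `T(f, Y) : T(X, Y) ⟶ T(X', Y)`. -/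
def mapL (Y : A) {X X' : A} (f : 𝟙_ V ⟶ (X' ⟶ᵥ X)) : T.obj (pr X Y) ⟶ T.obj (pr X' Y) :=
  actEl T (elL Y f)

/-- `T(f, g) : T(X, Y) ⟶ T(X', Y')`. -/
def mapLR {X X' Y Y' : A} (f : 𝟙_ V ⟶ (X' ⟶ᵥ X)) (g : 𝟙_ V ⟶ (Y ⟶ᵥ Y')) :
    T.obj (pr X Y) ⟶ T.obj (pr X' Y') := mapL T Y f ≫ mapR T X' g

variable {X X' X'' Y Y' Y'' : A} {W : V}

lemma actR_mapR (g : W ⟶ (Y ⟶ᵥ Y')) (h : 𝟙_ V ⟶ (Y' ⟶ᵥ Y'')) :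
    actR T X g ≫ mapR T X h = actR T X (g ≫ ePost Y h) := by
  rw [actR, mapR, actOn_actEl, elR_ePost, actR]

lemma mapR_actR (h : 𝟙_ V ⟶ (Y ⟶ᵥ Y')) (g : W ⟶ (Y' ⟶ᵥ Y'')) :
    mapR T X h ▷ W ≫ actR T X g = actR T X (g ≫ ePre h Y'') := by
  rw [actR, mapR, actEl_actOn, elR_ePre, actR]

lemma actL_mapL (g : W ⟶ (X' ⟶ᵥ X)) (h : 𝟙_ V ⟶ (X'' ⟶ᵥ X')) :
    actL T Y g ≫ mapL T Y h = actL T Y (g ≫ ePre h X) := by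
  rw [actL, mapL, actOn_actEl, elL_ePost, actL]

lemma mapL_actL (h : 𝟙_ V ⟶ (X' ⟶ᵥ X)) (g : W ⟶ (X'' ⟶ᵥ X')) :
    mapL T Y h ▷ W ≫ actL T Y g = actL T Y (g ≫ ePost X'' h) := by
  rw [actL, mapL, actEl_actOn, elL_ePre, actL]

lemma actR_mapL (g : W ⟶ (Y ⟶ᵥ Y')) (h : 𝟙_ V ⟶ (X' ⟶ᵥ X)) :
    actR T X g ≫ mapL T Y' h = mapL T Y h ▷ W ≫ actR T X' g := by
  rw [actR, actR, mapL, mapL, actOn_actEl, actEl_actOn, elR_elL]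

lemma actL_mapR (g : W ⟶ (X' ⟶ᵥ X)) (h : 𝟙_ V ⟶ (Y ⟶ᵥ Y')) :
    actL T Y g ≫ mapR T X' h = mapR T X h ▷ W ≫ actL T Y' g := by
  rw [actL, actL, mapR, mapR, actOn_actEl, actEl_actOn, elL_elR]

lemma elR_elComp (X : A) (g : 𝟙_ V ⟶ (Y ⟶ᵥ Y')) (h : 𝟙_ V ⟶ (Y' ⟶ᵥ Y'')) :
    elComp (elR X g) (elR X h) = elR X (elComp g h) := by
  rw [elComp_eq_ePost, elR_ePost, elComp_eq_ePost]

lemma elL_elComp (Y : A) (g : 𝟙_ V ⟶ (X' ⟶ᵥ X)) (h : 𝟙_ V ⟶ (X'' ⟶ᵥ X')) :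
    elComp (elL Y g) (elL Y h) = elL Y (elComp h g) := by
  rw [elComp_eq_ePost, elL_ePost, elComp_eq_ePre]

lemma mapR_mapR (g : 𝟙_ V ⟶ (Y ⟶ᵥ Y')) (h : 𝟙_ V ⟶ (Y' ⟶ᵥ Y'')) :
    mapR T X g ≫ mapR T X h = mapR T X (elComp g h) := by
  rw [mapR, mapR, actEl_actEl, elR_elComp, mapR]

lemma mapL_mapL (g : 𝟙_ V ⟶ (X' ⟶ᵥ X)) (h : 𝟙_ V ⟶ (X'' ⟶ᵥ X')) :
    mapL T Y g ≫ mapL T Y h = mapL T Y (elComp h g) := by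
  rw [mapL, mapL, actEl_actEl, elL_elComp, mapL]

lemma mapR_mapL (g : 𝟙_ V ⟶ (Y ⟶ᵥ Y')) (h : 𝟙_ V ⟶ (X' ⟶ᵥ X)) :
    mapR T X g ≫ mapL T Y' h = mapL T Y h ≫ mapR T X' g := by
  rw [mapR, mapL, mapR, mapL, actEl_actEl, actEl_actEl, elComp_eq_ePost, elR_elL, elComp_eq_ePre]

@[simp]
lemma mapR_eId (X Y : A) : mapR T X (eId V Y) = 𝟙 _ := by
  have : elR X (eId V Y) = eId V (pr X Y) := (insRFunctor V Aᵒᵖ A (Opposite.op X)).map_id Y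
  rw [mapR, this, actEl_eId]

@[simp]
lemma mapL_eId (X Y : A) : mapL T Y (eId V X) = 𝟙 _ := by
  have : elL Y (eId V X) = eId V (pr X Y) := (insLFunctor V Aᵒᵖ A Y).map_id (Opposite.op X)
  rw [mapL, this, actEl_eId]

@[simp]
lemma mapLR_eId (X Y : A) : mapLR T (eId V X) (eId V Y) = 𝟙 _ := by
  rw [mapLR, mapL_eId, mapR_eId, Category.id_comp]

lemma mapLR_mapLR (f : 𝟙_ V ⟶ (X' ⟶ᵥ X)) (g : 𝟙_ V ⟶ (Y ⟶ᵥ Y')) (f' : 𝟙_ V ⟶ (X'' ⟶ᵥ X'))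
    (g' : 𝟙_ V ⟶ (Y' ⟶ᵥ Y'')) :
    mapLR T f g ≫ mapLR T f' g' = mapLR T (elComp f' f) (elComp g g') := by
  rw [mapLR, mapLR, mapLR, Category.assoc, ← Category.assoc (mapR T X' g), mapR_mapL,
    Category.assoc, mapR_mapR, ← Category.assoc, mapL_mapL]

lemma actR_mapLR (f : 𝟙_ V ⟶ (X' ⟶ᵥ X)) (g : W ⟶ (Y ⟶ᵥ Y')) (h : 𝟙_ V ⟶ (Y' ⟶ᵥ Y'')) :
    actR T X g ≫ mapLR T f h = mapL T Y f ▷ W ≫ actR T X' (g ≫ ePost Y h) := by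
  rw [mapLR, ← Category.assoc, actR_mapL, Category.assoc, actR_mapR]

lemma mapLR_actR (f : 𝟙_ V ⟶ (X' ⟶ᵥ X)) (h : 𝟙_ V ⟶ (Y ⟶ᵥ Y')) (g : W ⟶ (Y' ⟶ᵥ Y'')) :
    mapLR T f h ▷ W ≫ actR T X' g = mapL T Y f ▷ W ≫ actR T X' (g ≫ ePre h Y'') := by
  rw [mapLR, comp_whiskerRight, Category.assoc, mapR_actR]

lemma actL_mapLR (g : W ⟶ (X' ⟶ᵥ X)) (f : 𝟙_ V ⟶ (X'' ⟶ᵥ X')) (h : 𝟙_ V ⟶ (Y ⟶ᵥ Y')) :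
    actL T Y g ≫ mapLR T f h = mapR T X h ▷ W ≫ actL T Y' (g ≫ ePre f X) := by
  rw [mapLR, ← mapR_mapL, ← Category.assoc, actL_mapR, Category.assoc, actL_mapL]

lemma mapLR_actL (f : 𝟙_ V ⟶ (X' ⟶ᵥ X)) (h : 𝟙_ V ⟶ (Y ⟶ᵥ Y')) (g : W ⟶ (X'' ⟶ᵥ X')) :
    mapLR T f h ▷ W ≫ actL T Y' g = mapR T X h ▷ W ≫ actL T Y' (g ≫ ePost X'' f) := by
  rw [mapLR, ← mapR_mapL, comp_whiskerRight, Category.assoc, mapL_actL]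

end TwoVariable

section Theta

variable {V : Type u} [Category.{v} V] [MonoidalCategory V] [SymmetricCategory V]
  {A : Type v} [EnrichedCategory V A] (t : EnrichedFunctor V (TensorCat A A) A)

/-- The `V`-functor `Aᵒᵖ ⊗ A ⟶ Aᵒᵖ ⊗ A`, `(X, Y) ↦ (Z ⊗ X, Z' ⊗ Y)`. -/
def act2 (Z Z' : A) : EnrichedFunctor V (TensorCat Aᵒᵖ A) (TensorCat Aᵒᵖ A) :=
  tensorFunctor V (opFunctor V (tl t Z)) (tl t Z')

/-- The `V`-functor `Aᵒᵖ ⊗ A ⟶ Aᵒᵖ ⊗ A`, `(Z, Z') ↦ (Z ⊗ X, Z' ⊗ Y)`. -/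
def orbit (X Y : A) : EnrichedFunctor V (TensorCat Aᵒᵖ A) (TensorCat Aᵒᵖ A) :=
  tensorFunctor V (opFunctor V (tr t X)) (tr t Y)

lemma elR_tensor {X Y Y' : A} {W : V} (g : W ⟶ (Y ⟶ᵥ Y')) (F G : EnrichedFunctor V A A) :
    elR X g ≫ (tensorFunctor V (opFunctor V F) G).map (pr X Y) (pr X Y') =
      elR (F.obj X) (g ≫ G.map Y Y') := by
  change (g ≫ (λ_ _).inv ≫ eId V X ▷ _) ≫ (F.map X X ⊗ₘ G.map Y Y') =
    (g ≫ G.map Y Y') ≫ (λ_ _).inv ≫ eId V (F.obj X) ▷ _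
  rw [leftUnitor_inv_naturality_assoc, leftUnitor_inv_naturality_assoc,
    ← MonoidalCategory.tensorHom_def', ← MonoidalCategory.tensorHom_def', Category.assoc,
    tensorHom_comp_tensorHom, F.map_id]

lemma elL_tensor {X X' Y : A} {W : V} (g : W ⟶ (X' ⟶ᵥ X)) (F G : EnrichedFunctor V A A) :
    elL Y g ≫ (tensorFunctor V (opFunctor V F) G).map (pr X Y) (pr X' Y) =
      elL (G.obj Y) (g ≫ F.map X' X) := by
  change (g ≫ (ρ_ _).inv ≫ _ ◁ eId V Y) ≫ (F.map X' X ⊗ₘ G.map Y Y) =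
    (g ≫ F.map X' X) ≫ (ρ_ _).inv ≫ _ ◁ eId V (G.obj Y)
  rw [rightUnitor_inv_naturality_assoc, rightUnitor_inv_naturality_assoc,
    ← MonoidalCategory.tensorHom_def, ← MonoidalCategory.tensorHom_def, Category.assoc,
    tensorHom_comp_tensorHom, G.map_id]

/-- `(Z ⊗ X, Z ⊗ Y) ⟶ (Z ⊗ X, Z' ⊗ Y)` as an `A(Z, Z')`-graded transformation in `(X, Y)`. -/
def actNatR (Z Z' : A) : GNat (Z ⟶ᵥ Z') (act2 t Z Z) (act2 t Z Z') :=
  (((GNat.id (opFunctor V (tl t Z))).tensor (wrNat t Z Z')).reindex (λ_ _).inv).copy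
    (fun c => elR (t.obj ⟨Z, c.fst.unop⟩) (wr t c.snd Z Z')) (fun c => by
      change wr t c.snd Z Z' ≫ (λ_ _).inv ≫ eId V (t.obj ⟨Z, c.fst.unop⟩) ▷ _ =
        (λ_ _).inv ≫ (eId V (t.obj ⟨Z, c.fst.unop⟩) ⊗ₘ wr t c.snd Z Z')
      rw [MonoidalCategory.tensorHom_def', leftUnitor_inv_naturality_assoc])

/-- `(Z' ⊗ X, Z' ⊗ Y) ⟶ (Z ⊗ X, Z' ⊗ Y)` as an `A(Z, Z')`-graded transformation in `(X, Y)`. -/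
def actNatL (Z Z' : A) : GNat (Z ⟶ᵥ Z') (act2 t Z' Z') (act2 t Z Z') :=
  (((wrNat t Z Z').op.tensor (GNat.id (tl t Z'))).reindex (ρ_ _).inv).copy
    (fun c => elL (t.obj ⟨Z', c.snd⟩) (wr t c.fst.unop Z Z')) (fun c => by
      change wr t c.fst.unop Z Z' ≫ (ρ_ _).inv ≫ _ ◁ eId V (t.obj ⟨Z', c.snd⟩) =
        (ρ_ _).inv ≫ (wr t c.fst.unop Z Z' ⊗ₘ eId V (t.obj ⟨Z', c.snd⟩))
      rw [MonoidalCategory.tensorHom_def, rightUnitor_inv_naturality_assoc])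

variable [MonoidalClosed V] [HasLimits V] (T : EnrichedFunctor V (TensorCat Aᵒᵖ A) V)

section

variable {B : Type v} [EnrichedCategory V B] (P : EnrichedFunctor V (TensorCat Bᵒᵖ B) V)

/-- The projections of the end `∫_b P(b, b)`. -/
def vEndπ (b : B) : vEnd P ⟶ P.obj ⟨Opposite.op b, b⟩ :=
  endObjπ (P := fun b b' => P.obj ⟨Opposite.op b, b'⟩) (H := fun b b' => b ⟶ᵥ b')
    (fun b b' => actOn P (insR V (Opposite.op b) b b'))
    (fun b b' => actOn P (insL V (Opposite.op b') (Opposite.op b) b')) b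

lemma vEnd_ext {W : V} {f g : W ⟶ vEnd P} (h : ∀ b, f ≫ vEndπ P b = g ≫ vEndπ P b) : f = g :=
  endObj_ext (P := fun b b' => P.obj ⟨Opposite.op b, b'⟩) (H := fun b b' => b ⟶ᵥ b')
    (fun b b' => actOn P (insR V (Opposite.op b) b b'))
    (fun b b' => actOn P (insL V (Opposite.op b') (Opposite.op b) b')) h

lemma vEnd_condition (b b' : B) : vEndπ P b ▷ _ ≫ actOn P (insR V (Opposite.op b) b b') =
    vEndπ P b' ▷ _ ≫ actOn P (insL V (Opposite.op b') (Opposite.op b) b') :=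
  endObj_condition (P := fun b b' => P.obj ⟨Opposite.op b, b'⟩) (H := fun b b' => b ⟶ᵥ b')
    (fun b b' => actOn P (insR V (Opposite.op b) b b'))
    (fun b b' => actOn P (insL V (Opposite.op b') (Opposite.op b) b')) b b'

/-- The universal property of the end `∫_b P(b, b)`. -/
def vEndLift {W : V} (k : ∀ b, W ⟶ P.obj ⟨Opposite.op b, b⟩)
    (h : ∀ b b', k b ▷ _ ≫ actOn P (insR V (Opposite.op b) b b') =
      k b' ▷ _ ≫ actOn P (insL V (Opposite.op b') (Opposite.op b) b')) : W ⟶ vEnd P :=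
  endObjLift (P := fun b b' => P.obj ⟨Opposite.op b, b'⟩) (H := fun b b' => b ⟶ᵥ b')
    (fun b b' => actOn P (insR V (Opposite.op b) b b'))
    (fun b b' => actOn P (insL V (Opposite.op b') (Opposite.op b) b')) k h

lemma vEndLift_π {W : V} (k : ∀ b, W ⟶ P.obj ⟨Opposite.op b, b⟩) (h) (b : B) :
    vEndLift P k h ≫ vEndπ P b = k b :=
  endObjLift_π (P := fun b b' => P.obj ⟨Opposite.op b, b'⟩) (H := fun b b' => b ⟶ᵥ b')
    (fun b b' => actOn P (insR V (Opposite.op b) b b'))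
    (fun b b' => actOn P (insL V (Opposite.op b') (Opposite.op b) b')) k h b

end

/-- `∫_Z T(Z ⊗ X, Z ⊗ Y)`. -/
def thetaObj (X Y : A) : V := vEnd ((orbit t X Y).comp V T)

/-- The projection `∫_Z T(Z ⊗ X, Z ⊗ Y) ⟶ T(Z ⊗ X, Z ⊗ Y)`. -/
def thetaπ (X Y Z : A) : thetaObj t T X Y ⟶ T.obj (pr (t.obj ⟨Z, X⟩) (t.obj ⟨Z, Y⟩)) :=
  vEndπ ((orbit t X Y).comp V T) Z

variable {t T}

lemma thetaObj_ext {X Y : A} {W : V} {f g : W ⟶ thetaObj t T X Y}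
    (h : ∀ Z, f ≫ thetaπ t T X Y Z = g ≫ thetaπ t T X Y Z) : f = g := vEnd_ext _ h

lemma orbit_actR (X Y Z Z' : A) :
    actOn ((orbit t X Y).comp V T) (insR V (Opposite.op Z) Z Z') =
      actR T (t.obj ⟨Z, X⟩) (wr t Y Z Z') := by
  rw [actOn_comp_functor]
  refine congrArg (actOn T) ?_
  have := elR_tensor (𝟙 _) (tr t X) (tr t Y) (X := Z) (Y := Z) (Y' := Z')
  simp only [elR, Category.id_comp] at this
  exact this

lemma orbit_actL (X Y Z Z' : A) :
    actOn ((orbit t X Y).comp V T) (insL V (Opposite.op Z') (Opposite.op Z) Z') =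
      actL T (t.obj ⟨Z', Y⟩) (wr t X Z Z') := by
  rw [actOn_comp_functor]
  refine congrArg (actOn T) ?_
  have := elL_tensor (𝟙 _) (tr t X) (tr t Y) (X := Z') (X' := Z) (Y := Z')
  simp only [elL, Category.id_comp] at this
  exact this

variable (t T) in
/-- The condition for a family to induce a morphism into `∫_Z T(Z ⊗ X, Z ⊗ Y)`. -/
def Wedge (X Y : A) {W : V} (k : ∀ Z, W ⟶ T.obj (pr (t.obj ⟨Z, X⟩) (t.obj ⟨Z, Y⟩))) : Prop :=
  ∀ Z Z', k Z ▷ _ ≫ actR T (t.obj ⟨Z, X⟩) (wr t Y Z Z') =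
    k Z' ▷ _ ≫ actL T (t.obj ⟨Z', Y⟩) (wr t X Z Z')

lemma thetaπ_wedge (X Y : A) : Wedge t T X Y (thetaπ t T X Y) := fun Z Z' => by
  rw [← orbit_actR, ← orbit_actL]
  exact vEnd_condition ((orbit t X Y).comp V T) Z Z'

/-- The universal property of `∫_Z T(Z ⊗ X, Z ⊗ Y)`. -/
def thetaLift {X Y : A} {W : V} (k : ∀ Z, W ⟶ T.obj (pr (t.obj ⟨Z, X⟩) (t.obj ⟨Z, Y⟩)))
    (h : Wedge t T X Y k) : W ⟶ thetaObj t T X Y :=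
  vEndLift ((orbit t X Y).comp V T) k fun Z Z' => by
    have := h Z Z'
    rw [← orbit_actR, ← orbit_actL] at this
    exact this

@[simp]
lemma thetaLift_π {X Y : A} {W : V} (k : ∀ Z, W ⟶ T.obj (pr (t.obj ⟨Z, X⟩) (t.obj ⟨Z, Y⟩)))
    (h : Wedge t T X Y k) (Z : A) : thetaLift k h ≫ thetaπ t T X Y Z = k Z :=
  vEndLift_π ((orbit t X Y).comp V T) k _ Z

lemma post_ev {C : Type u₁} [EnrichedCategory V C] {D : Type u₂} [EnrichedCategory V D]
    {F G : EnrichedFunctor V D C} {S : V} (σ : GNat S F G) (K : EnrichedFunctor V C V) (c : D) :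
    (σ.post K).ev c = actOn K (σ.app c) := (actOn_eq K _).symm

variable (t T) in
/-- `T(Z ⊗ X, Z' ⊗ Y) ⊗ W ⟶ T(Z ⊗ X', Z' ⊗ Y')` for `f : W ⟶ (Aᵒᵖ ⊗ A)((X, Y), (X', Y'))`. -/
def act2On (Z Z' : A) {c d : TensorCat Aᵒᵖ A} {W : V} (f : W ⟶ (c ⟶ᵥ d)) :
    T.obj (pr (t.obj ⟨Z, c.fst.unop⟩) (t.obj ⟨Z', c.snd⟩)) ⊗ W ⟶
      T.obj (pr (t.obj ⟨Z, d.fst.unop⟩) (t.obj ⟨Z', d.snd⟩)) :=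
  actOn ((act2 t Z Z').comp V T) f

/-- Wedges are stable under the graded transformations coming from `Aᵒᵖ ⊗ A`. -/
lemma Wedge.act2 {c d : TensorCat Aᵒᵖ A} {W U : V}
    {k : ∀ Z, W ⟶ T.obj (pr (t.obj ⟨Z, c.fst.unop⟩) (t.obj ⟨Z, c.snd⟩))}
    (h : Wedge t T c.fst.unop c.snd k) (f : U ⟶ (c ⟶ᵥ d)) :
    Wedge t T d.fst.unop d.snd (fun Z => k Z ▷ U ≫ act2On t T Z Z f) := by
  intro Z Z'
  have e1 : act2On t T Z Z f ▷ _ ≫ actR T (t.obj ⟨Z, d.fst.unop⟩) (wr t d.snd Z Z') =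
      sw _ _ _ ≫ actR T (t.obj ⟨Z, c.fst.unop⟩) (wr t c.snd Z Z') ▷ U ≫ act2On t T Z Z' f := by
    have := ((actNatR t Z Z').post T).ev_naturality f
    rw [post_ev, post_ev] at this
    exact this
  have e2 : act2On t T Z' Z' f ▷ _ ≫ actL T (t.obj ⟨Z', d.snd⟩) (wr t d.fst.unop Z Z') =
      sw _ _ _ ≫ actL T (t.obj ⟨Z', c.snd⟩) (wr t c.fst.unop Z Z') ▷ U ≫ act2On t T Z Z' f := by
    have := ((actNatL t Z Z').post T).ev_naturality f
    rw [post_ev, post_ev] at this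
    exact this
  rw [comp_whiskerRight, comp_whiskerRight, Category.assoc, Category.assoc, e1, e2,
    reassoc_of% sw_nat_left, reassoc_of% sw_nat_left, ← comp_whiskerRight_assoc,
    ← comp_whiskerRight_assoc, h Z Z']

lemma act2On_pre (Z Z' : A) {c d : TensorCat Aᵒᵖ A} {W W' : V} (g : W' ⟶ W) (f : W ⟶ (c ⟶ᵥ d)) :
    act2On t T Z Z' (g ≫ f) = _ ◁ g ≫ act2On t T Z Z' f :=
  actOn_pre _ _ _

lemma act2On_id (Z Z' : A) (c : TensorCat Aᵒᵖ A) :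
    act2On t T Z Z' (eId V c) = (ρ_ _).hom :=
  actOn_id _ _

lemma act2On_comp (Z Z' : A) {c d e : TensorCat Aᵒᵖ A} {W U : V} (f : W ⟶ (c ⟶ᵥ d))
    (g : U ⟶ (d ⟶ᵥ e)) : act2On t T Z Z' ((f ⊗ₘ g) ≫ eComp V c d e) =
      (α_ _ _ _).inv ≫ act2On t T Z Z' f ▷ U ≫ act2On t T Z Z' g :=
  actOn_comp _ _ _

variable (t T)

/-- The `V`-functor `Θ T = ∫_Z T(Z ⊗ -, Z ⊗ -)`. -/
def thetaFun : EnrichedFunctor V (TensorCat Aᵒᵖ A) V :=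
  ofAct (fun c => thetaObj t T c.fst.unop c.snd)
    (fun c d => thetaLift (fun Z => thetaπ t T c.fst.unop c.snd Z ▷ _ ≫ act2On t T Z Z (𝟙 (c ⟶ᵥ d)))
      ((thetaπ_wedge (t := t) (T := T) c.fst.unop c.snd).act2 _))
    (fun c => by
      apply thetaObj_ext; intro Z
      rw [Category.assoc, thetaLift_π, whisker_exchange_assoc, ← act2On_pre, Category.comp_id,
        act2On_id, rightUnitor_naturality])
    (fun c d e => by
      apply thetaObj_ext; intro Z
      rw [Category.assoc, thetaLift_π, Category.assoc, Category.assoc, thetaLift_π,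
        ← comp_whiskerRight_assoc, thetaLift_π, whisker_exchange_assoc, ← act2On_pre,
        Category.comp_id, ← Category.id_comp (eComp V c d e), ← id_tensorHom_id, act2On_comp]
      simp)

/-- The projection `Θ T (X, Y) ⟶ T(Z ⊗ X, Z ⊗ Y)`. -/
def thπ (X Y Z : A) :
    (thetaFun t T).obj (pr X Y) ⟶ T.obj (pr (t.obj ⟨Z, X⟩) (t.obj ⟨Z, Y⟩)) :=
  thetaπ t T X Y Z

variable {t T}

lemma th_ext {X Y : A} {W : V} {f g : W ⟶ (thetaFun t T).obj (pr X Y)}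
    (h : ∀ Z, f ≫ thπ t T X Y Z = g ≫ thπ t T X Y Z) : f = g := thetaObj_ext h

/-- The morphism into `Θ T (X, Y)` given by a wedge. -/
def thLift {X Y : A} {W : V} (k : ∀ Z, W ⟶ T.obj (pr (t.obj ⟨Z, X⟩) (t.obj ⟨Z, Y⟩)))
    (h : Wedge t T X Y k) : W ⟶ (thetaFun t T).obj (pr X Y) := thetaLift k h

@[simp]
lemma thLift_π {X Y : A} {W : V} (k : ∀ Z, W ⟶ T.obj (pr (t.obj ⟨Z, X⟩) (t.obj ⟨Z, Y⟩)))
    (h : Wedge t T X Y k) (Z : A) : thLift k h ≫ thπ t T X Y Z = k Z := thetaLift_π k h Z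

lemma thπ_wedge (X Y : A) : Wedge t T X Y (thπ t T X Y) := thetaπ_wedge X Y

lemma thπ_act2 {X Y X' Y' : A} {W : V} (f : W ⟶ (pr X Y ⟶ᵥ pr X' Y')) (Z : A) :
    actOn (thetaFun t T) f ≫ thπ t T X' Y' Z = thπ t T X Y Z ▷ W ≫ act2On t T Z Z f := by
  have e : act (thetaFun t T) (pr X Y) (pr X' Y') =
    thLift (fun Z => thπ t T X Y Z ▷ _ ≫ act2On t T Z Z (𝟙 (pr X Y ⟶ᵥ pr X' Y')))
      ((thπ_wedge (t := t) (T := T) X Y).act2 (c := pr X Y) (d := pr X' Y') _) :=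
      act_ofAct _ _ _ _ _ _
  rw [actOn, e, Category.assoc, thLift_π, whisker_exchange_assoc]
  exact _ ≫= (act2On_pre Z Z f (𝟙 _)).symm.trans (congrArg _ (Category.comp_id f))

lemma thπ_act2_assoc {X Y X' Y' : A} {W U : V} (f : W ⟶ (pr X Y ⟶ᵥ pr X' Y')) (Z : A)
    (h : T.obj (pr (t.obj ⟨Z, X'⟩) (t.obj ⟨Z, Y'⟩)) ⟶ U) :
    actOn (thetaFun t T) f ≫ thπ t T X' Y' Z ≫ h =
      thπ t T X Y Z ▷ W ≫ act2On t T Z Z f ≫ h := by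
  rw [← Category.assoc, thπ_act2, Category.assoc]

lemma Wedge.pre {X Y : A} {W W' : V} {k : ∀ Z, W ⟶ T.obj (pr (t.obj ⟨Z, X⟩) (t.obj ⟨Z, Y⟩))}
    (h : Wedge t T X Y k) (f : W' ⟶ W) : Wedge t T X Y (fun Z => f ≫ k Z) := fun Z Z' => by
  rw [comp_whiskerRight, comp_whiskerRight, Category.assoc, Category.assoc, h Z Z']

lemma Wedge.post {T' : EnrichedFunctor V (TensorCat Aᵒᵖ A) V} {X Y : A} {W U : V}
    {k : ∀ Z, W ⟶ T.obj (pr (t.obj ⟨Z, X⟩) (t.obj ⟨Z, Y⟩))} (h : Wedge t T X Y k)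
    (x : U ⟶ natObj T T') : Wedge t T' X Y (fun Z => k Z ▷ U ≫ nev x _) := fun Z Z' => by
  have := h Z Z'
  have n1 := nev_naturality x (elR (t.obj ⟨Z, X⟩) (wr t Y Z Z'))
  have n2 := nev_naturality x (elL (t.obj ⟨Z', Y⟩) (wr t X Z Z'))
  have n1' := sw _ _ _ ≫= n1
  have n2' := sw _ _ _ ≫= n2
  rw [reassoc_of% sw_sw] at n1' n2'
  rw [comp_whiskerRight, comp_whiskerRight, Category.assoc, Category.assoc, actR, actL, ← n1',
    ← n2', reassoc_of% sw_nat_left, reassoc_of% sw_nat_left, ← comp_whiskerRight_assoc,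
    ← comp_whiskerRight_assoc]
  rw [actR, actL] at this
  rw [this]

lemma nev_act2On {T' : EnrichedFunctor V (TensorCat Aᵒᵖ A) V} {W U : V} (x : W ⟶ natObj T T')
    (Z Z' : A) {X Y X' Y' : A} (f : U ⟶ (pr X Y ⟶ᵥ pr X' Y')) :
    act2On t T Z Z' f ▷ W ≫ nev x (pr (t.obj ⟨Z, X'⟩) (t.obj ⟨Z', Y'⟩)) =
      sw _ _ _ ≫ nev x (pr (t.obj ⟨Z, X⟩) (t.obj ⟨Z', Y⟩)) ▷ U ≫ act2On t T' Z Z' f := by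
  rw [act2On, act2On, actOn_comp_functor, actOn_comp_functor]
  exact nev_naturality x (f ≫ (act2 t Z Z').map (pr X Y) (pr X' Y'))

variable (t T) in
/-- The action of `Θ` on homs: `[Aᵒᵖ ⊗ A, V](T, T') ⟶ [Aᵒᵖ ⊗ A, V](Θ T, Θ T')`. -/
def thetaMap (T' : EnrichedFunctor V (TensorCat Aᵒᵖ A) V) :
    natObj T T' ⟶ natObj (thetaFun t T) (thetaFun t T') :=
  natLift (GNat.ofEv (fun c => thLift (fun Z => thπ t T c.fst.unop c.snd Z ▷ _ ≫ nev (𝟙 _) _)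
    ((thπ_wedge _ _).post _)) (by
      rintro ⟨⟨X⟩, Y⟩ ⟨⟨X'⟩, Y'⟩
      apply th_ext; intro Z
      have h (T) : act (thetaFun t T) (pr X Y) (pr X' Y') = actOn (thetaFun t T) (𝟙 _) :=
        act_eq_actOn _ _ _
      change (act (thetaFun t T) (pr X Y) (pr X' Y') ▷ _ ≫ thLift _ _) ≫ _ =
        (sw ((thetaFun t T).obj (pr X Y)) (pr X Y ⟶ᵥ pr X' Y') _ ≫
          thLift _ _ ▷ _ ≫ act (thetaFun t T') (pr X Y) (pr X' Y')) ≫ _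
      rw [h, h, Category.assoc, thLift_π, Category.assoc, Category.assoc, thπ_act2,
        ← comp_whiskerRight_assoc, ← comp_whiskerRight_assoc, thπ_act2, thLift_π,
        comp_whiskerRight_assoc, comp_whiskerRight_assoc, nev_act2On, reassoc_of% sw_nat_left]))

lemma thetaMap_nev {T' : EnrichedFunctor V (TensorCat Aᵒᵖ A) V} {W : V} (x : W ⟶ natObj T T')
    (X Y Z : A) :
    nev (x ≫ thetaMap t T T') (pr X Y) ≫ thπ t T' X Y Z = thπ t T X Y Z ▷ W ≫ nev x _ := by
  rw [nev_pre, thetaMap, nev_natLift, Category.assoc]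
  erw [GNat.ofEv_ev]
  rw [thLift_π, whisker_exchange_assoc, ← nev_pre, Category.comp_id]

lemma thetaMap_nEl {T' : EnrichedFunctor V (TensorCat Aᵒᵖ A) V} (x : 𝟙_ V ⟶ natObj T T')
    (X Y Z : A) :
    nEl (x ≫ thetaMap t T T') (pr X Y) ≫ thπ t T' X Y Z = thπ t T X Y Z ≫ nEl x _ := by
  change ((ρ_ _).inv ≫ nev (x ≫ thetaMap t T T') (pr X Y)) ≫ _ = _ ≫ (ρ_ _).inv ≫ nev x _
  rw [Category.assoc, thetaMap_nev, rightUnitor_inv_naturality_assoc]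

variable (t) in
/-- The `V`-functor `Θ` on `[Aᵒᵖ ⊗ A, V]`, `(Θ T)(X, Y) = ∫_Z T(Z ⊗ X, Z ⊗ Y)`. -/
def theta : EnrichedFunctor V (EnrichedFunctor V (TensorCat Aᵒᵖ A) V)
    (EnrichedFunctor V (TensorCat Aᵒᵖ A) V) where
  obj T := thetaFun t T
  map T T' := thetaMap t T T'
  map_id T := by
    apply nev_ext
    rintro ⟨⟨X⟩, Y⟩
    apply th_ext; intro Z
    refine (thetaMap_nev (eId V T) X Y Z).trans ?_
    erw [nev_eId, nev_eId]
    rw [rightUnitor_naturality]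
  map_comp T T' T'' := by
    apply nev_ext
    rintro ⟨⟨X⟩, Y⟩
    apply th_ext; intro Z
    refine (thetaMap_nev (eComp V T T' T'') X Y Z).trans ?_
    have e := nev_eComp (𝟙 (natObj T T')) (𝟙 (natObj T' T''))
      (pr (t.obj ⟨Z, X⟩) (t.obj ⟨Z, Y⟩))
    rw [id_tensorHom_id, Category.id_comp] at e
    refine (_ ≫= e).trans (Eq.trans ?_ (nev_eComp _ _ _ =≫ _).symm)
    have e1 := thetaMap_nev (t := t) (𝟙 (natObj T T')) X Y Z
    have e2 := thetaMap_nev (t := t) (𝟙 (natObj T' T'')) X Y Z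
    rw [Category.id_comp] at e1 e2
    refine Eq.trans ?_ (Category.assoc _ _ _).symm
    refine Eq.trans ?_ (_ ≫= (Category.assoc _ _ _).symm)
    refine Eq.trans ?_ (_ ≫= _ ≫= e2.symm)
    change thπ t T X Y Z ▷ (natObj T T' ⊗ natObj T' T'') ≫ _ =
      (α_ _ (natObj T T') (natObj T' T'')).inv ≫ nev (thetaMap t T T') (pr X Y) ▷
        natObj T' T'' ≫ thπ t T' X Y Z ▷ natObj T' T'' ≫ _
    rw [← comp_whiskerRight_assoc, e1]
    simp

end Theta

section Pairs

variable {V : Type u} [Category.{v} V] [MonoidalCategory V] [SymmetricCategory V]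

section

variable [MonoidalClosed V] {A : Type u₁} [EnrichedCategory V A]

/-- The element `(f, g)` of `(Aᵒᵖ ⊗ A)((X, Y), (X', Y'))`. -/
def pairEl {X X' Y Y' : A} (f : 𝟙_ V ⟶ (X' ⟶ᵥ X)) (g : 𝟙_ V ⟶ (Y ⟶ᵥ Y')) :
    𝟙_ V ⟶ (pr X Y ⟶ᵥ pr X' Y') :=
  (λ_ _).inv ≫ (f ⊗ₘ g)

lemma elL_elR_pair {X X' Y Y' : A} (f : 𝟙_ V ⟶ (X' ⟶ᵥ X)) (g : 𝟙_ V ⟶ (Y ⟶ᵥ Y')) :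
    elComp (elL Y f) (elR X' g) = pairEl f g := by
  rw [elComp, elL, elR, ← tensorHom_comp_tensorHom, Category.assoc]
  have := insL_insR (V := V) (Opposite.op X) (Opposite.op X') Y Y'
  refine (_ ≫= _ ≫= this).trans ?_
  rw [pairEl]
  exact _ ≫= Category.comp_id _

lemma mapLR_eq (T : EnrichedFunctor V (TensorCat Aᵒᵖ A) V) {X X' Y Y' : A}
    (f : 𝟙_ V ⟶ (X' ⟶ᵥ X)) (g : 𝟙_ V ⟶ (Y ⟶ᵥ Y')) : mapLR T f g = actEl T (pairEl f g) := by
  rw [mapLR, mapL, mapR, actEl_actEl, elL_elR_pair]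

lemma pairEl_map {X X' Y Y' : A} (f : 𝟙_ V ⟶ (X' ⟶ᵥ X)) (g : 𝟙_ V ⟶ (Y ⟶ᵥ Y'))
    (F G : EnrichedFunctor V A A) :
    pairEl f g ≫ (tensorFunctor V (opFunctor V F) G).map (pr X Y) (pr X' Y') =
      pairEl (f ≫ F.map X' X) (g ≫ G.map Y Y') := by
  change ((λ_ _).inv ≫ (f ⊗ₘ g)) ≫ (F.map X' X ⊗ₘ G.map Y Y') = (λ_ _).inv ≫ _
  rw [Category.assoc, tensorHom_comp_tensorHom]

/-- `T(σ, τ)` is `V`-natural for `V`-natural transformations `σ : F' ⟶ F` and `τ : G ⟶ G'`. -/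
lemma mapLR_naturality (T : EnrichedFunctor V (TensorCat Aᵒᵖ A) V) {F F' G G' : EnrichedFunctor V A A}
    (σ : VNat F' F) (τ : VNat G G') {X X' Y Y' : A} {W : V} (f : W ⟶ (pr X Y ⟶ᵥ pr X' Y')) :
    actOn ((tensorFunctor V (opFunctor V F) G).comp V T) f ≫ mapLR T (σ.app X') (τ.app Y') =
      mapLR T (σ.app X) (τ.app Y) ▷ W ≫
        actOn ((tensorFunctor V (opFunctor V F') G').comp V T) f := by
  have h := GNat.el_naturality ((σ.op.tensor τ).reindex (λ_ (𝟙_ V)).inv) (pr X Y) (pr X' Y')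
  have h' := f ≫= h
  rw [mapLR_eq, mapLR_eq, actOn_comp_functor, actOn_comp_functor]
  refine (actOn_actEl T _ _).trans ?_
  rw [Category.assoc]
  refine (congrArg (actOn T) h').trans ?_
  rw [← Category.assoc]
  exact (actEl_actOn T _ _).symm

lemma actR_actL_mapLR (T : EnrichedFunctor V (TensorCat Aᵒᵖ A) V)
    {X Y X' Y' X₁ Y₁ X₁' Y₁' : A} {W S : V} {k : W ⟶ T.obj (pr X Y)} {k' : W ⟶ T.obj (pr X' Y')}
    {g : S ⟶ (Y ⟶ᵥ Y')} {f : S ⟶ (X ⟶ᵥ X')} (h : k ▷ S ≫ actR T X g = k' ▷ S ≫ actL T Y' f)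
    {u : 𝟙_ V ⟶ (X₁ ⟶ᵥ X)} {w : 𝟙_ V ⟶ (Y ⟶ᵥ Y₁)} {u' : 𝟙_ V ⟶ (X₁' ⟶ᵥ X')}
    {w' : 𝟙_ V ⟶ (Y' ⟶ᵥ Y₁')} {g₁ : S ⟶ (Y₁ ⟶ᵥ Y₁')} {f₁ : S ⟶ (X₁ ⟶ᵥ X₁')}
    (hg : g ≫ ePost Y w' = g₁ ≫ ePre w Y₁') (hf : f₁ ≫ ePost X₁ u' = f ≫ ePre u X') :
    (k ≫ mapLR T u w) ▷ S ≫ actR T X₁ g₁ = (k' ≫ mapLR T u' w') ▷ S ≫ actL T Y₁' f₁ := by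
  rw [comp_whiskerRight, comp_whiskerRight, Category.assoc, Category.assoc, mapLR_actR, ← hg,
    ← actR_mapLR, mapLR_actL, hf, ← actL_mapLR, ← Category.assoc, h, Category.assoc]

end

variable [MonoidalClosed V] [HasLimits V] {A : Type v} [EnrichedCategory V A]

lemma nev_actEl {C : Type v} [EnrichedCategory V C] {T T' : EnrichedFunctor V C V} {W : V}
    (x : W ⟶ natObj T T') {c d : C} (f : 𝟙_ V ⟶ (c ⟶ᵥ d)) :
    actEl T f ▷ W ≫ nev x d = nev x c ≫ actEl T' f := by
  rw [actEl, comp_whiskerRight, Category.assoc, nev_naturality, reassoc_of% sw_unit, actEl,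
    rightUnitor_inv_naturality_assoc]
  simp

lemma nev_mapLR {T T' : EnrichedFunctor V (TensorCat Aᵒᵖ A) V} {W : V}
    (x : W ⟶ natObj T T') {X X' Y Y' : A} (f : 𝟙_ V ⟶ (X' ⟶ᵥ X)) (g : 𝟙_ V ⟶ (Y ⟶ᵥ Y')) :
    mapLR T f g ▷ W ≫ nev x (pr X' Y') = nev x (pr X Y) ≫ mapLR T' f g := by
  rw [mapLR_eq, mapLR_eq, nev_actEl]

variable {t : EnrichedFunctor V (TensorCat A A) A} {T : EnrichedFunctor V (TensorCat Aᵒᵖ A) V}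

lemma thπ_actR {X Y Y' : A} {W : V} (g : W ⟶ (Y ⟶ᵥ Y')) (Z : A) :
    actR (thetaFun t T) X g ≫ thπ t T X Y' Z =
      thπ t T X Y Z ▷ W ≫ actR T (t.obj ⟨Z, X⟩) (g ≫ wl t Z Y Y') := by
  rw [actR, thπ_act2, act2On, actOn_comp_functor]
  exact _ ≫= congrArg (actOn T) (elR_tensor g (tl t Z) (tl t Z))

lemma thπ_actL {X X' Y : A} {W : V} (f : W ⟶ (X' ⟶ᵥ X)) (Z : A) :
    actL (thetaFun t T) Y f ≫ thπ t T X' Y Z =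
      thπ t T X Y Z ▷ W ≫ actL T (t.obj ⟨Z, Y⟩) (f ≫ wl t Z X' X) := by
  rw [actL, thπ_act2, act2On, actOn_comp_functor]
  exact _ ≫= congrArg (actOn T) (elL_tensor f (tl t Z) (tl t Z))

lemma act2On_pairEl {X X' Y Y' : A} (f : 𝟙_ V ⟶ (X' ⟶ᵥ X)) (g : 𝟙_ V ⟶ (Y ⟶ᵥ Y')) (Z Z' : A) :
    (ρ_ _).inv ≫ act2On t T Z Z' (pairEl f g) =
      mapLR T (f ≫ wl t Z X' X) (g ≫ wl t Z' Y Y') := by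
  rw [mapLR_eq, actEl, act2On, actOn_comp_functor]
  exact _ ≫= congrArg (actOn T) (pairEl_map f g (tl t Z) (tl t Z'))

lemma actR_pre (T : EnrichedFunctor V (TensorCat Aᵒᵖ A) V) (X : A) {Y Y' : A} {W W' : V}
    (f : W' ⟶ W) (g : W ⟶ (Y ⟶ᵥ Y')) : actR T X (f ≫ g) = _ ◁ f ≫ actR T X g := by
  rw [actR, elR, Category.assoc, actOn_pre]; rfl

lemma actL_pre (T : EnrichedFunctor V (TensorCat Aᵒᵖ A) V) (Y : A) {X X' : A} {W W' : V}
    (f : W' ⟶ W) (g : W ⟶ (X' ⟶ᵥ X)) : actL T Y (f ≫ g) = _ ◁ f ≫ actL T Y g := by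
  rw [actL, elL, Category.assoc, actOn_pre]; rfl

lemma mapR_eq (T : EnrichedFunctor V (TensorCat Aᵒᵖ A) V) (X : A) {Y Y' : A}
    (g : 𝟙_ V ⟶ (Y ⟶ᵥ Y')) : mapR T X g = (ρ_ _).inv ≫ actR T X g := rfl

lemma mapL_eq (T : EnrichedFunctor V (TensorCat Aᵒᵖ A) V) (Y : A) {X X' : A}
    (g : 𝟙_ V ⟶ (X' ⟶ᵥ X)) : mapL T Y g = (ρ_ _).inv ≫ actL T Y g := rfl

lemma thπ_mapLR {X X' Y Y' : A} (f : 𝟙_ V ⟶ (X' ⟶ᵥ X)) (g : 𝟙_ V ⟶ (Y ⟶ᵥ Y')) (Z : A) :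
    mapLR (thetaFun t T) f g ≫ thπ t T X' Y' Z =
      thπ t T X Y Z ≫ mapLR T (f ≫ wl t Z X' X) (g ≫ wl t Z Y Y') := by
  rw [mapLR_eq, actEl, Category.assoc, thπ_act2, ← rightUnitor_inv_naturality_assoc, act2On_pairEl]

/-- A wedge is dinatural with respect to invertible elements. -/
lemma Wedge.iso {X Y : A} {W : V} {k : ∀ Z, W ⟶ T.obj (pr (t.obj ⟨Z, X⟩) (t.obj ⟨Z, Y⟩))}
    (h : Wedge t T X Y k) {Z Z' : A} (f : 𝟙_ V ⟶ (Z ⟶ᵥ Z')) (f' : 𝟙_ V ⟶ (Z' ⟶ᵥ Z))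
    (hf : elComp f' f = eId V Z') :
    k Z ≫ mapLR T (f' ≫ wr t X Z' Z) (f ≫ wr t Y Z Z') = k Z' := by
  have e : k Z ≫ mapR T (t.obj ⟨Z, X⟩) (f ≫ wr t Y Z Z') =
      k Z' ≫ mapL T (t.obj ⟨Z', Y⟩) (f ≫ wr t X Z Z') := by
    have h1 := _ ◁ f ≫= h Z Z'
    rw [whisker_exchange_assoc, whisker_exchange_assoc] at h1
    rw [mapR_eq, mapL_eq, rightUnitor_inv_naturality_assoc, rightUnitor_inv_naturality_assoc,
      actR_pre, actL_pre]
    exact _ ≫= h1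
  have e2 : elComp (f' ≫ wr t X Z' Z) (f ≫ wr t X Z Z') = eId V (t.obj ⟨Z', X⟩) := by
    have := (tr t X).map_id Z'
    rw [← hf] at this
    exact (elComp_map (tr t X) f' f).symm.trans this
  rw [mapLR, ← mapR_mapL, ← Category.assoc, e, Category.assoc, mapL_mapL, e2, mapL_eId,
    Category.comp_id]

end Pairs

section Double

variable {V : Type u} [Category.{v} V] [MonoidalCategory V] [SymmetricCategory V]
  [MonoidalClosed V] [HasLimits V] {A : Type v} [EnrichedCategory V A]
  {T : EnrichedFunctor V (TensorCat Aᵒᵖ A) V}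

lemma th_ext₂ {t t' : EnrichedFunctor V (TensorCat A A) A} {X Y : A} {U : V}
    {f g : U ⟶ (thetaFun t (thetaFun t' T)).obj (pr X Y)}
    (h : ∀ W Z, f ≫ thπ t (thetaFun t' T) X Y W ≫ thπ t' T (t.obj ⟨W, X⟩) (t.obj ⟨W, Y⟩) Z =
      g ≫ thπ t (thetaFun t' T) X Y W ≫ thπ t' T (t.obj ⟨W, X⟩) (t.obj ⟨W, Y⟩) Z) : f = g :=
  th_ext fun W => th_ext fun Z => by
    rw [Category.assoc, Category.assoc]; exact h W Z

/-- A morphism into an iterated end. -/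
def thLift₂ {t t' : EnrichedFunctor V (TensorCat A A) A} {X Y : A} {U : V}
    (k : ∀ W Z, U ⟶ T.obj (pr (t'.obj ⟨Z, t.obj ⟨W, X⟩⟩) (t'.obj ⟨Z, t.obj ⟨W, Y⟩⟩)))
    (h₁ : ∀ W, Wedge t' T (t.obj ⟨W, X⟩) (t.obj ⟨W, Y⟩) (k W))
    (h₂ : ∀ Z W W', k W Z ▷ _ ≫ actR T (t'.obj ⟨Z, t.obj ⟨W, X⟩⟩) (wr t Y W W' ≫ wl t' Z _ _) =
      k W' Z ▷ _ ≫ actL T (t'.obj ⟨Z, t.obj ⟨W', Y⟩⟩) (wr t X W W' ≫ wl t' Z _ _)) :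
    U ⟶ (thetaFun t (thetaFun t' T)).obj (pr X Y) :=
  thLift (fun W => thLift (k W) (h₁ W)) (fun W W' => by
    apply th_ext; intro Z
    rw [Category.assoc, Category.assoc, thπ_actR, thπ_actL, ← comp_whiskerRight_assoc,
      ← comp_whiskerRight_assoc]
    have h₂ := h₂ Z W W'
    rw [← thLift_π (k W) (h₁ W) Z, ← thLift_π (k W') (h₁ W') Z] at h₂
    exact h₂)

lemma thLift₂_π {t t' : EnrichedFunctor V (TensorCat A A) A} {X Y : A} {U : V}
    (k : ∀ W Z, U ⟶ T.obj (pr (t'.obj ⟨Z, t.obj ⟨W, X⟩⟩) (t'.obj ⟨Z, t.obj ⟨W, Y⟩⟩)))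
    (h₁) (h₂) (W Z : A) : thLift₂ (t := t) (t' := t') k h₁ h₂ ≫ thπ t (thetaFun t' T) X Y W ≫
      thπ t' T (t.obj ⟨W, X⟩) (t.obj ⟨W, Y⟩) Z = k W Z := by
  rw [← Category.assoc]
  exact ((thLift_π (fun W => thLift (k W) (h₁ W)) _ W) =≫ _).trans (thLift_π (k W) (h₁ W) Z)

variable (T) in
/-- The action of `f : U ⟶ (Aᵒᵖ ⊗ A)((X, Y), (X', Y'))` on
`T(Z ⊗ (W ⊗ -), Z ⊗ (W ⊗ -))`. -/
def act4On (t t' : EnrichedFunctor V (TensorCat A A) A) (W Z : A) {X Y X' Y' : A} {U : V}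
    (f : U ⟶ (pr X Y ⟶ᵥ pr X' Y')) :
    T.obj (pr (t'.obj ⟨Z, t.obj ⟨W, X⟩⟩) (t'.obj ⟨Z, t.obj ⟨W, Y⟩⟩)) ⊗ U ⟶
      T.obj (pr (t'.obj ⟨Z, t.obj ⟨W, X'⟩⟩) (t'.obj ⟨Z, t.obj ⟨W, Y'⟩⟩)) :=
  actOn ((tensorFunctor V (opFunctor V ((tl t W).comp V (tl t' Z)))
          ((tl t W).comp V (tl t' Z))).comp V T) f

lemma act2On_thπ (t t' : EnrichedFunctor V (TensorCat A A) A) {X Y X' Y' : A} {U : V}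
    (f : U ⟶ (pr X Y ⟶ᵥ pr X' Y')) (W Z : A) :
    act2On t (thetaFun t' T) W W f ≫ thπ t' T (t.obj ⟨W, X'⟩) (t.obj ⟨W, Y'⟩) Z =
      thπ t' T (t.obj ⟨W, X⟩) (t.obj ⟨W, Y⟩) Z ▷ U ≫ act4On T t t' W Z f := by
  rw [act2On, actOn_comp_functor]
  refine (thπ_act2 (X := t.obj ⟨W, X⟩) (Y := t.obj ⟨W, Y⟩) (X' := t.obj ⟨W, X'⟩)
    (Y' := t.obj ⟨W, Y'⟩) (f ≫ (act2 t W W).map (pr X Y) (pr X' Y')) Z).trans (_ ≫= ?_)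
  rw [act2On, act4On, actOn_comp_functor, actOn_comp_functor]
  exact congrArg (actOn T) ((Category.assoc _ _ _).trans (f ≫= tensorHom_comp_tensorHom _ _ _ _))

lemma thπ_thπ_actOn (t t' : EnrichedFunctor V (TensorCat A A) A) {X Y X' Y' : A} {U : V}
    (f : U ⟶ (pr X Y ⟶ᵥ pr X' Y')) (W Z : A) :
    actOn (thetaFun t (thetaFun t' T)) f ≫ thπ t (thetaFun t' T) X' Y' W ≫
        thπ t' T (t.obj ⟨W, X'⟩) (t.obj ⟨W, Y'⟩) Z =
      (thπ t (thetaFun t' T) X Y W ≫ thπ t' T (t.obj ⟨W, X⟩) (t.obj ⟨W, Y⟩) Z) ▷ U ≫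
        act4On T t t' W Z f := by
  rw [thπ_act2_assoc, comp_whiskerRight, Category.assoc, act2On_thπ]

end Double

section ThetaComonad

variable {V : Type u} [Category.{v} V] [MonoidalCategory V] [SymmetricCategory V]
  [MonoidalClosed V]

namespace MonoidalVCat

section

variable {A : Type u₁} [EnrichedCategory V A] (M : MonoidalVCat V A)

/-- `I ⊗ - ⟶ 1`. -/
def lamNat : VNat (tl M.tensor M.unit) (EnrichedFunctor.id V A) :=
  GNat.ofEl (fun X => M.leftUnitHom X) (fun X X' =>
    (M.leftUnit_naturality X X').trans (Category.id_comp _).symm)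

/-- `1 ⟶ I ⊗ -`. -/
def lamInvNat : VNat (EnrichedFunctor.id V A) (tl M.tensor M.unit) :=
  GNat.ofEl (fun X => M.leftUnitInv X) (fun X X' =>
    ePost_ePre_inv (M.leftUnitInv_leftUnitHom X) (M.leftUnitHom_leftUnitInv X')
      ((M.leftUnit_naturality X X').trans (Category.id_comp _).symm))

/-- `(X ⊗ Y) ⊗ - ⟶ X ⊗ (Y ⊗ -)`. -/
def assocNat (X Y : A) : VNat (tl M.tensor (M.tensor.obj ⟨X, Y⟩))
    ((tl M.tensor Y).comp V (tl M.tensor X)) :=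
  GNat.ofEl (fun Z => M.assocHom X Y Z) (fun Z Z' =>
    (M.assoc_naturality_right X Y Z Z').trans (Category.assoc _ _ _).symm)

/-- `X ⊗ (Y ⊗ -) ⟶ (X ⊗ Y) ⊗ -`. -/
def assocInvNat (X Y : A) : VNat ((tl M.tensor Y).comp V (tl M.tensor X))
    (tl M.tensor (M.tensor.obj ⟨X, Y⟩)) :=
  GNat.ofEl (fun Z => M.assocInv X Y Z) (fun Z Z' =>
    ePost_ePre_inv (M.assocInv_assocHom X Y Z) (M.assocHom_assocInv X Y Z')
      ((M.assoc_naturality_right X Y Z Z').trans (Category.assoc _ _ _).symm))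

lemma wr_el_inv {X X' : A} {f : 𝟙_ V ⟶ (X ⟶ᵥ X')} {f' : 𝟙_ V ⟶ (X' ⟶ᵥ X)}
    (h : elComp f f' = eId V X) (Y : A) :
    elComp (f ≫ wr M.tensor Y X X') (f' ≫ wr M.tensor Y X' X) = eId V _ := by
  rw [← wr_el, h, wr_id]

end

variable [HasLimits V] {A : Type v} [EnrichedCategory V A] (M : MonoidalVCat V A)
  (T : EnrichedFunctor V (TensorCat Aᵒᵖ A) V)

/-- The counit `ε : Θ T ⟶ T`, the projection at `I`. -/
def thetaε : 𝟙_ V ⟶ natObj (thetaFun M.tensor T) T :=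
  elNat (fun c => thπ M.tensor T c.fst.unop c.snd M.unit ≫
      mapLR T (M.leftUnitInv c.fst.unop) (M.leftUnitHom c.snd)) (by
    rintro ⟨⟨X⟩, Y⟩ ⟨⟨X'⟩, Y'⟩
    change act (thetaFun M.tensor T) (pr X Y) (pr X' Y') ≫ thπ M.tensor T X' Y' M.unit ≫
      mapLR T (M.leftUnitInv X') (M.leftUnitHom Y') =
      (thπ M.tensor T X Y M.unit ≫ mapLR T (M.leftUnitInv X) (M.leftUnitHom Y)) ▷ _ ≫
        act T (pr X Y) (pr X' Y')
    rw [act_eq_actOn, act_eq_actOn, thπ_act2_assoc, comp_whiskerRight, Category.assoc]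
    refine _ ≫= (mapLR_naturality T M.lamInvNat M.lamNat (𝟙 (pr X Y ⟶ᵥ pr X' Y'))).trans
      (_ ≫= ?_)
    rw [actOn_comp_functor]
    refine congrArg (actOn T) ?_
    exact (Category.id_comp _).trans (id_tensorHom_id _ _))

@[simp]
lemma nEl_thetaε (X Y : A) : nEl (M.thetaε T) (pr X Y) =
    thπ M.tensor T X Y M.unit ≫ mapLR T (M.leftUnitInv X) (M.leftUnitHom Y) :=
  nEl_elNat _ _ _

/-- The components of the comultiplication `δ : Θ T ⟶ Θ Θ T`: the projection at
`(W, Z)` is the projection at `Z ⊗ W`. -/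
def thetaδApp (X Y : A) : (thetaFun M.tensor T).obj (pr X Y) ⟶
    (thetaFun M.tensor (thetaFun M.tensor T)).obj (pr X Y) :=
  thLift₂ (fun W Z => thπ M.tensor T X Y (M.tensor.obj ⟨Z, W⟩) ≫
      mapLR T (M.assocInv Z W X) (M.assocHom Z W Y))
    (fun W Z Z' => by
      have h := thπ_wedge (t := M.tensor) (T := T) X Y (M.tensor.obj ⟨Z, W⟩) (M.tensor.obj ⟨Z', W⟩)
      have h' := (_ ◁ wr M.tensor W Z Z') ≫= h
      rw [whisker_exchange_assoc, whisker_exchange_assoc, ← actR_pre, ← actL_pre] at h'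
      refine actR_actL_mapLR T h' ?_ ?_
      · rw [Category.assoc, M.assoc_naturality_left]
      · refine (ePost_ePre_inv (p := wr M.tensor W Z Z' ≫ wr M.tensor X _ _)
          (M.assocInv_assocHom Z W X) (M.assocHom_assocInv Z' W X) ?_)
        rw [Category.assoc, M.assoc_naturality_left])
  (fun Z W W' => by
    have h := thπ_wedge (t := M.tensor) (T := T) X Y (M.tensor.obj ⟨Z, W⟩) (M.tensor.obj ⟨Z, W'⟩)
    have h' := (_ ◁ wl M.tensor Z W W') ≫= h
    rw [whisker_exchange_assoc, whisker_exchange_assoc, ← actR_pre, ← actL_pre] at h'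
    refine actR_actL_mapLR T h' ?_ ?_
    · rw [Category.assoc, M.assoc_naturality_middle, Category.assoc]
    · refine ePost_ePre_inv (M.assocInv_assocHom Z W X) (M.assocHom_assocInv Z W' X) ?_
      rw [Category.assoc, M.assoc_naturality_middle, Category.assoc])

lemma thetaδApp_π (X Y Z W : A) :
    M.thetaδApp T X Y ≫ thπ M.tensor (thetaFun M.tensor T) X Y W ≫
      thπ M.tensor T (M.tensor.obj ⟨W, X⟩) (M.tensor.obj ⟨W, Y⟩) Z =
    thπ M.tensor T X Y (M.tensor.obj ⟨Z, W⟩) ≫ mapLR T (M.assocInv Z W X) (M.assocHom Z W Y) := by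
  exact thLift₂_π _ _ _ W Z

/-- The comultiplication `δ : Θ T ⟶ Θ Θ T`. -/
def thetaδ : 𝟙_ V ⟶ natObj (thetaFun M.tensor T) (thetaFun M.tensor (thetaFun M.tensor T)) :=
  elNat (fun c => M.thetaδApp T c.fst.unop c.snd) (by
    rintro ⟨⟨X⟩, Y⟩ ⟨⟨X'⟩, Y'⟩
    change act (thetaFun M.tensor T) (pr X Y) (pr X' Y') ≫ M.thetaδApp T X' Y' =
      M.thetaδApp T X Y ▷ _ ≫ act (thetaFun M.tensor (thetaFun M.tensor T)) (pr X Y) (pr X' Y')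
    rw [act_eq_actOn, act_eq_actOn]
    apply th_ext₂; intro W Z
    rw [Category.assoc, thetaδApp_π, thπ_act2_assoc, Category.assoc, thπ_thπ_actOn,
      ← comp_whiskerRight_assoc, thetaδApp_π, comp_whiskerRight, Category.assoc]
    exact _ ≫= mapLR_naturality T (M.assocInvNat Z W) (M.assocNat Z W)
      (𝟙 (pr X Y ⟶ᵥ pr X' Y')))

@[simp]
lemma nEl_thetaδ (X Y : A) : nEl (M.thetaδ T) (pr X Y) = M.thetaδApp T X Y :=
  nEl_elNat _ _ _

end MonoidalVCat

end ThetaComonad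

section ThetaLaws

variable {V : Type u} [Category.{v} V] [MonoidalCategory V] [SymmetricCategory V]
  [MonoidalClosed V] [HasLimits V] {A : Type v} [EnrichedCategory V A]

lemma thetaMap_nev_assoc {t : EnrichedFunctor V (TensorCat A A) A}
    {T T' : EnrichedFunctor V (TensorCat Aᵒᵖ A) V} {W U : V} (x : W ⟶ natObj T T')
    (X Y Z : A) (h : T'.obj (pr (t.obj ⟨Z, X⟩) (t.obj ⟨Z, Y⟩)) ⟶ U) :
    nev (x ≫ thetaMap t T T') (pr X Y) ≫ thπ t T' X Y Z ≫ h =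
      thπ t T X Y Z ▷ W ≫ nev x (pr (t.obj ⟨Z, X⟩) (t.obj ⟨Z, Y⟩)) ≫ h := by
  rw [← Category.assoc, thetaMap_nev, Category.assoc]

lemma thetaMap_nEl_assoc {t : EnrichedFunctor V (TensorCat A A) A}
    {T T' : EnrichedFunctor V (TensorCat Aᵒᵖ A) V} {U : V} (x : 𝟙_ V ⟶ natObj T T')
    (X Y Z : A) (h : T'.obj (pr (t.obj ⟨Z, X⟩) (t.obj ⟨Z, Y⟩)) ⟶ U) :
    nEl (x ≫ thetaMap t T T') (pr X Y) ≫ thπ t T' X Y Z ≫ h =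
      thπ t T X Y Z ≫ nEl x (pr (t.obj ⟨Z, X⟩) (t.obj ⟨Z, Y⟩)) ≫ h := by
  rw [← Category.assoc, thetaMap_nEl, Category.assoc]

lemma thπ_mapLR_assoc {t : EnrichedFunctor V (TensorCat A A) A}
    {T : EnrichedFunctor V (TensorCat Aᵒᵖ A) V} {X X' Y Y' : A} {U : V}
    (f : 𝟙_ V ⟶ (X' ⟶ᵥ X)) (g : 𝟙_ V ⟶ (Y ⟶ᵥ Y')) (Z : A)
    (h : T.obj (pr (t.obj ⟨Z, X'⟩) (t.obj ⟨Z, Y'⟩)) ⟶ U) :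
    mapLR (thetaFun t T) f g ≫ thπ t T X' Y' Z ≫ h =
      thπ t T X Y Z ≫ mapLR T (f ≫ wl t Z X' X) (g ≫ wl t Z Y Y') ≫ h := by
  rw [← Category.assoc, thπ_mapLR, Category.assoc]

namespace MonoidalVCat

variable (M : MonoidalVCat V A)

lemma thetaδApp_π_assoc (T : EnrichedFunctor V (TensorCat Aᵒᵖ A) V) (X Y Z W : A) {U : V}
    (h : T.obj (pr (M.tensor.obj ⟨Z, M.tensor.obj ⟨W, X⟩⟩)
      (M.tensor.obj ⟨Z, M.tensor.obj ⟨W, Y⟩⟩)) ⟶ U) :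
    M.thetaδApp T X Y ≫ thπ M.tensor (thetaFun M.tensor T) X Y W ≫
      thπ M.tensor T (M.tensor.obj ⟨W, X⟩) (M.tensor.obj ⟨W, Y⟩) Z ≫ h =
    thπ M.tensor T X Y (M.tensor.obj ⟨Z, W⟩) ≫
      mapLR T (M.assocInv Z W X) (M.assocHom Z W Y) ≫ h := by
  have := M.thetaδApp_π T X Y Z W =≫ h
  simpa only [Category.assoc] using this

lemma leftUnit_tensor_inv (X Y : A) :
    elComp (M.leftUnitInv (M.tensor.obj ⟨X, Y⟩)) (M.assocInv M.unit X Y) =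
      M.leftUnitInv X ≫ wr M.tensor Y _ _ := by
  have h := M.leftUnit_tensor X Y
  refine el_cancel_right (f := M.leftUnitHom X ≫ wr M.tensor Y _ _)
    (M.wr_el_inv (M.leftUnitHom_leftUnitInv X) Y) ?_
  rw [M.wr_el_inv (M.leftUnitInv_leftUnitHom X) Y, ← h, elComp_assoc,
    ← elComp_assoc (M.assocInv _ _ _), M.assocInv_assocHom, eId_elComp,
    M.leftUnitInv_leftUnitHom]

lemma triangle_inv (X Y : A) :
    elComp (M.leftUnitInv Y ≫ wl M.tensor X _ _) (M.assocInv X M.unit Y) =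
      M.rightUnitInv X ≫ wr M.tensor Y _ _ := by
  have h := M.triangle X Y
  refine el_cancel_right (f := M.rightUnitHom X ≫ wr M.tensor Y _ _)
    (M.wr_el_inv (M.rightUnitHom_rightUnitInv X) Y) ?_
  rw [M.wr_el_inv (M.rightUnitInv_rightUnitHom X) Y, ← h, elComp_assoc,
    ← elComp_assoc (M.assocInv _ _ _), M.assocInv_assocHom, eId_elComp, ← wl_el,
    M.leftUnitInv_leftUnitHom, wl_id]

/-- The comonad `Θ` on `[Aᵒᵖ ⊗ A, V]`, `(Θ T)(X, Y) = ∫_Z T(Z ⊗ X, Z ⊗ Y)`. -/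
def thetaComonad : VComonad (V := V) (EnrichedFunctor V (TensorCat Aᵒᵖ A) V) where
  toFunctor := theta M.tensor
  ε := GNat.ofNev (fun T => M.thetaε T) (by
    rintro T T' ⟨⟨X⟩, Y⟩
    change nev (thetaMap M.tensor T T') (pr X Y) ≫ nEl (M.thetaε T') (pr X Y) =
      nEl (M.thetaε T) (pr X Y) ▷ _ ≫ nev (𝟙 (natObj T T')) (pr X Y)
    rw [← Category.id_comp (thetaMap M.tensor T T'), nEl_thetaε, nEl_thetaε, thetaMap_nev_assoc,
      comp_whiskerRight, Category.assoc, nev_mapLR])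
  δ := GNat.ofNev (fun T => M.thetaδ T) (by
    rintro T T' ⟨⟨X⟩, Y⟩
    change nev (thetaMap M.tensor T T') (pr X Y) ≫ nEl (M.thetaδ T') (pr X Y) =
      nEl (M.thetaδ T) (pr X Y) ▷ natObj T T' ≫
        nev (thetaMap M.tensor T T' ≫ thetaMap M.tensor _ _) (pr X Y)
    rw [← Category.id_comp (thetaMap M.tensor T T'), nEl_thetaδ, nEl_thetaδ]
    apply th_ext₂; intro W Z
    rw [Category.assoc, thetaδApp_π, thetaMap_nev_assoc, Category.assoc, thetaMap_nev_assoc,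
      thetaMap_nev, ← comp_whiskerRight_assoc, ← comp_whiskerRight_assoc, Category.assoc,
      thetaδApp_π, comp_whiskerRight, Category.assoc, nev_mapLR])
  counit_left T := by
    apply nEl_ext
    rintro ⟨⟨X⟩, Y⟩
    refine (nEl_elComp _ _ (pr X Y)).trans ?_
    change nEl (M.thetaδ T) (pr X Y) ≫ nEl (M.thetaε (thetaFun M.tensor T)) (pr X Y) =
      nEl (eId V (thetaFun M.tensor T)) (pr X Y)
    rw [nEl_thetaδ, nEl_thetaε, nEl_eId]
    apply th_ext; intro Z
    rw [Category.assoc, Category.assoc, thπ_mapLR, thetaδApp_π_assoc, mapLR_mapLR,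
      M.triangle_inv, M.triangle, Category.id_comp]
    exact (thπ_wedge X Y).iso _ _ (M.rightUnitInv_rightUnitHom Z)
  counit_right T := by
    apply nEl_ext
    rintro ⟨⟨X⟩, Y⟩
    refine (nEl_elComp _ _ (pr X Y)).trans ?_
    change nEl (M.thetaδ T) (pr X Y) ≫ nEl (M.thetaε T ≫ thetaMap M.tensor _ _) (pr X Y) =
      nEl (eId V (thetaFun M.tensor T)) (pr X Y)
    rw [nEl_thetaδ, nEl_eId]
    apply th_ext; intro Z
    rw [Category.assoc, thetaMap_nEl, nEl_thetaε, thetaδApp_π_assoc, mapLR_mapLR,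
      M.leftUnit_tensor_inv, M.leftUnit_tensor, Category.id_comp]
    exact (thπ_wedge X Y).iso _ _ (M.leftUnitInv_leftUnitHom Z)
  coassoc T := by
    apply nEl_ext
    rintro ⟨⟨X⟩, Y⟩
    refine (nEl_elComp _ _ (pr X Y)).trans (Eq.trans ?_ (nEl_elComp _ _ (pr X Y)).symm)
    change nEl (M.thetaδ T) (pr X Y) ≫ nEl (M.thetaδ (thetaFun M.tensor T)) (pr X Y) =
      nEl (M.thetaδ T) (pr X Y) ≫ nEl (M.thetaδ T ≫ thetaMap M.tensor _ _) (pr X Y)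
    rw [nEl_thetaδ, nEl_thetaδ]
    apply th_ext₂; intro Z₁ Z₂
    apply th_ext; intro Z₃
    simp only [Category.assoc]
    rw [thetaδApp_π_assoc, thπ_mapLR, thetaδApp_π_assoc, thetaMap_nEl_assoc, nEl_thetaδ,
      thetaδApp_π, thetaδApp_π_assoc, mapLR_mapLR, mapLR_mapLR,
      ← (thπ_wedge (t := M.tensor) (T := T) X Y).iso (M.assocInv Z₃ Z₂ Z₁)
        (M.assocHom Z₃ Z₂ Z₁) (M.assocHom_assocInv Z₃ Z₂ Z₁), Category.assoc, mapLR_mapLR]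
    rw [← M.pentagon, ← M.pentagon_inv]
    simp only [elComp_assoc]
    rw [M.wr_el_inv (M.assocInv_assocHom Z₃ Z₂ Z₁), elComp_eId,
      ← elComp_assoc (_ ≫ wr M.tensor Y _ _), M.wr_el_inv (M.assocInv_assocHom Z₃ Z₂ Z₁),
      eId_elComp]

end MonoidalVCat

end ThetaLaws

section Distributive

variable {V : Type u} [Category.{v} V] [MonoidalCategory V] [SymmetricCategory V]
  [MonoidalClosed V] {M : Type u₁} [EnrichedCategory V M] {N : Type u₂} [EnrichedCategory V N]
  {P : Type u₃} [EnrichedCategory V P]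

lemma el_reassoc {x y y' z w : M} {a : 𝟙_ V ⟶ (x ⟶ᵥ y)} {b : 𝟙_ V ⟶ (y ⟶ᵥ z)}
    {c : 𝟙_ V ⟶ (x ⟶ᵥ y')} {d : 𝟙_ V ⟶ (y' ⟶ᵥ z)} (h : elComp a b = elComp c d)
    (k : 𝟙_ V ⟶ (z ⟶ᵥ w)) : elComp a (elComp b k) = elComp c (elComp d k) := by
  rw [← elComp_assoc, h, elComp_assoc]

lemma el_reassoc' {x y z w : M} {a : 𝟙_ V ⟶ (x ⟶ᵥ y)} {b : 𝟙_ V ⟶ (y ⟶ᵥ z)}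
    {c : 𝟙_ V ⟶ (x ⟶ᵥ z)} (h : elComp a b = c)
    (k : 𝟙_ V ⟶ (z ⟶ᵥ w)) : elComp a (elComp b k) = elComp c k := by
  rw [← elComp_assoc, h]

/-- The action of a `V`-functor on elements. -/
def fEl (F : EnrichedFunctor V M N) {x y : M} (f : 𝟙_ V ⟶ (x ⟶ᵥ y)) :
    𝟙_ V ⟶ (F.obj x ⟶ᵥ F.obj y) := f ≫ F.map x y

lemma fEl_elComp (F : EnrichedFunctor V M N) {x y z : M} (f : 𝟙_ V ⟶ (x ⟶ᵥ y))
    (g : 𝟙_ V ⟶ (y ⟶ᵥ z)) : fEl F (elComp f g) = elComp (fEl F f) (fEl F g) :=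
  elComp_map F f g

lemma fEl_eId (F : EnrichedFunctor V M N) (x : M) : fEl F (eId V x) = eId V (F.obj x) :=
  F.map_id x

lemma VNat.el {F G : EnrichedFunctor V M N} (σ : VNat F G) {x y : M} (f : 𝟙_ V ⟶ (x ⟶ᵥ y)) :
    elComp (fEl F f) (σ.app y) = elComp (σ.app x) (fEl G f) := by
  rw [elComp_eq_ePost, elComp_eq_ePre, fEl, fEl, Category.assoc, Category.assoc,
    GNat.el_naturality]

lemma ePost_ePre_comp {W : V} {x x' y y' z z' : M} {p : W ⟶ (x ⟶ᵥ x')} {q : W ⟶ (y ⟶ᵥ y')}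
    {r : W ⟶ (z ⟶ᵥ z')} {a : 𝟙_ V ⟶ (x ⟶ᵥ y)} {a' : 𝟙_ V ⟶ (x' ⟶ᵥ y')} {b : 𝟙_ V ⟶ (y ⟶ᵥ z)}
    {b' : 𝟙_ V ⟶ (y' ⟶ᵥ z')} (h : p ≫ ePost x a' = q ≫ ePre a y')
    (h' : q ≫ ePost y b' = r ≫ ePre b z') :
    p ≫ ePost x (elComp a' b') = r ≫ ePre (elComp a b) z' := by
  rw [← ePost_ePost, ← ePre_ePre, ← Category.assoc, h, Category.assoc, ePre_ePost,
    ← Category.assoc, h', Category.assoc]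

lemma ePost_ePre_map (F : EnrichedFunctor V M N) {W : V} {x x' y y' : M} {p : W ⟶ (x ⟶ᵥ x')}
    {q : W ⟶ (y ⟶ᵥ y')} {a : 𝟙_ V ⟶ (x ⟶ᵥ y)} {a' : 𝟙_ V ⟶ (x' ⟶ᵥ y')}
    (h : p ≫ ePost x a' = q ≫ ePre a y') :
    (p ≫ F.map x x') ≫ ePost (F.obj x) (fEl F a') =
      (q ≫ F.map y y') ≫ ePre (fEl F a) (F.obj y') := by
  rw [fEl, fEl, Category.assoc, Category.assoc, ← ePost_map, ← ePre_map, ← Category.assoc, h,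
    Category.assoc]

/-- A distributive law `H G ⟶ G H` between `V`-comonads. -/
structure DistribLaw (G H : VComonad (V := V) M) where
  κ : VNat (G.toFunctor.comp V H.toFunctor) (H.toFunctor.comp V G.toFunctor)
  counit_left : ∀ x, elComp (κ.app x) (G.ε.app (H.toFunctor.obj x)) =
    fEl H.toFunctor (G.ε.app x)
  counit_right : ∀ x, elComp (κ.app x) (fEl G.toFunctor (H.ε.app x)) =
    H.ε.app (G.toFunctor.obj x)
  comul_left : ∀ x, elComp (κ.app x) (G.δ.app (H.toFunctor.obj x)) =
    elComp (fEl H.toFunctor (G.δ.app x))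
      (elComp (κ.app (G.toFunctor.obj x)) (fEl G.toFunctor (κ.app x)))
  comul_right : ∀ x, elComp (κ.app x) (fEl G.toFunctor (H.δ.app x)) =
    elComp (H.δ.app (G.toFunctor.obj x))
      (elComp (fEl H.toFunctor (κ.app x)) (κ.app (H.toFunctor.obj x)))

namespace DistribLaw

variable {G H : VComonad (V := V) M} (d : DistribLaw G H)

lemma κ_el {x y : M} (f : 𝟙_ V ⟶ (x ⟶ᵥ y)) :
    elComp (fEl H.toFunctor (fEl G.toFunctor f)) (d.κ.app y) =
      elComp (d.κ.app x) (fEl G.toFunctor (fEl H.toFunctor f)) := by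
  have h := VNat.el d.κ f
  have e : fEl (G.toFunctor.comp V H.toFunctor) f = fEl H.toFunctor (fEl G.toFunctor f) :=
    (Category.assoc _ _ _).symm
  have e' : fEl (H.toFunctor.comp V G.toFunctor) f = fEl G.toFunctor (fEl H.toFunctor f) :=
    (Category.assoc _ _ _).symm
  rw [e, e'] at h
  exact h

lemma δ_el (H : VComonad (V := V) M) {x y : M} (f : 𝟙_ V ⟶ (x ⟶ᵥ y)) :
    elComp (fEl H.toFunctor f) (H.δ.app y) =
      elComp (H.δ.app x) (fEl H.toFunctor (fEl H.toFunctor f)) := by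
  have h := VNat.el H.δ f
  have e : fEl (H.toFunctor.comp V H.toFunctor) f = fEl H.toFunctor (fEl H.toFunctor f) :=
    (Category.assoc _ _ _).symm
  rw [e] at h
  exact h

/-- The comultiplication `H G ⟶ H G G ⟶ H H G G ⟶ H G H G` of the composite comonad. -/
def compδ (x : M) : 𝟙_ V ⟶ (H.toFunctor.obj (G.toFunctor.obj x) ⟶ᵥ
    H.toFunctor.obj (G.toFunctor.obj (H.toFunctor.obj (G.toFunctor.obj x)))) :=
  elComp (fEl H.toFunctor (G.δ.app x))
    (elComp (H.δ.app (G.toFunctor.obj (G.toFunctor.obj x)))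
      (fEl H.toFunctor (d.κ.app (G.toFunctor.obj x))))

variable (G H) in
/-- The counit `H G ⟶ H ⟶ 1` of the composite comonad. -/
def compε (x : M) : 𝟙_ V ⟶ (H.toFunctor.obj (G.toFunctor.obj x) ⟶ᵥ x) :=
  elComp (fEl H.toFunctor (G.ε.app x)) (H.ε.app x)

lemma compε_naturality (x y : M) :
    (G.toFunctor.map x y ≫ H.toFunctor.map _ _) ≫ ePost _ (compε G H y) =
      𝟙 (x ⟶ᵥ y) ≫ ePre (compε G H x) y := by
  refine ePost_ePre_comp (q := 𝟙 _ ≫ H.toFunctor.map x y)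
    (ePost_ePre_map H.toFunctor (GNat.el_naturality G.ε x y)) ?_
  rw [Category.id_comp]
  exact GNat.el_naturality H.ε x y

lemma compδ_naturality_aux {G H : EnrichedFunctor V M M}
    {dG : ∀ x, 𝟙_ V ⟶ (G.obj x ⟶ᵥ G.obj (G.obj x))}
    {dH : ∀ x, 𝟙_ V ⟶ (H.obj x ⟶ᵥ H.obj (H.obj x))}
    {k : ∀ x, 𝟙_ V ⟶ (H.obj (G.obj x) ⟶ᵥ G.obj (H.obj x))}
    (nG : ∀ x y, G.map x y ≫ ePost _ (dG y) = (G.map x y ≫ G.map _ _) ≫ ePre (dG x) _)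
    (nH : ∀ x y, H.map x y ≫ ePost _ (dH y) = (H.map x y ≫ H.map _ _) ≫ ePre (dH x) _)
    (nk : ∀ x y, (G.map x y ≫ H.map _ _) ≫ ePost _ (k y) =
      (H.map x y ≫ G.map _ _) ≫ ePre (k x) _) (x y : M) :
    (G.map x y ≫ H.map _ _) ≫ ePost (H.obj (G.obj x)) (elComp (fEl H (dG y))
      (elComp (dH (G.obj (G.obj y))) (fEl H (k (G.obj y))))) =
      ((G.map x y ≫ H.map _ _) ≫ G.map _ _ ≫ H.map _ _) ≫ ePre (elComp (fEl H (dG x))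
      (elComp (dH (G.obj (G.obj x))) (fEl H (k (G.obj x))))) _ := by
  refine ePost_ePre_comp (ePost_ePre_map H (nG x y))
    (ePost_ePre_comp (q := ((G.map x y ≫ G.map _ _) ≫ H.map _ _) ≫ H.map _ _) ?_ ?_)
  · have h := (G.map x y ≫ G.map _ _) ≫= nH (G.obj (G.obj x)) (G.obj (G.obj y))
    simpa only [Category.assoc] using h
  · have h' := G.map x y ≫= nk (G.obj x) (G.obj y)
    have h'' := ePost_ePre_map H
      (p := (G.map x y ≫ G.map _ _) ≫ H.map _ _)
      (q := (G.map x y ≫ H.map _ _) ≫ G.map _ _)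
      (a := k (G.obj x)) (a' := k (G.obj y)) (by simpa only [Category.assoc] using h')
    simpa only [Category.assoc] using h''

lemma compδ_naturality (x y : M) :
    (G.toFunctor.map x y ≫ H.toFunctor.map _ _) ≫ ePost _ (d.compδ y) =
      ((G.toFunctor.map x y ≫ H.toFunctor.map _ _) ≫ G.toFunctor.map _ _ ≫ H.toFunctor.map _ _) ≫
        ePre (d.compδ x) _ :=
  compδ_naturality_aux (dG := G.δ.app) (dH := H.δ.app) (k := d.κ.app)
    (fun x y => GNat.el_naturality G.δ x y) (fun x y => GNat.el_naturality H.δ x y)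
    (fun x y => GNat.el_naturality d.κ x y) x y

section Aux

variable {G H : EnrichedFunctor V M M}
  {eG : ∀ x, 𝟙_ V ⟶ (G.obj x ⟶ᵥ x)} {eH : ∀ x, 𝟙_ V ⟶ (H.obj x ⟶ᵥ x)}
  {dG : ∀ x, 𝟙_ V ⟶ (G.obj x ⟶ᵥ G.obj (G.obj x))}
  {dH : ∀ x, 𝟙_ V ⟶ (H.obj x ⟶ᵥ H.obj (H.obj x))}
  {k : ∀ x, 𝟙_ V ⟶ (H.obj (G.obj x) ⟶ᵥ G.obj (H.obj x))}

lemma counit_left_aux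
    (nH : ∀ {x y : M} (f : 𝟙_ V ⟶ (x ⟶ᵥ y)),
      elComp (fEl H f) (dH y) = elComp (dH x) (fEl H (fEl H f)))
    (uG : ∀ x, elComp (dG x) (eG (G.obj x)) = eId V _)
    (uH : ∀ x, elComp (dH x) (eH (H.obj x)) = eId V _)
    (ku : ∀ x, elComp (k x) (eG (H.obj x)) = fEl H (eG x)) (x : M) :
    elComp (elComp (fEl H (dG x)) (elComp (dH (G.obj (G.obj x))) (fEl H (k (G.obj x)))))
      (elComp (fEl H (eG (H.obj (G.obj x)))) (eH (H.obj (G.obj x)))) = eId V _ := by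
  rw [elComp_assoc, elComp_assoc, el_reassoc' (fEl_elComp _ _ _).symm, ku,
    ← el_reassoc (nH _), uH, elComp_eId, ← fEl_elComp, uG, fEl_eId]

lemma counit_right_aux
    (nH : ∀ {x y : M} (f : 𝟙_ V ⟶ (x ⟶ᵥ y)),
      elComp (fEl H f) (dH y) = elComp (dH x) (fEl H (fEl H f)))
    (nk : ∀ {x y : M} (f : 𝟙_ V ⟶ (x ⟶ᵥ y)),
      elComp (fEl H (fEl G f)) (k y) = elComp (k x) (fEl G (fEl H f)))
    (uG : ∀ x, elComp (dG x) (fEl G (eG x)) = eId V _)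
    (uH : ∀ x, elComp (dH x) (fEl H (eH x)) = eId V _)
    (ku : ∀ x, elComp (k x) (fEl G (eH x)) = eH (G.obj x)) (x : M) :
    elComp (elComp (fEl H (dG x)) (elComp (dH (G.obj (G.obj x))) (fEl H (k (G.obj x)))))
      (fEl H (fEl G (elComp (fEl H (eG x)) (eH x)))) = eId V _ := by
  rw [elComp_assoc, elComp_assoc, ← fEl_elComp, fEl_elComp G, ← elComp_assoc (k _),
    ← nk, elComp_assoc, ku, fEl_elComp H, ← el_reassoc (nH _), uH, elComp_eId, ← fEl_elComp,
    uG, fEl_eId]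

lemma coassoc_aux
    (nH : ∀ {x y : M} (f : 𝟙_ V ⟶ (x ⟶ᵥ y)),
      elComp (fEl H f) (dH y) = elComp (dH x) (fEl H (fEl H f)))
    (nk : ∀ {x y : M} (f : 𝟙_ V ⟶ (x ⟶ᵥ y)),
      elComp (fEl H (fEl G f)) (k y) = elComp (k x) (fEl G (fEl H f)))
    (cG : ∀ x, elComp (dG x) (dG (G.obj x)) = elComp (dG x) (fEl G (dG x)))
    (cH : ∀ x, elComp (dH x) (dH (H.obj x)) = elComp (dH x) (fEl H (dH x)))
    (kG : ∀ x, elComp (k x) (dG (H.obj x)) =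
      elComp (fEl H (dG x)) (elComp (k (G.obj x)) (fEl G (k x))))
    (kH : ∀ x, elComp (k x) (fEl G (dH x)) =
      elComp (dH (G.obj x)) (elComp (fEl H (k x)) (k (H.obj x))))
    (D : ∀ x, 𝟙_ V ⟶ (H.obj (G.obj x) ⟶ᵥ H.obj (G.obj (H.obj (G.obj x)))))
    (hD : ∀ x, D x =
      elComp (fEl H (dG x)) (elComp (dH (G.obj (G.obj x))) (fEl H (k (G.obj x))))) (x : M) :
    elComp (D x) (D (H.obj (G.obj x))) = elComp (D x) (fEl H (fEl G (D x))) := by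
  have L : elComp (D x) (D (H.obj (G.obj x))) = elComp (fEl H (elComp (dG x) (dG (G.obj x))))
      (elComp (dH _) (elComp (dH _) (fEl H (elComp (fEl H (k (G.obj (G.obj x))))
        (elComp (fEl H (fEl G (k (G.obj x)))) (k _)))))) := by
    rw [hD, hD (H.obj (G.obj x))]
    simp only [elComp_assoc]
    rw [el_reassoc' (fEl_elComp _ _ _).symm, kG]
    simp only [fEl_elComp, elComp_assoc]
    rw [← el_reassoc (nH (dG (G.obj x))),
      el_reassoc (nH (fEl G (k (G.obj x)))), el_reassoc (nH (k (G.obj (G.obj x))))]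
  have R : elComp (D x) (fEl H (fEl G (D x))) = elComp (fEl H (elComp (dG x) (fEl G (dG x))))
      (elComp (dH _) (elComp (dH _) (fEl H (elComp (fEl H (k (G.obj (G.obj x))))
        (elComp (fEl H (fEl G (k (G.obj x)))) (k _)))))) := by
    rw [← el_reassoc (cH _).symm, hD]
    simp only [elComp_assoc]
    have e : elComp (k (G.obj x)) (fEl G (elComp (fEl H (dG x)) (elComp (dH (G.obj (G.obj x)))
        (fEl H (k (G.obj x)))))) = elComp (fEl H (fEl G (dG x))) (elComp (dH _)
        (elComp (fEl H (k (G.obj (G.obj x)))) (elComp (fEl H (fEl G (k (G.obj x)))) (k _)))) := by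
      simp only [fEl_elComp]
      rw [← el_reassoc (nk _), el_reassoc (kH _), elComp_assoc, ← nk]
    rw [← fEl_elComp, e]
    simp only [fEl_elComp, elComp_assoc]
    rw [← el_reassoc (nH _)]
  rw [L, R, cG]

end Aux

/-- The composite comonad `H G` of a distributive law `H G ⟶ G H`. -/
def comonad : VComonad (V := V) M where
  toFunctor := G.toFunctor.comp V H.toFunctor
  ε := GNat.ofEl (fun x => compε G H x) (fun x y => compε_naturality x y)
  δ := GNat.ofEl (fun x => d.compδ x) (fun x y => d.compδ_naturality x y)
  counit_left x := counit_left_aux (dG := G.δ.app) (dH := H.δ.app) (k := d.κ.app)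
    (eG := G.ε.app) (eH := H.ε.app) (δ_el H) G.counit_left H.counit_left d.counit_left x
  counit_right x := by
    refine Eq.trans (congrArg (elComp (d.compδ x)) (Category.assoc _ _ _).symm) ?_
    exact counit_right_aux (dG := G.δ.app) (dH := H.δ.app) (k := d.κ.app)
      (eG := G.ε.app) (eH := H.ε.app) (δ_el H) d.κ_el G.counit_right H.counit_right
      d.counit_right x
  coassoc x := by
    refine Eq.trans ?_ (congrArg (elComp (d.compδ x)) (Category.assoc _ _ _))
    exact coassoc_aux (dG := G.δ.app) (dH := H.δ.app) (k := d.κ.app)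
      (δ_el H) d.κ_el G.coassoc H.coassoc d.comul_left d.comul_right d.compδ (fun _ => rfl) x

end DistribLaw

end Distributive

section Interchange

variable {V : Type u} [Category.{v} V] [MonoidalCategory V] [SymmetricCategory V]

/-- Invertible, `V`-natural elements `B ⊗' (A ⊗ X) ⟶ A ⊗ (B ⊗' X)` for two monoidal structures `M`
and `N` on `A`, compatible with the units and the associativity isomorphisms. -/
structure Interchange {A : Type u₁} [EnrichedCategory V A] (M N : MonoidalVCat V A) where
  hom : ∀ A' X B : A, 𝟙_ V ⟶
    (N.tensor.obj ⟨B, M.tensor.obj ⟨A', X⟩⟩ ⟶ᵥ M.tensor.obj ⟨A', N.tensor.obj ⟨B, X⟩⟩)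
  inv : ∀ A' X B : A, 𝟙_ V ⟶
    (M.tensor.obj ⟨A', N.tensor.obj ⟨B, X⟩⟩ ⟶ᵥ N.tensor.obj ⟨B, M.tensor.obj ⟨A', X⟩⟩)
  hom_inv : ∀ A' X B, elComp (hom A' X B) (inv A' X B) = eId V _
  inv_hom : ∀ A' X B, elComp (inv A' X B) (hom A' X B) = eId V _
  nat_left : ∀ A₁ A₂ X B : A,
    wr M.tensor X A₁ A₂ ≫ wl N.tensor B _ _ ≫ ePost _ (hom A₂ X B) =
      wr M.tensor (N.tensor.obj ⟨B, X⟩) A₁ A₂ ≫ ePre (hom A₁ X B) _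
  nat_middle : ∀ A' X X' B : A,
    wl M.tensor A' X X' ≫ wl N.tensor B _ _ ≫ ePost _ (hom A' X' B) =
      wl N.tensor B X X' ≫ wl M.tensor A' _ _ ≫ ePre (hom A' X B) _
  nat_right : ∀ A' X B₁ B₂ : A,
    wr N.tensor (M.tensor.obj ⟨A', X⟩) B₁ B₂ ≫ ePost _ (hom A' X B₂) =
      wr N.tensor X B₁ B₂ ≫ wl M.tensor A' _ _ ≫ ePre (hom A' X B₁) _
  unit_left : ∀ X B : A, elComp (inv M.unit X B) (M.leftUnitHom X ≫ wl N.tensor B _ _) =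
    M.leftUnitHom (N.tensor.obj ⟨B, X⟩)
  unit_left_inv : ∀ X B : A, elComp (M.leftUnitInv X ≫ wl N.tensor B _ _) (hom M.unit X B) =
    M.leftUnitInv (N.tensor.obj ⟨B, X⟩)
  unit_right : ∀ A' X : A, elComp (inv A' X N.unit) (N.leftUnitHom (M.tensor.obj ⟨A', X⟩)) =
    N.leftUnitHom X ≫ wl M.tensor A' _ _
  unit_right_inv : ∀ A' X : A,
    elComp (N.leftUnitInv (M.tensor.obj ⟨A', X⟩)) (hom A' X N.unit) =
      N.leftUnitInv X ≫ wl M.tensor A' _ _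
  assoc_left : ∀ A₂ A₁ X B : A,
    elComp (inv (M.tensor.obj ⟨A₂, A₁⟩) X B) (M.assocHom A₂ A₁ X ≫ wl N.tensor B _ _) =
      elComp (M.assocHom A₂ A₁ (N.tensor.obj ⟨B, X⟩))
        (elComp (inv A₁ X B ≫ wl M.tensor A₂ _ _) (inv A₂ (M.tensor.obj ⟨A₁, X⟩) B))
  assoc_left_inv : ∀ A₂ A₁ X B : A,
    elComp (M.assocInv A₂ A₁ X ≫ wl N.tensor B _ _) (hom (M.tensor.obj ⟨A₂, A₁⟩) X B) =
      elComp (elComp (hom A₂ (M.tensor.obj ⟨A₁, X⟩) B) (hom A₁ X B ≫ wl M.tensor A₂ _ _))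
        (M.assocInv A₂ A₁ (N.tensor.obj ⟨B, X⟩))
  assoc_right : ∀ A' B₂ B₁ X : A,
    elComp (inv A' X (N.tensor.obj ⟨B₂, B₁⟩)) (N.assocHom B₂ B₁ (M.tensor.obj ⟨A', X⟩)) =
      elComp (N.assocHom B₂ B₁ X ≫ wl M.tensor A' _ _)
        (elComp (inv A' (N.tensor.obj ⟨B₁, X⟩) B₂) (inv A' X B₁ ≫ wl N.tensor B₂ _ _))
  assoc_right_inv : ∀ A' B₂ B₁ X : A,
    elComp (N.assocInv B₂ B₁ (M.tensor.obj ⟨A', X⟩)) (hom A' X (N.tensor.obj ⟨B₂, B₁⟩)) =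
      elComp (elComp (hom A' X B₁ ≫ wl N.tensor B₂ _ _) (hom A' (N.tensor.obj ⟨B₁, X⟩) B₂))
        (N.assocInv B₂ B₁ X ≫ wl M.tensor A' _ _)

section

variable {A : Type u₁} [EnrichedCategory V A] (M : MonoidalVCat V A)

lemma el_five {x y z w c : A} {p : 𝟙_ V ⟶ (x ⟶ᵥ y)} {q : 𝟙_ V ⟶ (y ⟶ᵥ z)}
    {r : 𝟙_ V ⟶ (z ⟶ᵥ w)} {s : 𝟙_ V ⟶ (x ⟶ᵥ c)} {t : 𝟙_ V ⟶ (c ⟶ᵥ w)}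
    (h : elComp p (elComp q r) = elComp s t) {q' : 𝟙_ V ⟶ (z ⟶ᵥ y)} {r' : 𝟙_ V ⟶ (w ⟶ᵥ z)}
    {s' : 𝟙_ V ⟶ (c ⟶ᵥ x)} (hq : elComp q q' = eId V y) (hr : elComp r r' = eId V z)
    (hs : elComp s' s = eId V c) : elComp s' p = elComp t (elComp r' q') := by
  have h' := congrArg (fun k => elComp s' (elComp k (elComp r' q'))) h
  simp only [elComp_assoc] at h'
  rw [← elComp_assoc r r', hr, eId_elComp, hq, elComp_eId, ← elComp_assoc s' s, hs,
    eId_elComp] at h'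
  exact h'

lemma el_five' {x y w c : A} {p : 𝟙_ V ⟶ (x ⟶ᵥ y)} {q : 𝟙_ V ⟶ (y ⟶ᵥ w)}
    {s : 𝟙_ V ⟶ (x ⟶ᵥ c)} {t : 𝟙_ V ⟶ (c ⟶ᵥ w)}
    (h : elComp p q = elComp s t) {p' : 𝟙_ V ⟶ (y ⟶ᵥ x)} {t' : 𝟙_ V ⟶ (w ⟶ᵥ c)}
    (hp : elComp p' p = eId V y) (ht : elComp t t' = eId V c) :
    elComp p' s = elComp q t' := by
  have h' := congrArg (fun k => elComp p' (elComp k t')) h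
  simp only [elComp_assoc] at h'
  rw [← elComp_assoc p' p, hp, eId_elComp, ht, elComp_eId] at h'
  exact h'.symm

namespace MonoidalVCat

lemma interchange_unit (X B : A) :
    elComp (M.assocInv M.unit X B) (M.leftUnitHom X ≫ wr M.tensor B _ _) =
      M.leftUnitHom (M.tensor.obj ⟨X, B⟩) := by
  rw [← M.leftUnit_tensor, ← elComp_assoc, M.assocInv_assocHom, eId_elComp]

lemma leftUnit_tensor_inv' (X Y : A) :
    elComp (M.leftUnitInv (M.tensor.obj ⟨X, Y⟩)) (M.assocInv M.unit X Y) =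
      M.leftUnitInv X ≫ wr M.tensor Y _ _ := by
  have h := M.leftUnit_tensor X Y
  have h1 : elComp (M.leftUnitInv X ≫ wr M.tensor Y _ _)
      (M.leftUnitHom X ≫ wr M.tensor Y _ _) = eId V _ := by
    rw [← wr_el, M.leftUnitInv_leftUnitHom, wr_id]
  have h2 : elComp (M.leftUnitHom X ≫ wr M.tensor Y _ _)
      (M.leftUnitInv X ≫ wr M.tensor Y _ _) = eId V _ := by
    rw [← wr_el, M.leftUnitHom_leftUnitInv, wr_id]
  refine el_cancel_right (f := M.leftUnitHom X ≫ wr M.tensor Y _ _) h2 ?_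
  rw [h1, ← h, elComp_assoc,
    ← elComp_assoc (M.assocInv _ _ _), M.assocInv_assocHom, eId_elComp,
    M.leftUnitInv_leftUnitHom]

lemma interchange_unit_inv (X B : A) :
    elComp (M.leftUnitInv X ≫ wr M.tensor B _ _) (M.assocHom M.unit X B) =
      M.leftUnitInv (M.tensor.obj ⟨X, B⟩) := by
  rw [← M.leftUnit_tensor_inv', elComp_assoc, M.assocInv_assocHom, elComp_eId]

lemma interchange_assoc (W X Y Z : A) :
    elComp (M.assocInv (M.tensor.obj ⟨W, X⟩) Y Z) (M.assocHom W X Y ≫ wr M.tensor Z _ _) =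
      elComp (M.assocHom W X (M.tensor.obj ⟨Y, Z⟩))
        (elComp (M.assocInv X Y Z ≫ wl M.tensor W _ _)
          (M.assocInv W (M.tensor.obj ⟨X, Y⟩) Z)) := by
  refine el_five (M.pentagon W X Y Z) (M.assocHom_assocInv _ _ _) ?_ (M.assocInv_assocHom _ _ _)
  rw [← M.wl_el, M.assocHom_assocInv, M.wl_id]

lemma interchange_assoc_inv (W X Y Z : A) :
    elComp (M.assocInv W X Y ≫ wr M.tensor Z _ _) (M.assocHom (M.tensor.obj ⟨W, X⟩) Y Z) =
      elComp (elComp (M.assocHom W (M.tensor.obj ⟨X, Y⟩) Z) (M.assocHom X Y Z ≫ wl M.tensor W _ _))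
        (M.assocInv W X (M.tensor.obj ⟨Y, Z⟩)) := by
  refine el_five' (M.pentagon W X Y Z) ?_ (M.assocHom_assocInv _ _ _)
  rw [← M.wr_el, M.assocInv_assocHom, M.wr_id]

end MonoidalVCat

end

/-- The associativity isomorphism `(A ⊗ X) ⊗ B ⟶ A ⊗ (X ⊗ B)` as an interchange. -/
def MonoidalVCat.interchange {A : Type u₁} [EnrichedCategory V A] (M : MonoidalVCat V A) :
    Interchange M M.rev where
  hom A' X B := M.assocHom A' X B
  inv A' X B := M.assocInv A' X B
  hom_inv A' X B := M.assocHom_assocInv A' X B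
  inv_hom A' X B := M.assocInv_assocHom A' X B
  nat_left A₁ A₂ X B := by
    have h := M.assoc_naturality_left A₁ A₂ X B
    rw [← wl_revTensor M.tensor B] at h
    exact h
  nat_middle A' X X' B := by
    have h := M.assoc_naturality_middle A' X X' B
    rw [← wl_revTensor, ← wl_revTensor] at h
    exact h
  nat_right A' X B₁ B₂ := by
    have h := M.assoc_naturality_right A' X B₁ B₂
    rw [← wr_revTensor, ← wr_revTensor] at h
    exact h
  unit_left X B := by
    have h := M.interchange_unit X B
    rw [← wl_revTensor] at h
    exact h
  unit_left_inv X B := by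
    have h := M.interchange_unit_inv X B
    rw [← wl_revTensor] at h
    exact h
  unit_right A' X := by
    have h := M.rev.leftUnit_tensor X A'
    have e : wr M.rev.tensor A' (M.rev.tensor.obj ⟨M.rev.unit, X⟩) X = wl M.tensor A' _ _ :=
      wr_revTensor _ _ _ _
    rw [e] at h
    exact h
  unit_right_inv A' X := by
    have h := M.rev.leftUnit_tensor_inv' X A'
    have e : wr M.rev.tensor A' X (M.rev.tensor.obj ⟨M.rev.unit, X⟩) = wl M.tensor A' _ _ :=
      wr_revTensor _ _ _ _
    rw [e] at h
    exact h
  assoc_left A₂ A₁ X B := by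
    have h := M.interchange_assoc A₂ A₁ X B
    rw [← wl_revTensor] at h
    exact h
  assoc_left_inv A₂ A₁ X B := by
    have h := M.interchange_assoc_inv A₂ A₁ X B
    rw [← wl_revTensor] at h
    exact h
  assoc_right A' B₂ B₁ X := by
    have h := (M.pentagon_inv B₂ B₁ X A').symm
    rw [← wl_revTensor] at h
    exact h
  assoc_right_inv A' B₂ B₁ X := by
    have h := (M.pentagon A' X B₁ B₂).symm.trans (elComp_assoc _ _ _).symm
    rw [← wl_revTensor] at h
    exact h

end Interchange

section Kappa

variable {V : Type u} [Category.{v} V] [MonoidalCategory V] [SymmetricCategory V]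
  [MonoidalClosed V]

namespace Interchange

section

variable {A : Type u₁} [EnrichedCategory V A] {M N : MonoidalVCat V A} (D : Interchange M N)

/-- `B ⊗' (A ⊗ -) ⟶ A ⊗ (B ⊗' -)`. -/
def homNat (A' B : A) : VNat ((tl M.tensor A').comp V (tl N.tensor B))
    ((tl N.tensor B).comp V (tl M.tensor A')) :=
  GNat.ofEl (fun X => D.hom A' X B) (fun X X' =>
    (Category.assoc _ _ _).trans ((D.nat_middle A' X X' B).trans (Category.assoc _ _ _).symm))

/-- `A ⊗ (B ⊗' -) ⟶ B ⊗' (A ⊗ -)`. -/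
def invNat (A' B : A) : VNat ((tl N.tensor B).comp V (tl M.tensor A'))
    ((tl M.tensor A').comp V (tl N.tensor B)) :=
  GNat.ofEl (fun X => D.inv A' X B) (fun X X' =>
    ePost_ePre_inv (D.inv_hom A' X B) (D.hom_inv A' X' B)
      ((Category.assoc _ _ _).trans ((D.nat_middle A' X X' B).trans (Category.assoc _ _ _).symm)))

end

variable [HasLimits V] {A : Type v} [EnrichedCategory V A] {M N : MonoidalVCat V A}
  (D : Interchange M N) (T : EnrichedFunctor V (TensorCat Aᵒᵖ A) V)

/-- The components of the distributive law: the projection at `(A, B)` is the projection at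
`(B, A)` followed by the interchange isomorphism. -/
def κApp (X Y : A) : (thetaFun N.tensor (thetaFun M.tensor T)).obj (pr X Y) ⟶
    (thetaFun M.tensor (thetaFun N.tensor T)).obj (pr X Y) :=
  thLift₂ (fun A' B => (thπ N.tensor (thetaFun M.tensor T) X Y B ≫
      thπ M.tensor T (N.tensor.obj ⟨B, X⟩) (N.tensor.obj ⟨B, Y⟩) A') ≫
      mapLR T (D.hom A' X B) (D.inv A' Y B))
    (fun A' B B' => by
      have h := thπ_wedge (t := N.tensor) (T := thetaFun M.tensor T) X Y B B' =≫
        thπ M.tensor T (N.tensor.obj ⟨B, X⟩) (N.tensor.obj ⟨B', Y⟩) A'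
      rw [Category.assoc, Category.assoc, thπ_actR, thπ_actL, ← comp_whiskerRight_assoc,
        ← comp_whiskerRight_assoc] at h
      refine actR_actL_mapLR T h ?_ ?_
      · exact ePost_ePre_inv (D.inv_hom A' Y B) (D.hom_inv A' Y B')
          ((D.nat_right A' Y B B').trans (Category.assoc _ _ _).symm)
      · exact (D.nat_right A' X B B').trans (Category.assoc _ _ _).symm)
    (fun B A₁ A₂ => by
      have h := thπ N.tensor (thetaFun M.tensor T) X Y B ▷ _ ≫=
        thπ_wedge (t := M.tensor) (T := T) (N.tensor.obj ⟨B, X⟩) (N.tensor.obj ⟨B, Y⟩) A₁ A₂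
      rw [← comp_whiskerRight_assoc, ← comp_whiskerRight_assoc] at h
      refine actR_actL_mapLR T h ?_ ?_
      · exact ePost_ePre_inv (D.inv_hom A₁ Y B) (D.hom_inv A₂ Y B)
          ((Category.assoc _ _ _).trans (D.nat_left A₁ A₂ Y B))
      · exact (Category.assoc _ _ _).trans (D.nat_left A₁ A₂ X B))

lemma κApp_π (X Y A' B : A) :
    D.κApp T X Y ≫ thπ M.tensor (thetaFun N.tensor T) X Y A' ≫
      thπ N.tensor T (M.tensor.obj ⟨A', X⟩) (M.tensor.obj ⟨A', Y⟩) B =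
    thπ N.tensor (thetaFun M.tensor T) X Y B ≫
      thπ M.tensor T (N.tensor.obj ⟨B, X⟩) (N.tensor.obj ⟨B, Y⟩) A' ≫
      mapLR T (D.hom A' X B) (D.inv A' Y B) := by
  rw [← Category.assoc (thπ N.tensor _ _ _ _)]
  exact thLift₂_π _ _ _ A' B

lemma κApp_π_assoc (X Y A' B : A) {U : V}
    (h : T.obj (pr (N.tensor.obj ⟨B, M.tensor.obj ⟨A', X⟩⟩)
      (N.tensor.obj ⟨B, M.tensor.obj ⟨A', Y⟩⟩)) ⟶ U) :
    D.κApp T X Y ≫ thπ M.tensor (thetaFun N.tensor T) X Y A' ≫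
      thπ N.tensor T (M.tensor.obj ⟨A', X⟩) (M.tensor.obj ⟨A', Y⟩) B ≫ h =
    thπ N.tensor (thetaFun M.tensor T) X Y B ≫
      thπ M.tensor T (N.tensor.obj ⟨B, X⟩) (N.tensor.obj ⟨B, Y⟩) A' ≫
      mapLR T (D.hom A' X B) (D.inv A' Y B) ≫ h := by
  have := D.κApp_π T X Y A' B =≫ h
  simpa only [Category.assoc] using this

/-- The distributive law at `T`. -/
def κEl : 𝟙_ V ⟶ natObj (thetaFun N.tensor (thetaFun M.tensor T))
    (thetaFun M.tensor (thetaFun N.tensor T)) :=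
  elNat (fun c => D.κApp T c.fst.unop c.snd) (by
    rintro ⟨⟨X⟩, Y⟩ ⟨⟨X'⟩, Y'⟩
    change act (thetaFun N.tensor (thetaFun M.tensor T)) (pr X Y) (pr X' Y') ≫ D.κApp T X' Y' =
      D.κApp T X Y ▷ _ ≫ act (thetaFun M.tensor (thetaFun N.tensor T)) (pr X Y) (pr X' Y')
    rw [act_eq_actOn, act_eq_actOn]
    apply th_ext₂; intro A' B
    rw [Category.assoc, κApp_π, thπ_act2_assoc, Category.assoc, thπ_thπ_actOn,
      ← comp_whiskerRight_assoc, κApp_π, ← Category.assoc (act2On _ _ _ _ _), act2On_thπ,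
      comp_whiskerRight, comp_whiskerRight, Category.assoc, Category.assoc, Category.assoc]
    exact _ ≫= _ ≫= mapLR_naturality T (D.homNat A' B) (D.invNat A' B)
      (𝟙 (pr X Y ⟶ᵥ pr X' Y')))

@[simp]
lemma nEl_κEl (X Y : A) : nEl (D.κEl T) (pr X Y) = D.κApp T X Y :=
  nEl_elNat _ _ _

/-- The distributive law `∫_B ∫_A T(A ⊗ (B ⊗' X), A ⊗ (B ⊗' Y)) ⟶
∫_A ∫_B T(B ⊗' (A ⊗ X), B ⊗' (A ⊗ Y))`. -/
def distribLaw : DistribLaw M.thetaComonad N.thetaComonad where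
  κ := GNat.ofNev (fun T => D.κEl T) (by
    rintro T T' ⟨⟨X⟩, Y⟩
    change nev (thetaMap M.tensor T T' ≫ thetaMap N.tensor _ _) (pr X Y) ≫
        nEl (D.κEl T') (pr X Y) =
      nEl (D.κEl T) (pr X Y) ▷ natObj T T' ≫
        nev (thetaMap N.tensor T T' ≫ thetaMap M.tensor _ _) (pr X Y)
    rw [← Category.id_comp (thetaMap M.tensor T T'), ← Category.id_comp (thetaMap N.tensor T T'),
      nEl_κEl, nEl_κEl]
    apply th_ext₂; intro A' B
    have e := congrArg (· ▷ natObj T T') (D.κApp_π T X Y A' B)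
    simp only [comp_whiskerRight] at e
    rw [Category.assoc, κApp_π, thetaMap_nev_assoc, thetaMap_nev_assoc, Category.assoc,
      thetaMap_nev_assoc, thetaMap_nev, reassoc_of% e, nev_mapLR])
  counit_left T := by
    apply nEl_ext
    rintro ⟨⟨X⟩, Y⟩
    refine (nEl_elComp _ _ (pr X Y)).trans ?_
    change nEl (D.κEl T) (pr X Y) ≫ nEl (M.thetaε (thetaFun N.tensor T)) (pr X Y) =
      nEl (M.thetaε T ≫ thetaMap N.tensor _ _) (pr X Y)
    rw [nEl_κEl, MonoidalVCat.nEl_thetaε]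
    apply th_ext; intro B
    rw [thetaMap_nEl, MonoidalVCat.nEl_thetaε, Category.assoc, Category.assoc, thπ_mapLR, κApp_π_assoc,
      mapLR_mapLR, D.unit_left, D.unit_left_inv]
  counit_right T := by
    apply nEl_ext
    rintro ⟨⟨X⟩, Y⟩
    refine (nEl_elComp _ _ (pr X Y)).trans ?_
    change nEl (D.κEl T) (pr X Y) ≫ nEl (N.thetaε T ≫ thetaMap M.tensor _ _) (pr X Y) =
      nEl (N.thetaε (thetaFun M.tensor T)) (pr X Y)
    rw [nEl_κEl, MonoidalVCat.nEl_thetaε]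
    apply th_ext; intro A'
    rw [Category.assoc, thetaMap_nEl, MonoidalVCat.nEl_thetaε, κApp_π_assoc, mapLR_mapLR, D.unit_right,
      D.unit_right_inv, Category.assoc, thπ_mapLR]
  comul_left T := by
    apply nEl_ext
    rintro ⟨⟨X⟩, Y⟩
    refine (nEl_elComp _ _ (pr X Y)).trans (Eq.trans ?_ ((nEl_elComp _ _ (pr X Y)).trans
      (_ ≫= nEl_elComp _ _ (pr X Y))).symm)
    change nEl (D.κEl T) (pr X Y) ≫ nEl (M.thetaδ (thetaFun N.tensor T)) (pr X Y) =
      nEl (M.thetaδ T ≫ thetaMap N.tensor _ _) (pr X Y) ≫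
        nEl (D.κEl (thetaFun M.tensor T)) (pr X Y) ≫
        nEl (D.κEl T ≫ thetaMap M.tensor _ _) (pr X Y)
    rw [nEl_κEl, nEl_κEl, MonoidalVCat.nEl_thetaδ]
    apply th_ext₂; intro A₁ A₂
    apply th_ext; intro B
    simp only [Category.assoc]
    rw [MonoidalVCat.thetaδApp_π_assoc, thπ_mapLR, κApp_π_assoc, mapLR_mapLR, thetaMap_nEl_assoc, nEl_κEl,
      κApp_π, κApp_π_assoc, thetaMap_nEl_assoc, MonoidalVCat.nEl_thetaδ, thπ_mapLR_assoc, MonoidalVCat.thetaδApp_π_assoc,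
      mapLR_mapLR, mapLR_mapLR, D.assoc_left, D.assoc_left_inv]
  comul_right T := by
    apply nEl_ext
    rintro ⟨⟨X⟩, Y⟩
    refine (nEl_elComp _ _ (pr X Y)).trans (Eq.trans ?_ ((nEl_elComp _ _ (pr X Y)).trans
      (_ ≫= nEl_elComp _ _ (pr X Y))).symm)
    change nEl (D.κEl T) (pr X Y) ≫ nEl (N.thetaδ T ≫ thetaMap M.tensor _ _) (pr X Y) =
      nEl (N.thetaδ (thetaFun M.tensor T)) (pr X Y) ≫
        nEl (D.κEl T ≫ thetaMap N.tensor _ _) (pr X Y) ≫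
        nEl (D.κEl (thetaFun N.tensor T)) (pr X Y)
    rw [nEl_κEl, nEl_κEl, MonoidalVCat.nEl_thetaδ]
    apply th_ext₂; intro A' B₁
    apply th_ext; intro B₂
    simp only [Category.assoc]
    rw [thetaMap_nEl_assoc, MonoidalVCat.nEl_thetaδ, MonoidalVCat.thetaδApp_π, κApp_π_assoc, mapLR_mapLR, κApp_π_assoc,
      thetaMap_nEl_assoc, nEl_κEl, thπ_mapLR, κApp_π_assoc, MonoidalVCat.thetaδApp_π_assoc, thπ_mapLR_assoc,
      mapLR_mapLR, mapLR_mapLR, D.assoc_right, D.assoc_right_inv]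

end Interchange

end Kappa

section Tambara

variable {V : Type u} [Category.{v} V] [MonoidalCategory V] [SymmetricCategory V]
  [MonoidalClosed V]

/-- A left Tambara module structure on a `V`-functor `T : Aᵒᵖ ⊗ A ⟶ V`: morphisms
`α B X Y : T(X, Y) ⟶ T(B ⊗ X, B ⊗ Y)` which are `V`-natural in `X`, in `Y` and
(extraordinarily) in `B`, such that `α I` is the identity and `α (B ⊗ B')` is `α B'` followed by
`α B`, up to the structure isomorphisms of `A`. -/
structure LeftTambara {A : Type u₁} [EnrichedCategory V A] (M : MonoidalVCat V A)
    (T : EnrichedFunctor V (TensorCat Aᵒᵖ A) V) where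
  α : ∀ B X Y : A, T.obj (pr X Y) ⟶ T.obj (pr (M.tensor.obj ⟨B, X⟩) (M.tensor.obj ⟨B, Y⟩))
  natural_left : ∀ B X X' Y : A,
    actL T Y (𝟙 (X' ⟶ᵥ X)) ≫ α B X' Y =
      α B X Y ▷ _ ≫ actL T (M.tensor.obj ⟨B, Y⟩) (wl M.tensor B X' X)
  natural_right : ∀ B X Y Y' : A,
    actR T X (𝟙 (Y ⟶ᵥ Y')) ≫ α B X Y' =
      α B X Y ▷ _ ≫ actR T (M.tensor.obj ⟨B, X⟩) (wl M.tensor B Y Y')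
  extranatural : ∀ X Y B B' : A,
    α B X Y ▷ _ ≫ actR T (M.tensor.obj ⟨B, X⟩) (wr M.tensor Y B B') =
      α B' X Y ▷ _ ≫ actL T (M.tensor.obj ⟨B', Y⟩) (wr M.tensor X B B')
  unit : ∀ X Y : A, α M.unit X Y ≫ mapLR T (M.leftUnitInv X) (M.leftUnitHom Y) = 𝟙 _
  assoc : ∀ B B' X Y : A,
    α (M.tensor.obj ⟨B, B'⟩) X Y ≫ mapLR T (M.assocInv B B' X) (M.assocHom B B' Y) =
      α B' X Y ≫ α B (M.tensor.obj ⟨B', X⟩) (M.tensor.obj ⟨B', Y⟩)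

/-- A right Tambara module structure `T(X, Y) ⟶ T(X ⊗ B, Y ⊗ B)` is a left one for the reverse
tensor product. -/
abbrev RightTambara {A : Type u₁} [EnrichedCategory V A] (M : MonoidalVCat V A)
    (T : EnrichedFunctor V (TensorCat Aᵒᵖ A) V) := LeftTambara M.rev T

/-- Left Tambara modules on `A`. -/
structure LTamb {A : Type u₁} [EnrichedCategory V A] (M : MonoidalVCat V A) where
  T : EnrichedFunctor V (TensorCat Aᵒᵖ A) V
  left : LeftTambara M T

/-- Right Tambara modules on `A`. -/
structure RTamb {A : Type u₁} [EnrichedCategory V A] (M : MonoidalVCat V A) where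
  T : EnrichedFunctor V (TensorCat Aᵒᵖ A) V
  right : RightTambara M T

/-- Tambara modules on `A`: compatible left and right Tambara module structures on `T`. Here
`M.interchange` is the associativity isomorphism `(B ⊗ X) ⊗ B' ≅ B ⊗ (X ⊗ B')`. -/
structure Tamb {A : Type u₁} [EnrichedCategory V A] (M : MonoidalVCat V A) where
  T : EnrichedFunctor V (TensorCat Aᵒᵖ A) V
  left : LeftTambara M T
  right : RightTambara M T
  compat : ∀ B B' X Y : A,
    left.α B X Y ≫ right.α B' (M.tensor.obj ⟨B, X⟩) (M.tensor.obj ⟨B, Y⟩) =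
      right.α B' X Y ≫ left.α B (M.rev.tensor.obj ⟨B', X⟩) (M.rev.tensor.obj ⟨B', Y⟩) ≫
        mapLR T (M.interchange.hom B X B') (M.interchange.inv B Y B')

variable [HasLimits V]

/-- For `V`-functors `F x : C ⟶ V` equipped with families of morphisms
`α x i : F x (s i) ⟶ F x (t i)`, the `V`-category with
`hom(x, y)` the intersection over `i` of the equalizers of
`V(α x i, 1) ∘ pr_{t i}, V(1, α y i) ∘ pr_{s i} : [C, V](F x, F y) ⟶ V(F x (s i), F y (t i))`. -/
def familyCut {C : Type v} [EnrichedCategory V C] {O : Type u₁} (F : O → EnrichedFunctor V C V)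
    {ι : Type v} (s t : ι → C) (α : ∀ x i, (F x).obj (s i) ⟶ (F x).obj (t i)) :
    HomCut (V := V) (EnrichedFunctor V C V) O where
  obj := F
  I _ _ := ι
  Z x y i := (F x).obj (s i) ⟶ᵥ (F y).obj (t i)
  f x y i := natπ (F x) (F y) (t i) ≫ ePre (elV (α x i)) ((F y).obj (t i))
  g x y i := natπ (F x) (F y) (s i) ≫ ePost ((F x).obj (s i)) (elV (α y i))
  id_mem x i := by
    rw [← Category.assoc, ← Category.assoc, functorCategory_eId_π, functorCategory_eId_π,
      ← elComp_eq_ePre, ← elComp_eq_ePost, elComp_eId, eId_elComp]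
  comp_mem := by
    intro x y z W U h k hh hk i
    have hh := hh i
    have hk := hk i
    have e : ∀ c, ((h ⊗ₘ k) ≫ eComp V (F x) (F y) (F z)) ≫ natπ (F x) (F z) c =
        (h ≫ natπ (F x) (F y) c ⊗ₘ k ≫ natπ (F y) (F z) c) ≫ eComp V _ _ _ := fun c => by
      rw [Category.assoc, functorCategory_eComp_π, tensorHom_comp_tensorHom_assoc]
    rw [← Category.assoc, ← Category.assoc, e, e, comp_ePre_comp, comp_comp_ePost, Category.assoc,
      Category.assoc]
    refine (congrArg (fun a => (a ⊗ₘ _) ≫ eComp V _ _ _) hh).trans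
      (Eq.trans ?_ (congrArg (fun a => (_ ⊗ₘ a) ≫ eComp V _ _ _) hk))
    rw [← Category.assoc h, ← comp_ePre_ePost, Category.assoc k]

variable {A : Type v} [EnrichedCategory V A] (M : MonoidalVCat V A)

namespace LTamb

/-- `LTamb(A)(T, T')` is the intersection over all `B, X, Y` of the equalizers of
`V(α, 1) ∘ pr_{B ⊗ X, B ⊗ Y}, V(1, α') ∘ pr_{X, Y} :
[Aᵒᵖ ⊗ A, V](T, T') ⟶ V(T(X, Y), T'(B ⊗ X, B ⊗ Y))`. -/
def cut : HomCut (V := V) (EnrichedFunctor V (TensorCat Aᵒᵖ A) V) (LTamb M) :=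
  familyCut (fun x => x.T) (ι := A × A × A) (fun i => pr i.2.1 i.2.2)
    (fun i => pr (M.tensor.obj ⟨i.1, i.2.1⟩) (M.tensor.obj ⟨i.1, i.2.2⟩))
    (fun x i => x.left.α i.1 i.2.1 i.2.2)

/-- The `V`-category of left Tambara modules. -/
instance : EnrichedCategory V (LTamb M) := (cut M).enrichedCategory

/-- The forgetful `V`-functor. -/
def forget : EnrichedFunctor V (LTamb M) (EnrichedFunctor V (TensorCat Aᵒᵖ A) V) :=
  (cut M).forget

end LTamb

namespace RTamb

/-- The analogue of `LTamb.cut` for right Tambara modules. -/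
def cut : HomCut (V := V) (EnrichedFunctor V (TensorCat Aᵒᵖ A) V) (RTamb M) :=
  familyCut (fun x => x.T) (ι := A × A × A) (fun i => pr i.2.1 i.2.2)
    (fun i => pr (M.rev.tensor.obj ⟨i.1, i.2.1⟩) (M.rev.tensor.obj ⟨i.1, i.2.2⟩))
    (fun x i => x.right.α i.1 i.2.1 i.2.2)

/-- The `V`-category of right Tambara modules. -/
instance : EnrichedCategory V (RTamb M) := (cut M).enrichedCategory

/-- The forgetful `V`-functor. -/
def forget : EnrichedFunctor V (RTamb M) (EnrichedFunctor V (TensorCat Aᵒᵖ A) V) :=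
  (cut M).forget

end RTamb

namespace Tamb

/-- The intersection of the equalizers for the left and for the right Tambara module
structures. -/
def cut : HomCut (V := V) (EnrichedFunctor V (TensorCat Aᵒᵖ A) V) (Tamb M) :=
  familyCut (fun x => x.T) (ι := (A × A × A) ⊕ (A × A × A))
    (Sum.elim (fun i => pr i.2.1 i.2.2) (fun i => pr i.2.1 i.2.2))
    (Sum.elim (fun i => pr (M.tensor.obj ⟨i.1, i.2.1⟩) (M.tensor.obj ⟨i.1, i.2.2⟩))
      (fun i => pr (M.rev.tensor.obj ⟨i.1, i.2.1⟩) (M.rev.tensor.obj ⟨i.1, i.2.2⟩)))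
    (fun x i => match i with
      | Sum.inl i => x.left.α i.1 i.2.1 i.2.2
      | Sum.inr i => x.right.α i.1 i.2.1 i.2.2)

/-- The `V`-category of Tambara modules. -/
instance : EnrichedCategory V (Tamb M) := (cut M).enrichedCategory

/-- The forgetful `V`-functor. -/
def forget : EnrichedFunctor V (Tamb M) (EnrichedFunctor V (TensorCat Aᵒᵖ A) V) :=
  (cut M).forget

end Tamb

namespace MonoidalVCat

/-- The comonad `(Θₗ T)(X, Y) = ∫_B T(B ⊗ X, B ⊗ Y)`. -/
abbrev thetaL : VComonad (V := V) (EnrichedFunctor V (TensorCat Aᵒᵖ A) V) := M.thetaComonad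

/-- The comonad `(Θᵣ T)(X, Y) = ∫_B T(X ⊗ B, Y ⊗ B)`. -/
abbrev thetaR : VComonad (V := V) (EnrichedFunctor V (TensorCat Aᵒᵖ A) V) := M.rev.thetaComonad

/-- The composite comonad `Θ = Θᵣ Θₗ`,
`(Θ T)(X, Y) = ∫_B' ∫_B T(B ⊗ (X ⊗ B'), B ⊗ (Y ⊗ B'))`, for the distributive law
`Θᵣ Θₗ ⟶ Θₗ Θᵣ` given by interchange of ends and the associativity isomorphism. -/
abbrev thetaLR : VComonad (V := V) (EnrichedFunctor V (TensorCat Aᵒᵖ A) V) :=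
  M.interchange.distribLaw.comonad

end MonoidalVCat

end Tambara

end VTamb

end

attribute [local instance] MonoidalClosed.enrichedCategorySelf

/-!
A coaction `γ : T ⟶ Θₗ T` amounts, by the universal property of the end
`(Θₗ T)(X, Y) = ∫_B T(B ⊗ X, B ⊗ Y)`, to a family `α B X Y : T(X, Y) ⟶ T(B ⊗ X, B ⊗ Y)`
(`coactionα`). The wedge condition is extranaturality in `B`, naturality of `γ` is naturality in
`X` and in `Y` (`act_naturality_of_separate`), and the counit and coassociativity laws, read off
after the projections of `Θₗ T` and `Θₗ Θₗ T`, are the unit and associativity laws of a left Tambara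
module (`LeftTambara.ofCoaction`, `LeftTambara.coaction`). In the same way a generalised element of
`[Aᵒᵖ ⊗ A, V](T, T')` commutes with two coactions exactly when it commutes with the corresponding
families (`commutes_coaction_iff`), so both hom-objects are cut out of `[Aᵒᵖ ⊗ A, V](T, T')` by the
same generalised elements. The case of right Tambara modules is that of left ones for the reverse
monoidal structure.

For `Θ = Θᵣ Θₗ`, let `κ : H G ⟶ G H` be any distributive law of `V`-comonads. A coaction `γ` of `H G`
has two parts `g = γ ; ε_H` and `h = γ ; H ε_G`, coactions of `G` and of `H` satisfying
`g ; G h = h ; H g ; κ` (`DistribLaw.Compat`), and `γ = h ; H g`; conversely `h ; H g` is a coaction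
for any such pair. For the distributive law of `Θᵣ` and `Θₗ`, the compatibility condition is that of
Tambara modules (`Interchange.compat_iff`).

In each case there are `V`-functors in both directions over `[Aᵒᵖ ⊗ A, V]`, inverse on objects. The
forgetful `V`-functors are monic on homs, so that they are inverse to each other
(`exists_vCatIso_over`).
-/

noncomputable section

namespace VTamb

/-! ### Isomorphisms of `V`-categories over a base -/

section OverBase

variable {V : Type u} [Category.{v} V] [MonoidalCategory V] [SymmetricCategory V]
  {C : Type u₁} [EnrichedCategory V C] {D : Type u₂} [EnrichedCategory V D]
  {M : Type u₃} [EnrichedCategory V M]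

/-- A `V`-functor is determined by its object map and its composite with a `V`-functor that is
monic on homs. -/
lemma enrichedFunctor_eq_of_comp_eq {F G : EnrichedFunctor V C D} (U : EnrichedFunctor V D M)
    [∀ x y, Mono (U.map x y)] (h_obj : ∀ x, F.obj x = G.obj x)
    (h : F.comp V U = G.comp V U) : F = G := by
  obtain ⟨Fo, Fm, _, _⟩ := F
  obtain ⟨Go, Gm, _, _⟩ := G
  obtain rfl : Fo = Go := funext h_obj
  have e : (fun x y => Fm x y ≫ U.map _ _) = fun x y => Gm x y ≫ U.map _ _ :=
    eq_of_heq (EnrichedFunctor.mk.inj h).2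
  obtain rfl : Fm = Gm := by
    funext x y
    exact (cancel_mono (U.map _ _)).1 (congrFun (congrFun e x) y)
  rfl

lemma comp_comp_eq_id_comp {F : EnrichedFunctor V C D} {G : EnrichedFunctor V D C}
    {U : EnrichedFunctor V C M} {U' : EnrichedFunctor V D M} (hF : F.comp V U' = U)
    (hG : G.comp V U = U') : (F.comp V G).comp V U = (EnrichedFunctor.id V C).comp V U := by
  have e : (F.comp V G).comp V U = F.comp V (G.comp V U) := by
    simp only [EnrichedFunctor.comp, Category.assoc]
  have e' : (EnrichedFunctor.id V C).comp V U = U := by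
    simp only [EnrichedFunctor.comp, EnrichedFunctor.id, Category.id_comp]
  rw [e, e', hG, hF]

/-- `V`-functors in both directions over a common base, bijective on objects, are mutually inverse
when the functors to the base are monic on homs. -/
lemma exists_vCatIso_over {U : EnrichedFunctor V C M} {U' : EnrichedFunctor V D M}
    (hU : ∀ x y, Mono (U.map x y)) (hU' : ∀ x y, Mono (U'.map x y)) (F : EnrichedFunctor V C D)
    (G : EnrichedFunctor V D C) (hF : F.comp V U' = U) (hG : G.comp V U = U')
    (hFG : ∀ x, G.obj (F.obj x) = x) (hGF : ∀ y, F.obj (G.obj y) = y) :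
    ∃ K : VCatIso (V := V) C D, K.hom.comp V U' = U :=
  ⟨⟨F, G, enrichedFunctor_eq_of_comp_eq U hFG (comp_comp_eq_id_comp hF hG),
    enrichedFunctor_eq_of_comp_eq U' hGF (comp_comp_eq_id_comp hG hF)⟩, hF⟩

namespace HomCut

variable [HasLimits V] {O : Type u₂} (K : HomCut (V := V) M O)

/-- The lift along `K.forget` of a `V`-functor to `M`. The latter is given by its action on homs,
its object map being that of `K.forget` after `F`, so that no equality of objects of `M` has to be
transported along. -/
def liftFunctor (F : C → O) (m : ∀ x y, (x ⟶ᵥ y : V) ⟶ (K.obj (F x) ⟶ᵥ K.obj (F y)))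
    (m_id : ∀ x, eId V x ≫ m x x = eId V (K.obj (F x)))
    (m_comp : ∀ x y z, eComp V x y z ≫ m x z =
      (m x y ⊗ₘ m y z) ≫ eComp V (K.obj (F x)) (K.obj (F y)) (K.obj (F z)))
    (mem : ∀ x y i, m x y ≫ K.f (F x) (F y) i = m x y ≫ K.g (F x) (F y) i) :
    letI := K.enrichedCategory; EnrichedFunctor V C O :=
  letI := K.enrichedCategory
  { obj := F
    map := fun x y => K.lift (m x y) (mem x y)
    map_id := fun x => by
      rw [← cancel_mono (K.ι _ _), Category.assoc, lift_ι, m_id]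
      exact (K.lift_ι _ (K.id_mem (F x))).symm
    map_comp := fun x y z => by
      rw [← cancel_mono (K.ι _ _), Category.assoc, lift_ι, m_comp]
      refine Eq.trans ?_ ((Category.assoc _ _ _).trans (_ ≫= K.lift_ι _
        (K.comp_mem _ _ (K.condition (F x) (F y)) (K.condition (F y) (F z))))).symm
      rw [tensorHom_comp_tensorHom_assoc, lift_ι, lift_ι] }

lemma liftFunctor_comp_forget (F : C → O)
    (m : ∀ x y, (x ⟶ᵥ y : V) ⟶ (K.obj (F x) ⟶ᵥ K.obj (F y))) (m_id m_comp mem) :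
    letI := K.enrichedCategory
    (K.liftFunctor F m m_id m_comp mem).comp V K.forget =
      { obj := fun x => K.obj (F x), map := m, map_id := m_id, map_comp := m_comp } := by
  let := K.enrichedCategory
  have e : (fun x y => K.lift (m x y) (mem x y) ≫ K.ι (F x) (F y)) = m := by
    funext x y
    exact K.lift_ι _ _
  simp only [liftFunctor, EnrichedFunctor.comp, forget]
  congr

end HomCut

end OverBase

/-! ### Coalgebras for a composite comonad -/

section CompositeCoalgebras

variable {V : Type u} [Category.{v} V] [MonoidalCategory V] [SymmetricCategory V]
  [MonoidalClosed V] {M : Type u₁} [EnrichedCategory V M]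

/-- The laws making `γ : x ⟶ G x` a coaction of the comonad `G`. -/
structure VComonad.IsCoaction (G : VComonad (V := V) M) {x : M}
    (γ : 𝟙_ V ⟶ (x ⟶ᵥ G.toFunctor.obj x)) : Prop where
  counit : elComp γ (G.ε.app x) = eId V x
  coassoc : elComp γ (G.δ.app x) = elComp γ (fEl G.toFunctor γ)

lemma VComonad.Coalgebra.isCoaction {G : VComonad (V := V) M} (x : G.Coalgebra) :
    G.IsCoaction x.coact := ⟨x.counit, x.coassoc⟩

lemma VComonad.ε_el (G : VComonad (V := V) M) {x y : M} (f : 𝟙_ V ⟶ (x ⟶ᵥ y)) :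
    elComp (fEl G.toFunctor f) (G.ε.app y) = elComp (G.ε.app x) f := by
  have h := VNat.el G.ε f
  have e : fEl (EnrichedFunctor.id V M) f = f := Category.comp_id _
  rw [e] at h
  exact h

namespace DistribLaw

-- The computations are carried out for families of elements `eG`, `eH`, `dG`, `dH`, `k` with
-- values in iterates of `G.obj` and `H.obj`: the components of `ε`, `δ` and `κ` have these types
-- only after unfolding composite functors, which rewriting does not do.
section Aux

variable {G H : EnrichedFunctor V M M}
  {eG : ∀ x, 𝟙_ V ⟶ (G.obj x ⟶ᵥ x)} {eH : ∀ x, 𝟙_ V ⟶ (H.obj x ⟶ᵥ x)}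
  {dG : ∀ x, 𝟙_ V ⟶ (G.obj x ⟶ᵥ G.obj (G.obj x))}
  {dH : ∀ x, 𝟙_ V ⟶ (H.obj x ⟶ᵥ H.obj (H.obj x))}
  {k : ∀ x, 𝟙_ V ⟶ (H.obj (G.obj x) ⟶ᵥ G.obj (H.obj x))}

/-- The part `δ ; ε_H` of the comultiplication of `H G`. -/
lemma comul_counit_aux
    (nH : ∀ {x y : M} (f : 𝟙_ V ⟶ (x ⟶ᵥ y)), elComp (fEl H f) (eH y) = elComp (eH x) f)
    (uH : ∀ x, elComp (dH x) (eH (H.obj x)) = eId V _) (x : M) :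
    elComp (elComp (fEl H (dG x)) (elComp (dH (G.obj (G.obj x))) (fEl H (k (G.obj x)))))
      (eH _) = elComp (fEl H (dG x)) (k (G.obj x)) := by
  rw [elComp_assoc, elComp_assoc, nH, el_reassoc' (uH _), eId_elComp]

/-- The part `δ ; H ε_G` of the comultiplication of `H G`. -/
lemma comul_map_counit_aux
    (ndH : ∀ {x y : M} (f : 𝟙_ V ⟶ (x ⟶ᵥ y)),
      elComp (fEl H f) (dH y) = elComp (dH x) (fEl H (fEl H f)))
    (uG : ∀ x, elComp (dG x) (eG (G.obj x)) = eId V _)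
    (ku : ∀ x, elComp (k x) (eG (H.obj x)) = fEl H (eG x)) (x : M) :
    elComp (elComp (fEl H (dG x)) (elComp (dH (G.obj (G.obj x))) (fEl H (k (G.obj x)))))
      (fEl H (eG (H.obj (G.obj x)))) = dH (G.obj x) := by
  rw [elComp_assoc, elComp_assoc, ← fEl_elComp, ku, ← ndH, el_reassoc' (fEl_elComp _ _ _).symm,
    uG, fEl_eId, eId_elComp]

section

variable {x : M} {γ : 𝟙_ V ⟶ (x ⟶ᵥ H.obj (G.obj x))}
  {D : 𝟙_ V ⟶ (H.obj (G.obj x) ⟶ᵥ H.obj (G.obj (H.obj (G.obj x))))}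

/-- The part `γ ; ε_H` of a coaction `γ` of `H G` is a coassociative `G`-coaction. -/
lemma coaction_left_aux
    (neH : ∀ {x y : M} (f : 𝟙_ V ⟶ (x ⟶ᵥ y)), elComp (fEl H f) (eH y) = elComp (eH x) f)
    (kH : ∀ x, elComp (k x) (fEl G (eH x)) = eH (G.obj x))
    (hD : elComp D (eH _) = elComp (fEl H (dG x)) (k (G.obj x)))
    (hγ : elComp γ D = elComp γ (fEl H (fEl G γ))) :
    elComp (elComp γ (eH (G.obj x))) (dG x) =
      elComp (elComp γ (eH (G.obj x))) (fEl G (elComp γ (eH (G.obj x)))) := by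
  rw [elComp_assoc, elComp_assoc, fEl_elComp, ← el_reassoc (neH (fEl G γ)), ← el_reassoc hγ,
    el_reassoc hD, kH, neH]

/-- The part `γ ; H ε_G` of a coaction `γ` of `H G` is a coassociative `H`-coaction. -/
lemma coaction_right_aux
    (neG : ∀ {x y : M} (f : 𝟙_ V ⟶ (x ⟶ᵥ y)), elComp (fEl G f) (eG y) = elComp (eG x) f)
    (ndH : ∀ {x y : M} (f : 𝟙_ V ⟶ (x ⟶ᵥ y)),
      elComp (fEl H f) (dH y) = elComp (dH x) (fEl H (fEl H f)))
    (hD : elComp D (fEl H (eG _)) = dH (G.obj x))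
    (hγ : elComp γ D = elComp γ (fEl H (fEl G γ))) :
    elComp (elComp γ (fEl H (eG x))) (dH x) =
      elComp (elComp γ (fEl H (eG x))) (fEl H (elComp γ (fEl H (eG x)))) := by
  rw [elComp_assoc, elComp_assoc, ndH, ← fEl_elComp H (eG x), ← elComp_assoc (eG x), ← neG,
    elComp_assoc, fEl_elComp H (fEl G γ), ← el_reassoc hγ, fEl_elComp H (eG _), el_reassoc' hD]

/-- Both sides of the compatibility condition for the two parts of `γ` equal `γ ; κ`. -/
lemma coaction_compat_aux
    (neH : ∀ {x y : M} (f : 𝟙_ V ⟶ (x ⟶ᵥ y)), elComp (fEl H f) (eH y) = elComp (eH x) f)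
    (nk : ∀ {x y : M} (f : 𝟙_ V ⟶ (x ⟶ᵥ y)),
      elComp (fEl H (fEl G f)) (k y) = elComp (k x) (fEl G (fEl H f)))
    (uG : ∀ x, elComp (dG x) (fEl G (eG x)) = eId V _)
    (hD : elComp D (eH _) = elComp (fEl H (dG x)) (k (G.obj x)))
    (hγ : elComp γ D = elComp γ (fEl H (fEl G γ))) :
    elComp (elComp γ (eH (G.obj x))) (fEl G (elComp γ (fEl H (eG x)))) = elComp γ (k x) := by
  rw [elComp_assoc, fEl_elComp, ← el_reassoc (neH (fEl G γ)), ← el_reassoc hγ,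
    el_reassoc hD, ← nk, el_reassoc' (fEl_elComp _ _ _).symm, uG, fEl_eId, eId_elComp]

/-- A coaction `γ` of `H G` is recovered from its two parts: coassociativity turns the composite
into `γ ; δ ; H ε_G ; H ε_H`, which is `γ` by the counit law of `H`. -/
lemma coaction_recover_aux
    (neG : ∀ {x y : M} (f : 𝟙_ V ⟶ (x ⟶ᵥ y)), elComp (fEl G f) (eG y) = elComp (eG x) f)
    (uH : ∀ x, elComp (dH x) (fEl H (eH x)) = eId V _)
    (hD : elComp D (fEl H (eG _)) = dH (G.obj x))
    (hγ : elComp γ D = elComp γ (fEl H (fEl G γ))) :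
    elComp (elComp γ (fEl H (eG x))) (fEl H (elComp γ (eH (G.obj x)))) = γ := by
  rw [elComp_assoc, ← fEl_elComp, ← elComp_assoc (eG x), ← neG, elComp_assoc, fEl_elComp,
    ← el_reassoc hγ, fEl_elComp, el_reassoc' hD, uH, elComp_eId]

/-- Compatible coactions `g` and `h` compose to a coassociative coaction `h ; H g` of `H G`. -/
lemma coassoc_of_compat_aux
    (ndH : ∀ {x y : M} (f : 𝟙_ V ⟶ (x ⟶ᵥ y)),
      elComp (fEl H f) (dH y) = elComp (dH x) (fEl H (fEl H f)))
    (nk : ∀ {x y : M} (f : 𝟙_ V ⟶ (x ⟶ᵥ y)),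
      elComp (fEl H (fEl G f)) (k y) = elComp (k x) (fEl G (fEl H f)))
    {g : 𝟙_ V ⟶ (x ⟶ᵥ G.obj x)} {h : 𝟙_ V ⟶ (x ⟶ᵥ H.obj x)}
    (hg : elComp g (dG x) = elComp g (fEl G g)) (hh : elComp h (dH x) = elComp h (fEl H h))
    (c : elComp g (fEl G h) = elComp h (elComp (fEl H g) (k x))) :
    elComp (elComp h (fEl H g))
        (elComp (fEl H (dG x)) (elComp (dH (G.obj (G.obj x))) (fEl H (k (G.obj x))))) =
      elComp (elComp h (fEl H g)) (fEl H (fEl G (elComp h (fEl H g)))) := by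
  rw [elComp_assoc, elComp_assoc, el_reassoc' (fEl_elComp _ _ _).symm, hg,
    el_reassoc (ndH _), el_reassoc hh, ← fEl_elComp, ← fEl_elComp, ← fEl_elComp, fEl_elComp H g,
    fEl_elComp G h, el_reassoc c, elComp_assoc, elComp_assoc, ← nk, fEl_elComp]

end

end Aux

variable {G H : VComonad (V := V) M} (d : DistribLaw G H)

variable (G H) in
/-- The `G`-coaction underlying a coaction of the composite `H G`. -/
def leftPart {x : M} (γ : 𝟙_ V ⟶ (x ⟶ᵥ H.toFunctor.obj (G.toFunctor.obj x))) :
    𝟙_ V ⟶ (x ⟶ᵥ G.toFunctor.obj x) := elComp γ (H.ε.app (G.toFunctor.obj x))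

variable (G H) in
/-- The `H`-coaction underlying a coaction of the composite `H G`. -/
def rightPart {x : M} (γ : 𝟙_ V ⟶ (x ⟶ᵥ H.toFunctor.obj (G.toFunctor.obj x))) :
    𝟙_ V ⟶ (x ⟶ᵥ H.toFunctor.obj x) := elComp γ (fEl H.toFunctor (G.ε.app x))

/-- Compatibility of a `G`-coaction and an `H`-coaction with a distributive law `H G ⟶ G H`. -/
def Compat {x : M} (g : 𝟙_ V ⟶ (x ⟶ᵥ G.toFunctor.obj x))
    (h : 𝟙_ V ⟶ (x ⟶ᵥ H.toFunctor.obj x)) : Prop :=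
  elComp g (fEl G.toFunctor h) = elComp h (elComp (fEl H.toFunctor g) (d.κ.app x))

lemma compδ_ε (x : M) : elComp (d.compδ x) (H.ε.app _) =
    elComp (fEl H.toFunctor (G.δ.app x)) (d.κ.app (G.toFunctor.obj x)) :=
  comul_counit_aux (dG := G.δ.app) (dH := H.δ.app) (k := d.κ.app) (eH := H.ε.app)
    H.ε_el H.counit_left x

lemma compδ_map_ε (x : M) : elComp (d.compδ x) (fEl H.toFunctor (G.ε.app _)) =
    H.δ.app (G.toFunctor.obj x) :=
  comul_map_counit_aux (dG := G.δ.app) (dH := H.δ.app) (k := d.κ.app) (eG := G.ε.app)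
    (δ_el H) G.counit_left d.counit_left x

section

variable {d} {x : M} {γ : 𝟙_ V ⟶ (x ⟶ᵥ H.toFunctor.obj (G.toFunctor.obj x))}

lemma isCoaction_coassoc (hγ : d.comonad.IsCoaction γ) :
    elComp γ (d.compδ x) = elComp γ (fEl H.toFunctor (fEl G.toFunctor γ)) :=
  hγ.coassoc.trans (congrArg (elComp γ) (Category.assoc _ _ _).symm)

lemma isCoaction_counit (hγ : d.comonad.IsCoaction γ) :
    elComp γ (elComp (fEl H.toFunctor (G.ε.app x)) (H.ε.app x)) = eId V x :=
  hγ.counit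

lemma isCoaction_leftPart (hγ : d.comonad.IsCoaction γ) : G.IsCoaction (leftPart G H γ) where
  counit := (elComp_assoc _ _ _).trans
    ((congrArg (elComp γ) (H.ε_el (G.ε.app x)).symm).trans (isCoaction_counit hγ))
  coassoc := coaction_left_aux (dG := G.δ.app) (k := d.κ.app) (eH := H.ε.app) H.ε_el
    d.counit_right (d.compδ_ε x) (isCoaction_coassoc hγ)

lemma isCoaction_rightPart (hγ : d.comonad.IsCoaction γ) : H.IsCoaction (rightPart G H γ) where
  counit := (elComp_assoc _ _ _).trans (isCoaction_counit hγ)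
  coassoc := coaction_right_aux (dH := H.δ.app) (eG := G.ε.app) G.ε_el (δ_el H)
    (d.compδ_map_ε x) (isCoaction_coassoc hγ)

/-- A coaction of `H G` is recovered from its two parts. -/
lemma rightPart_leftPart (hγ : d.comonad.IsCoaction γ) :
    elComp (rightPart G H γ) (fEl H.toFunctor (leftPart G H γ)) = γ :=
  coaction_recover_aux (dH := H.δ.app) (eG := G.ε.app) (eH := H.ε.app) G.ε_el H.counit_right
    (d.compδ_map_ε x) (isCoaction_coassoc hγ)

lemma compat_parts (hγ : d.comonad.IsCoaction γ) :
    d.Compat (leftPart G H γ) (rightPart G H γ) :=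
  (coaction_compat_aux (dG := G.δ.app) (eG := G.ε.app) (eH := H.ε.app) (k := d.κ.app)
    H.ε_el d.κ_el G.counit_right (d.compδ_ε x) (isCoaction_coassoc hγ)).trans
    ((congrArg (fun a => elComp a (d.κ.app x)) (rightPart_leftPart hγ)).symm.trans
      (elComp_assoc _ _ _))

variable {g : 𝟙_ V ⟶ (x ⟶ᵥ G.toFunctor.obj x)} {h : 𝟙_ V ⟶ (x ⟶ᵥ H.toFunctor.obj x)}

lemma leftPart_comp (hh : H.IsCoaction h) :
    leftPart G H (elComp h (fEl H.toFunctor g)) = g := by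
  refine (elComp_assoc _ _ _).trans ((congrArg (elComp h) (H.ε_el g)).trans ?_)
  exact (el_reassoc' hh.counit g).trans (eId_elComp g)

lemma rightPart_comp (hg : G.IsCoaction g) :
    rightPart G H (elComp h (fEl H.toFunctor g)) = h := by
  have hg := hg.counit
  refine (elComp_assoc _ _ _).trans ((congrArg (elComp h) ?_).trans (elComp_eId h))
  exact (fEl_elComp _ _ _).symm.trans ((congrArg (fEl H.toFunctor) hg).trans (fEl_eId _ x))

lemma isCoaction_comp (hg : G.IsCoaction g) (hh : H.IsCoaction h) (c : d.Compat g h) :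
    d.comonad.IsCoaction (elComp h (fEl H.toFunctor g)) where
  counit := by
    have e : elComp (elComp (elComp h (fEl H.toFunctor g)) (fEl H.toFunctor (G.ε.app x)))
        (H.ε.app x) = eId V x :=
      (congrArg (fun a => elComp a (H.ε.app x)) (rightPart_comp hg)).trans hh.counit
    exact (elComp_assoc _ _ _).symm.trans e
  coassoc := (coassoc_of_compat_aux (dG := G.δ.app) (dH := H.δ.app) (k := d.κ.app) (δ_el H)
    d.κ_el hg.coassoc hh.coassoc c).trans (congrArg (elComp _) (Category.assoc _ _ _))

end

section Hom

variable {x y : M} {W : V} (k : W ⟶ (x ⟶ᵥ y))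

/-- A generalised element `k` of `M(x, y)` that commutes with coactions of `G` and of `H` commutes
with the composites `h ; H g`. -/
lemma commutes_comp {g : 𝟙_ V ⟶ (x ⟶ᵥ G.toFunctor.obj x)} {h : 𝟙_ V ⟶ (x ⟶ᵥ H.toFunctor.obj x)}
    {g' : 𝟙_ V ⟶ (y ⟶ᵥ G.toFunctor.obj y)} {h' : 𝟙_ V ⟶ (y ⟶ᵥ H.toFunctor.obj y)}
    (eg : k ≫ ePost x g' = (k ≫ G.toFunctor.map x y) ≫ ePre g _)
    (eh : k ≫ ePost x h' = (k ≫ H.toFunctor.map x y) ≫ ePre h _) :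
    k ≫ ePost x (elComp h' (fEl H.toFunctor g')) =
      ((k ≫ G.toFunctor.map x y) ≫ H.toFunctor.map _ _) ≫ ePre (elComp h (fEl H.toFunctor g)) _ :=
  ePost_ePre_comp eh (ePost_ePre_map H.toFunctor eg)

variable {γ : 𝟙_ V ⟶ (x ⟶ᵥ H.toFunctor.obj (G.toFunctor.obj x))}
  {γ' : 𝟙_ V ⟶ (y ⟶ᵥ H.toFunctor.obj (G.toFunctor.obj y))}

lemma commutes_leftPart
    (e : k ≫ ePost x γ' = ((k ≫ G.toFunctor.map x y) ≫ H.toFunctor.map _ _) ≫ ePre γ _) :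
    k ≫ ePost x (leftPart G H γ') =
    (k ≫ G.toFunctor.map x y) ≫ ePre (leftPart G H γ) _ := by
  refine ePost_ePre_comp e ?_
  have h := (k ≫ G.toFunctor.map x y) ≫= GNat.el_naturality H.ε (G.toFunctor.obj x)
    (G.toFunctor.obj y)
  exact (Category.assoc _ _ _).trans (h.trans (_ ≫= Category.id_comp _))

lemma commutes_rightPart
    (e : k ≫ ePost x γ' = ((k ≫ G.toFunctor.map x y) ≫ H.toFunctor.map _ _) ≫ ePre γ _) :
    k ≫ ePost x (rightPart G H γ') =
    (k ≫ H.toFunctor.map x y) ≫ ePre (rightPart G H γ) _ := by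
  refine ePost_ePre_comp e (ePost_ePre_map H.toFunctor ?_)
  exact (Category.assoc _ _ _).trans ((k ≫= GNat.el_naturality G.ε x y).trans
    (_ ≫= Category.id_comp _))

end Hom

end DistribLaw

end CompositeCoalgebras

/-! ### Left Tambara modules as coalgebras -/

section LeftTambaraCoaction

variable {V : Type u} [Category.{v} V] [MonoidalCategory V] [SymmetricCategory V]
  [MonoidalClosed V]

@[ext]
lemma LeftTambara.ext {A : Type u₁} [EnrichedCategory V A] {M : MonoidalVCat V A}
    {T : EnrichedFunctor V (TensorCat Aᵒᵖ A) V} {a b : LeftTambara M T}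
    (h : ∀ B X Y, a.α B X Y = b.α B X Y) : a = b := by
  obtain ⟨α, _, _, _, _, _⟩ := a
  obtain ⟨β, _, _, _, _, _⟩ := b
  obtain rfl : α = β := by
    funext B X Y
    exact h B X Y
  rfl

/-- A family that is natural in each variable separately is natural on `Aᵒᵖ ⊗ A`, since every hom
of `Aᵒᵖ ⊗ A` factors through its two variables. -/
lemma act_naturality_of_separate {A : Type u₁} [EnrichedCategory V A]
    {S T : EnrichedFunctor V (TensorCat Aᵒᵖ A) V} (k : ∀ X Y, S.obj (pr X Y) ⟶ T.obj (pr X Y))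
    (hL : ∀ X X' Y, actL S Y (𝟙 (X' ⟶ᵥ X)) ≫ k X' Y = k X Y ▷ _ ≫ actL T Y (𝟙 (X' ⟶ᵥ X)))
    (hR : ∀ X Y Y', actR S X (𝟙 (Y ⟶ᵥ Y')) ≫ k X Y' = k X Y ▷ _ ≫ actR T X (𝟙 (Y ⟶ᵥ Y')))
    (X Y X' Y' : A) :
    act S (pr X Y) (pr X' Y') ≫ k X' Y' = k X Y ▷ _ ≫ act T (pr X Y) (pr X' Y') := by
  have e (F : EnrichedFunctor V (TensorCat Aᵒᵖ A) V) : act F (pr X Y) (pr X' Y') =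
      (α_ _ _ _).inv ≫ actL F Y (𝟙 (X' ⟶ᵥ X)) ▷ _ ≫ actR F X' (𝟙 (Y ⟶ᵥ Y')) := by
    have h := insL_insR V (Opposite.op X) (Opposite.op X') Y Y'
    rw [act_eq_actOn, actL, actR, elL, elR, Category.id_comp, Category.id_comp]
    exact (congrArg (actOn F) h).symm.trans (actOn_comp F _ _)
  rw [e, e, Category.assoc, Category.assoc, hR, ← comp_whiskerRight_assoc, hL,
    comp_whiskerRight_assoc, ← associator_inv_naturality_left_assoc]
  rfl

variable [HasLimits V] {A : Type v} [EnrichedCategory V A] {M : MonoidalVCat V A}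
  {T T' : EnrichedFunctor V (TensorCat Aᵒᵖ A) V}

variable (M) in
/-- The families `T(X, Y) ⟶ T(B ⊗ X, B ⊗ Y)` underlying `T ⟶ Θ T`. -/
def coactionα (γ : 𝟙_ V ⟶ natObj T (thetaFun M.tensor T)) (B X Y : A) :
    T.obj (pr X Y) ⟶ T.obj (pr (M.tensor.obj ⟨B, X⟩) (M.tensor.obj ⟨B, Y⟩)) :=
  nEl γ (pr X Y) ≫ thπ M.tensor T X Y B

/-- The left Tambara module given by a coalgebra. -/
def LeftTambara.ofCoaction (γ : 𝟙_ V ⟶ natObj T (thetaFun M.tensor T))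
    (hγ : M.thetaComonad.IsCoaction (x := T) γ) : LeftTambara M T where
  α := coactionα M γ
  natural_left B X X' Y := by
    have h := nEl_naturality γ (elL Y (𝟙 (X' ⟶ᵥ X)))
    have h' := thπ_actL (t := M.tensor) (T := T) (Y := Y) (𝟙 (X' ⟶ᵥ X)) B
    rw [Category.id_comp] at h'
    rw [coactionα, coactionα, comp_whiskerRight, Category.assoc, ← h', ← Category.assoc]
    exact (h =≫ _).trans (Category.assoc _ _ _)
  natural_right B X Y Y' := by
    have h := nEl_naturality γ (elR X (𝟙 (Y ⟶ᵥ Y')))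
    have h' := thπ_actR (t := M.tensor) (T := T) (X := X) (𝟙 (Y ⟶ᵥ Y')) B
    rw [Category.id_comp] at h'
    rw [coactionα, coactionα, comp_whiskerRight, Category.assoc, ← h', ← Category.assoc]
    exact (h =≫ _).trans (Category.assoc _ _ _)
  extranatural X Y B B' := (thπ_wedge X Y).pre (nEl γ (pr X Y)) B B'
  unit X Y := by
    have h := (nEl_elComp γ (M.thetaε T) (pr X Y)).symm.trans
      ((congrArg (fun a => nEl a (pr X Y)) hγ.counit).trans (nEl_eId T (pr X Y)))
    rw [MonoidalVCat.nEl_thetaε] at h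
    rw [coactionα, Category.assoc, h]
  assoc B B' X Y := by
    have h : nEl γ (pr X Y) ≫ nEl (M.thetaδ T) (pr X Y) =
        nEl γ (pr X Y) ≫ nEl (γ ≫ thetaMap M.tensor T (thetaFun M.tensor T)) (pr X Y) :=
      (nEl_elComp _ _ (pr X Y)).symm.trans
        ((congrArg (fun a => nEl a (pr X Y)) hγ.coassoc).trans (nEl_elComp _ _ (pr X Y)))
    have h' := h =≫ (thπ M.tensor (thetaFun M.tensor T) X Y B' ≫
      thπ M.tensor T (M.tensor.obj ⟨B', X⟩) (M.tensor.obj ⟨B', Y⟩) B)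
    rw [Category.assoc, Category.assoc, MonoidalVCat.nEl_thetaδ, MonoidalVCat.thetaδApp_π,
      thetaMap_nEl_assoc] at h'
    rw [coactionα, coactionα, coactionα, Category.assoc, h', Category.assoc]

namespace LeftTambara

lemma wedge (a : LeftTambara M T) (X Y : A) : Wedge M.tensor T X Y (fun B => a.α B X Y) :=
  a.extranatural X Y

/-- The components of the morphism `T ⟶ Θ T` given by a left Tambara module structure. -/
def coactionApp (a : LeftTambara M T) (X Y : A) :
    T.obj (pr X Y) ⟶ (thetaFun M.tensor T).obj (pr X Y) :=
  thLift (fun B => a.α B X Y) (a.wedge X Y)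

lemma coactionApp_π (a : LeftTambara M T) (B X Y : A) :
    a.coactionApp X Y ≫ thπ M.tensor T X Y B = a.α B X Y :=
  thLift_π _ _ B

/-- The morphism `T ⟶ Θ T` given by a left Tambara module structure. -/
def coaction (a : LeftTambara M T) : 𝟙_ V ⟶ natObj T (thetaFun M.tensor T) :=
  elNat (fun c => a.coactionApp c.fst.unop c.snd) (by
    rintro ⟨⟨X⟩, Y⟩ ⟨⟨X'⟩, Y'⟩
    refine act_naturality_of_separate (S := T) (T := thetaFun M.tensor T) a.coactionApp
      ?_ ?_ X Y X' Y'
    · intro X X' Y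
      apply th_ext; intro B
      rw [Category.assoc, Category.assoc, coactionApp_π, thπ_actL, ← comp_whiskerRight_assoc,
        coactionApp_π, Category.id_comp, a.natural_left]
    · intro X Y Y'
      apply th_ext; intro B
      rw [Category.assoc, Category.assoc, coactionApp_π, thπ_actR, ← comp_whiskerRight_assoc,
        coactionApp_π, Category.id_comp, a.natural_right])

/-- The components of the coaction are the morphisms `α`. -/
lemma coactionα_coaction (a : LeftTambara M T) (B X Y : A) :
    coactionα M a.coaction B X Y = a.α B X Y := by
  rw [coactionα, coaction, nEl_elNat]
  exact a.coactionApp_π B X Y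

lemma coaction_thπ (a : LeftTambara M T) (B X Y : A) :
    nEl a.coaction (pr X Y) ≫ thπ M.tensor T X Y B = a.α B X Y :=
  a.coactionα_coaction B X Y

lemma coaction_thπ_assoc (a : LeftTambara M T) (B X Y : A) {U : V}
    (h : T.obj (pr (M.tensor.obj ⟨B, X⟩) (M.tensor.obj ⟨B, Y⟩)) ⟶ U) :
    nEl a.coaction (pr X Y) ≫ thπ M.tensor T X Y B ≫ h = a.α B X Y ≫ h := by
  rw [← Category.assoc, coaction_thπ]

lemma isCoaction_coaction (a : LeftTambara M T) :
    M.thetaComonad.IsCoaction (x := T) a.coaction where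
  counit := by
    apply nEl_ext
    rintro ⟨⟨X⟩, Y⟩
    refine (nEl_elComp a.coaction (M.thetaε T) (pr X Y)).trans (Eq.trans ?_
      (nEl_eId T (pr X Y)).symm)
    rw [MonoidalVCat.nEl_thetaε, coaction_thπ_assoc, a.unit]
  coassoc := by
    apply nEl_ext
    rintro ⟨⟨X⟩, Y⟩
    refine (nEl_elComp _ _ (pr X Y)).trans (Eq.trans ?_ (nEl_elComp _ _ (pr X Y)).symm)
    change nEl a.coaction (pr X Y) ≫ nEl (M.thetaδ T) (pr X Y) = nEl a.coaction (pr X Y) ≫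
      nEl (a.coaction ≫ thetaMap M.tensor T (thetaFun M.tensor T)) (pr X Y)
    apply th_ext₂; intro B' B
    rw [Category.assoc, Category.assoc, MonoidalVCat.nEl_thetaδ, MonoidalVCat.thetaδApp_π,
      thetaMap_nEl_assoc, coaction_thπ_assoc, coaction_thπ_assoc, coaction_thπ, a.assoc]

lemma ofCoaction_coaction (a : LeftTambara M T) :
    ofCoaction a.coaction a.isCoaction_coaction = a :=
  LeftTambara.ext a.coactionα_coaction

end LeftTambara

/-- A morphism `T ⟶ Θ T` is determined by its components. -/
lemma eq_of_coactionα {γ γ' : 𝟙_ V ⟶ natObj T (thetaFun M.tensor T)}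
    (h : ∀ B X Y, coactionα M γ B X Y = coactionα M γ' B X Y) : γ = γ' := by
  apply nEl_ext
  rintro ⟨⟨X⟩, Y⟩
  exact th_ext fun B => h B X Y

lemma LeftTambara.coaction_ofCoaction (γ : 𝟙_ V ⟶ natObj T (thetaFun M.tensor T))
    (hγ : M.thetaComonad.IsCoaction (x := T) γ) : (LeftTambara.ofCoaction γ hγ).coaction = γ :=
  eq_of_coactionα (LeftTambara.coactionα_coaction _)

/-- A generalised element `k` of `[Aᵒᵖ ⊗ A, V](T, T')` commutes with two coactions exactly when it
lies in the equalizers defining the hom-object of left Tambara modules: both conditions say that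
`k` commutes with the families `T(X, Y) ⟶ T(B ⊗ X, B ⊗ Y)`. -/
lemma commutes_coaction_iff (γ : 𝟙_ V ⟶ natObj T (thetaFun M.tensor T))
    (γ' : 𝟙_ V ⟶ natObj T' (thetaFun M.tensor T')) {W : V} (k : W ⟶ natObj T T') :
    k ≫ ePost T (y := T') (z := thetaFun M.tensor T') γ' =
        (k ≫ thetaMap M.tensor T T') ≫ ePre (x := T) (y := thetaFun M.tensor T) γ
          (thetaFun M.tensor T') ↔
      ∀ B X Y, k ≫ natπ T T' (pr (M.tensor.obj ⟨B, X⟩) (M.tensor.obj ⟨B, Y⟩)) ≫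
          ePre (elV (coactionα M γ B X Y)) _ =
        k ≫ natπ T T' (pr X Y) ≫ ePost _ (elV (coactionα M γ' B X Y)) := by
  have h₁ (B X Y : A) : MonoidalClosed.uncurry
      (k ≫ natπ T T' (pr (M.tensor.obj ⟨B, X⟩) (M.tensor.obj ⟨B, Y⟩)) ≫
        ePre (elV (coactionα M γ B X Y)) _) =
      nev ((k ≫ thetaMap M.tensor T T') ≫ ePre (x := T) (y := thetaFun M.tensor T) γ
        (thetaFun M.tensor T')) (pr X Y) ≫ thπ M.tensor T' X Y B := by
    rw [← Category.assoc k, uncurry_ePre, vEl_elV, nev_ePre, Category.assoc, thetaMap_nev,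
      coactionα, comp_whiskerRight, Category.assoc]
    rfl
  have h₂ (B X Y : A) : MonoidalClosed.uncurry
      (k ≫ natπ T T' (pr X Y) ≫ ePost _ (elV (coactionα M γ' B X Y))) =
      nev (k ≫ ePost T (y := T') (z := thetaFun M.tensor T') γ') (pr X Y) ≫
        thπ M.tensor T' X Y B := by
    rw [← Category.assoc k, uncurry_ePost, vEl_elV, nev_ePost, Category.assoc]
    rfl
  refine ⟨fun e B X Y => uncurry_injective' ?_, fun e => nev_ext ?_⟩
  · rw [h₁, h₂, e]
  · rintro ⟨⟨X⟩, Y⟩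
    refine th_ext fun B => ?_
    rw [← h₁, ← h₂, e]

end LeftTambaraCoaction

/-! ### Tambara modules as coalgebras -/

section TambaraCoalgebra

variable {V : Type u} [Category.{v} V] [MonoidalCategory V] [SymmetricCategory V]
  [MonoidalClosed V] [HasLimits V] {A : Type v} [EnrichedCategory V A]

/-- Compatibility of two coactions with the distributive law is the compatibility condition for
the corresponding left and right Tambara module structures. -/
lemma Interchange.compat_iff {M N : MonoidalVCat V A} (D : Interchange M N)
    {T : EnrichedFunctor V (TensorCat Aᵒᵖ A) V} (g : 𝟙_ V ⟶ natObj T (thetaFun M.tensor T))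
    (h : 𝟙_ V ⟶ natObj T (thetaFun N.tensor T)) :
    D.distribLaw.Compat (x := T) g h ↔ ∀ B B' X Y : A,
      coactionα M g B X Y ≫ coactionα N h B' (M.tensor.obj ⟨B, X⟩) (M.tensor.obj ⟨B, Y⟩) =
        coactionα N h B' X Y ≫
          coactionα M g B (N.tensor.obj ⟨B', X⟩) (N.tensor.obj ⟨B', Y⟩) ≫
          mapLR T (D.hom B X B') (D.inv B Y B') := by
  let l : 𝟙_ V ⟶ natObj T (thetaFun M.tensor (thetaFun N.tensor T)) :=
    elComp (x := T) (y := thetaFun M.tensor T) (z := thetaFun M.tensor (thetaFun N.tensor T)) g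
      (h ≫ thetaMap M.tensor T (thetaFun N.tensor T))
  let r : 𝟙_ V ⟶ natObj T (thetaFun M.tensor (thetaFun N.tensor T)) :=
    elComp (x := T) (y := thetaFun N.tensor T) (z := thetaFun M.tensor (thetaFun N.tensor T)) h
      (elComp (x := thetaFun N.tensor T) (y := thetaFun N.tensor (thetaFun M.tensor T))
        (z := thetaFun M.tensor (thetaFun N.tensor T))
        (g ≫ thetaMap N.tensor T (thetaFun M.tensor T)) (D.κEl T))
  have hl (B B' X Y : A) : nEl l (pr X Y) ≫ thπ M.tensor (thetaFun N.tensor T) X Y B ≫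
      thπ N.tensor T (M.tensor.obj ⟨B, X⟩) (M.tensor.obj ⟨B, Y⟩) B' =
      coactionα M g B X Y ≫ coactionα N h B' (M.tensor.obj ⟨B, X⟩) (M.tensor.obj ⟨B, Y⟩) := by
    rw [nEl_elComp, Category.assoc, thetaMap_nEl_assoc, coactionα, coactionα, Category.assoc]
  have hr (B B' X Y : A) : nEl r (pr X Y) ≫ thπ M.tensor (thetaFun N.tensor T) X Y B ≫
      thπ N.tensor T (M.tensor.obj ⟨B, X⟩) (M.tensor.obj ⟨B, Y⟩) B' =
      coactionα N h B' X Y ≫ coactionα M g B (N.tensor.obj ⟨B', X⟩) (N.tensor.obj ⟨B', Y⟩) ≫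
        mapLR T (D.hom B X B') (D.inv B Y B') := by
    rw [nEl_elComp, nEl_elComp, nEl_κEl, Category.assoc, Category.assoc, κApp_π,
      thetaMap_nEl_assoc, coactionα, coactionα, Category.assoc, Category.assoc]
  change l = r ↔ _
  constructor
  · intro e B B' X Y
    rw [← hl, ← hr, e]
  · intro e
    apply nEl_ext
    rintro ⟨⟨X⟩, Y⟩
    refine th_ext₂ fun B B' => ?_
    rw [hl, hr, e]

variable {M : MonoidalVCat V A}

/-- The equalizer condition for hom-objects of left Tambara modules, for the coactions they
define. -/
lemma LeftTambara.commutes_iff {T T' : EnrichedFunctor V (TensorCat Aᵒᵖ A) V}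
    (a : LeftTambara M T) (b : LeftTambara M T') {W : V} (k : W ⟶ natObj T T') :
    k ≫ ePost T (y := T') (z := thetaFun M.tensor T') b.coaction =
        (k ≫ thetaMap M.tensor T T') ≫ ePre (x := T) (y := thetaFun M.tensor T) a.coaction
          (thetaFun M.tensor T') ↔
      ∀ B X Y, k ≫ natπ T T' (pr (M.tensor.obj ⟨B, X⟩) (M.tensor.obj ⟨B, Y⟩)) ≫
          ePre (elV (a.α B X Y)) _ = k ≫ natπ T T' (pr X Y) ≫ ePost _ (elV (b.α B X Y)) := by
  rw [commutes_coaction_iff]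
  simp only [coactionα_coaction]

variable (M)

/-- The left Tambara module underlying a `Θₗ`-coalgebra. -/
def LTamb.ofCoalgebra (x : M.thetaL.Coalgebra) : LTamb M :=
  ⟨x.obj, LeftTambara.ofCoaction x.coact x.isCoaction⟩

/-- The `Θₗ`-coalgebra given by a left Tambara module. -/
def LTamb.toCoalgebra (a : LTamb M) : M.thetaL.Coalgebra :=
  ⟨a.T, a.left.coaction, a.left.isCoaction_coaction.counit, a.left.isCoaction_coaction.coassoc⟩

/-- The right Tambara module underlying a `Θᵣ`-coalgebra. -/
def RTamb.ofCoalgebra (x : M.thetaR.Coalgebra) : RTamb M :=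
  ⟨x.obj, LeftTambara.ofCoaction (M := M.rev) x.coact x.isCoaction⟩

/-- The `Θᵣ`-coalgebra given by a right Tambara module. -/
def RTamb.toCoalgebra (a : RTamb M) : M.thetaR.Coalgebra :=
  ⟨a.T, a.right.coaction, a.right.isCoaction_coaction.counit,
    a.right.isCoaction_coaction.coassoc⟩

/-- The Tambara module underlying a `Θ`-coalgebra. -/
def Tamb.ofCoalgebra (x : M.thetaLR.Coalgebra) : Tamb M where
  T := x.obj
  left := LeftTambara.ofCoaction (DistribLaw.leftPart M.thetaL M.thetaR x.coact)
    (DistribLaw.isCoaction_leftPart x.isCoaction)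
  right := LeftTambara.ofCoaction (M := M.rev) (DistribLaw.rightPart M.thetaL M.thetaR x.coact)
    (DistribLaw.isCoaction_rightPart x.isCoaction)
  compat := (M.interchange.compat_iff _ _).1 (DistribLaw.compat_parts x.isCoaction)

variable {M} in
lemma Tamb.compat_coaction (a : Tamb M) :
    M.interchange.distribLaw.Compat (x := a.T) a.left.coaction a.right.coaction := by
  refine (M.interchange.compat_iff _ _).2 fun B B' X Y => ?_
  simp only [LeftTambara.coactionα_coaction]
  exact a.compat B B' X Y

variable {M} in
lemma Tamb.isCoaction_comp (a : Tamb M) : M.thetaLR.IsCoaction (x := a.T)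
    (elComp (x := a.T) a.right.coaction (fEl M.thetaR.toFunctor a.left.coaction)) :=
  DistribLaw.isCoaction_comp a.left.isCoaction_coaction a.right.isCoaction_coaction
    a.compat_coaction

/-- The `Θ`-coalgebra `T ⟶ Θᵣ T ⟶ Θᵣ Θₗ T` given by a Tambara module. -/
def Tamb.toCoalgebra (a : Tamb M) : M.thetaLR.Coalgebra :=
  ⟨a.T, elComp (x := a.T) a.right.coaction (fEl M.thetaR.toFunctor a.left.coaction),
    a.isCoaction_comp.counit, a.isCoaction_comp.coassoc⟩

variable {M}

lemma VComonad.Coalgebra.mk_eq {N : Type u₁} [EnrichedCategory V N] {G : VComonad (V := V) N}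
    {x : N} {γ γ' : 𝟙_ V ⟶ (x ⟶ᵥ G.toFunctor.obj x)} (h : γ = γ') (p q p' q') :
    (⟨x, γ, p, q⟩ : G.Coalgebra) = ⟨x, γ', p', q'⟩ := by
  subst h
  rfl

/-- The equalizer condition for morphisms of coalgebras. -/
lemma VComonad.coalgebra_condition {N : Type u₁} [EnrichedCategory V N] (G : VComonad (V := V) N)
    (x y : G.Coalgebra) : G.coalgebraCut.ι x y ≫ ePost x.obj y.coact =
      (G.coalgebraCut.ι x y ≫ G.toFunctor.map x.obj y.obj) ≫
        ePre x.coact (G.toFunctor.obj y.obj) :=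
  (G.coalgebraCut.condition x y ⟨⟩).trans (Category.assoc _ _ _).symm

variable (M)

theorem exists_vCatIso_lTamb : ∃ K : VCatIso (V := V) M.thetaL.Coalgebra (LTamb M),
    K.hom.comp V (LTamb.forget M) = M.thetaL.forget := by
  refine exists_vCatIso_over
    (fun x y => inferInstanceAs (Mono (M.thetaL.coalgebraCut.ι x y)))
    (fun x y => inferInstanceAs (Mono ((LTamb.cut M).ι x y)))
    ((LTamb.cut M).liftFunctor (LTamb.ofCoalgebra M) (M.thetaL.forget).map
      (M.thetaL.forget).map_id (M.thetaL.forget).map_comp fun x y i =>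
        (commutes_coaction_iff (M := M) x.coact y.coact (M.thetaL.coalgebraCut.ι x y)).1
          (M.thetaL.coalgebra_condition x y) i.1 i.2.1 i.2.2)
    (M.thetaL.coalgebraCut.liftFunctor (LTamb.toCoalgebra M) (LTamb.forget M).map
      (LTamb.forget M).map_id (LTamb.forget M).map_comp fun a b _ =>
        ((a.left.commutes_iff b.left ((LTamb.cut M).ι a b)).2 fun B X Y =>
          (LTamb.cut M).condition a b ⟨B, X, Y⟩).trans (Category.assoc _ _ _))
    ((LTamb.cut M).liftFunctor_comp_forget _ _ _ _ _)
    (M.thetaL.coalgebraCut.liftFunctor_comp_forget _ _ _ _ _) (fun x => ?_) (fun a => ?_)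
  · exact VComonad.Coalgebra.mk_eq (LeftTambara.coaction_ofCoaction x.coact x.isCoaction) _ _ _ _
  · exact congrArg (LTamb.mk a.T) a.left.ofCoaction_coaction

theorem exists_vCatIso_rTamb : ∃ K : VCatIso (V := V) M.thetaR.Coalgebra (RTamb M),
    K.hom.comp V (RTamb.forget M) = M.thetaR.forget := by
  refine exists_vCatIso_over
    (fun x y => inferInstanceAs (Mono (M.thetaR.coalgebraCut.ι x y)))
    (fun x y => inferInstanceAs (Mono ((RTamb.cut M).ι x y)))
    ((RTamb.cut M).liftFunctor (RTamb.ofCoalgebra M) (M.thetaR.forget).map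
      (M.thetaR.forget).map_id (M.thetaR.forget).map_comp fun x y i =>
        (commutes_coaction_iff (M := M.rev) x.coact y.coact (M.thetaR.coalgebraCut.ι x y)).1
          (M.thetaR.coalgebra_condition x y) i.1 i.2.1 i.2.2)
    (M.thetaR.coalgebraCut.liftFunctor (RTamb.toCoalgebra M) (RTamb.forget M).map
      (RTamb.forget M).map_id (RTamb.forget M).map_comp fun a b _ =>
        ((a.right.commutes_iff b.right ((RTamb.cut M).ι a b)).2 fun B X Y =>
          (RTamb.cut M).condition a b ⟨B, X, Y⟩).trans (Category.assoc _ _ _))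
    ((RTamb.cut M).liftFunctor_comp_forget _ _ _ _ _)
    (M.thetaR.coalgebraCut.liftFunctor_comp_forget _ _ _ _ _) (fun x => ?_) (fun a => ?_)
  · exact VComonad.Coalgebra.mk_eq
      (LeftTambara.coaction_ofCoaction (M := M.rev) x.coact x.isCoaction) _ _ _ _
  · exact congrArg (RTamb.mk a.T) a.right.ofCoaction_coaction

lemma Tamb.mk_eq {T : EnrichedFunctor V (TensorCat Aᵒᵖ A) V} {l l' : LeftTambara M T}
    {r r' : RightTambara M T} (hl : l = l') (hr : r = r') (c c') :
    (⟨T, l, r, c⟩ : Tamb M) = ⟨T, l', r', c'⟩ := by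
  subst hl hr
  rfl

lemma LeftTambara.ofCoaction_eq {T : EnrichedFunctor V (TensorCat Aᵒᵖ A) V} (a : LeftTambara M T)
    {γ : 𝟙_ V ⟶ natObj T (thetaFun M.tensor T)} (h : γ = a.coaction) (hγ) :
    LeftTambara.ofCoaction γ hγ = a := by
  subst h
  exact a.ofCoaction_coaction

lemma Tamb.toCoalgebra_ofCoalgebra (x : M.thetaLR.Coalgebra) :
    Tamb.toCoalgebra M (Tamb.ofCoalgebra M x) = x := by
  refine VComonad.Coalgebra.mk_eq (Eq.trans ?_ (DistribLaw.rightPart_leftPart x.isCoaction)) _ _ _ _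
  have hl := LeftTambara.coaction_ofCoaction (DistribLaw.leftPart M.thetaL M.thetaR x.coact)
    (DistribLaw.isCoaction_leftPart x.isCoaction)
  have hr := LeftTambara.coaction_ofCoaction (M := M.rev)
    (DistribLaw.rightPart M.thetaL M.thetaR x.coact)
    (DistribLaw.isCoaction_rightPart x.isCoaction)
  exact congrArg₂ (fun (r : 𝟙_ V ⟶ (x.obj ⟶ᵥ M.thetaR.toFunctor.obj x.obj))
    (l : 𝟙_ V ⟶ (x.obj ⟶ᵥ M.thetaL.toFunctor.obj x.obj)) =>
      elComp r (fEl M.thetaR.toFunctor l)) hr hl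

lemma Tamb.ofCoalgebra_toCoalgebra (a : Tamb M) :
    Tamb.ofCoalgebra M (Tamb.toCoalgebra M a) = a := by
  have hl := DistribLaw.leftPart_comp (G := M.thetaL) (H := M.thetaR) (x := a.T)
    (g := a.left.coaction) a.right.isCoaction_coaction
  have hr := DistribLaw.rightPart_comp (G := M.thetaL) (H := M.thetaR) (x := a.T)
    (h := a.right.coaction) a.left.isCoaction_coaction
  refine Tamb.mk_eq M (a.left.ofCoaction_eq M ?_ _) (a.right.ofCoaction_eq M.rev ?_ _) _ _
  · exact hl
  · exact hr

theorem exists_vCatIso_tamb : ∃ K : VCatIso (V := V) M.thetaLR.Coalgebra (Tamb M),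
    K.hom.comp V (Tamb.forget M) = M.thetaLR.forget := by
  have hc (x y : M.thetaLR.Coalgebra) :=
    (M.thetaLR.coalgebra_condition x y).trans
      (congrArg (· ≫ ePre x.coact (M.thetaLR.toFunctor.obj y.obj)) (Category.assoc _ _ _).symm)
  refine exists_vCatIso_over
    (fun x y => inferInstanceAs (Mono (M.thetaLR.coalgebraCut.ι x y)))
    (fun x y => inferInstanceAs (Mono ((Tamb.cut M).ι x y)))
    ((Tamb.cut M).liftFunctor (Tamb.ofCoalgebra M) (M.thetaLR.forget).map
      (M.thetaLR.forget).map_id (M.thetaLR.forget).map_comp fun x y i => ?_)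
    (M.thetaLR.coalgebraCut.liftFunctor (Tamb.toCoalgebra M) (Tamb.forget M).map
      (Tamb.forget M).map_id (Tamb.forget M).map_comp fun a b _ => ?_)
    ((Tamb.cut M).liftFunctor_comp_forget _ _ _ _ _)
    (M.thetaLR.coalgebraCut.liftFunctor_comp_forget _ _ _ _ _)
    (Tamb.toCoalgebra_ofCoalgebra M) (Tamb.ofCoalgebra_toCoalgebra M)
  · rcases i with i | i
    · exact (commutes_coaction_iff (M := M) (DistribLaw.leftPart M.thetaL M.thetaR x.coact)
        (DistribLaw.leftPart M.thetaL M.thetaR y.coact) (M.thetaLR.coalgebraCut.ι x y)).1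
        (DistribLaw.commutes_leftPart _ (hc x y)) i.1 i.2.1 i.2.2
    · exact (commutes_coaction_iff (M := M.rev) (DistribLaw.rightPart M.thetaL M.thetaR x.coact)
        (DistribLaw.rightPart M.thetaL M.thetaR y.coact) (M.thetaLR.coalgebraCut.ι x y)).1
        (DistribLaw.commutes_rightPart _ (hc x y)) i.1 i.2.1 i.2.2
  · have hl := (a.left.commutes_iff b.left ((Tamb.cut M).ι a b)).2 fun B X Y =>
      (Tamb.cut M).condition a b (Sum.inl ⟨B, X, Y⟩)
    have hr := (a.right.commutes_iff b.right ((Tamb.cut M).ι a b)).2 fun B X Y =>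
      (Tamb.cut M).condition a b (Sum.inr ⟨B, X, Y⟩)
    have h := DistribLaw.commutes_comp (G := M.thetaL) (H := M.thetaR) (x := a.T) (y := b.T)
      ((Tamb.cut M).ι a b) hl hr
    exact h.trans ((Category.assoc _ _ _ =≫ _).trans (Category.assoc _ _ _))

end TambaraCoalgebra

end VTamb

end

theorem mainTheorem5 {V : Type u} [Category.{v} V] [MonoidalCategory V] [SymmetricCategory V]
    [MonoidalClosed V] [HasLimits V] {A : Type v} [EnrichedCategory V A]
    (M : VTamb.MonoidalVCat V A) :
    (∃ K : VTamb.VCatIso (V := V) M.thetaL.Coalgebra (VTamb.LTamb M),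
      K.hom.comp V (VTamb.LTamb.forget M) = M.thetaL.forget) ∧
    (∃ K : VTamb.VCatIso (V := V) M.thetaR.Coalgebra (VTamb.RTamb M),
      K.hom.comp V (VTamb.RTamb.forget M) = M.thetaR.forget) ∧
    (∃ K : VTamb.VCatIso (V := V) M.thetaLR.Coalgebra (VTamb.Tamb M),
      K.hom.comp V (VTamb.Tamb.forget M) = M.thetaLR.forget) :=
  ⟨VTamb.exists_vCatIso_lTamb M, VTamb.exists_vCatIso_rTamb M, VTamb.exists_vCatIso_tamb M⟩
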